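/- **Setting.** Let $d\in\{1,2,3\}$ and let $\Omega\subset\mathbb R^d$ be a bounded Lipschitz domain. Let $\Gamma_D,\Gamma_N,\Gamma_R$ be disjoint measurable sets with $\partial\Omega=\overline{\Gamma_D\cup\Gamma_N\cup\Gamma_R}$ and $|\Gamma_R|>0$ (surface measure). All function spaces are complex valued. Put $V=\{v\in W^{1,2}(\Omega): v=0\text{ on }\Gamma_D\}$ and, for $\kappa>0$, $$\|v\|_V=\big(\kappa^2\|v\|_{L^2(\Omega)}^2+\|\nabla v\|_{L^2(\Omega)}^2\big)^{1/2},\qquad a(u,v)=(\nabla u,\nabla v)_{\Omega}-\kappa^2(u,v)_{\Omega}-i\kappa\,(u,v)_{\Gamma_R},$$ where $(u,v)_{\Omega}=\int_\Omega u\bar v\,dx$ and $(u,v)_{\Gamma_R}=\int_{\Gamma_R}u\bar v\,ds$. Let $\mathcal T_H$ be a regular simplicial mesh of $\Omega$ such that $\overline{\Gamma_D}$ is a union of $(d-1)$-dimensional faces. Let $H_T$ be the diameter of $T\in\mathcal T_H$, $H=\max_T H_T$, $\Omega_{T,1}$ the union of the elements that meet $T$, and $C_{\rm ol}$ the maximal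 number, over $T$, of elements that meet $T$ (including $T$). Let $V_H=\{v\in V: v|_T\text{ is affine for all }T\in\mathcal T_H\}$, let $\mathcal N_H$ be the set of mesh vertices not in $\overline{\Gamma_D}$, $\phi_z$ the nodal hat function of $z$, and $$\mathcal I_Hv=\sum_{z\in\mathcal N_H}\frac{(v,\phi_z)_\Omega}{(1,\phi_z)_\Omega}\,\phi_z ,\qquad W=\{w\in V:\mathcal I_Hw=0\}.$$ **Constants.** Let $C_a$, $C_{\rm st}(\kappa)$, $C_{\mathcal I_H}$ be any constants such that * $|a(u,v)|\le C_a\|u\|_V\|v\|_V$ for all $u,v\in V$; * $\|u\|_V\le C_{\rm st}(\kappa)\|f\|_{L^2(\Omega)}$ whenever $f\in L^2(\Omega)$ and $u\in V$ satisfies $a(u,v)=(f,v)_\Omega$ for all $v\in V$; * $H_T^{-1}\|v-\mathcal I_Hv\|_{L^2(T)}+\|\nabla(v-\mathcal I_Hv)\|_{L^2(T)}\le C_{\mathcal I_H}\|\nabla v\|_{L^2(\Omega_{T,1})}$ for all $v\in V$, $T\in\mathcal T_H$. Put $C_{\mathcal C}=3C_a$. **Theorem (stability).** There is a $\kappa_0>0$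 that depends only on $\Omega$ such that the following holds for every such boundary partition, mesh, wave number $\kappa>0$ and constants, provided that the resolution condition $$H\kappa\le \frac1{\sqrt{2C_{\rm ol}}\;C_{\mathcal I_H}}$$ is satisfied. For every $v\in V$ there are a unique $\mathcal C_\infty v\in W$ with $a(\mathcal C_\infty v,w)=a(v,w)$ for all $w\in W$, and a unique $\mathcal C^*_\infty v\in W$ with $a(w,\mathcal C^*_\infty v)=a(w,v)$ for all $w\in W$. If moreover $\kappa\ge\kappa_0$ or $C_{\rm st}(\kappa)\,\kappa\ge 1$, then the spaces $V_{H,\infty}=(1-\mathcal C_\infty)V_H$ and $V^*_{H,\infty}=(1-\mathcal C^*_\infty)V_H$ satisfy $$\inf_{u\in V_{H,\infty}\setminus\{0\}}\ \sup_{v\in V^*_{H,\infty}\setminus\{0\}}\ \frac{\operatorname{Re}a(u,v)}{\|u\|_V\|v\|_V}\ \ge\ \frac1{2\,C_{\mathcal C}\,C_{\rm st}(\kappa)\,\kappa}$$ (with $\inf\emptyset=+\infty$). -/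

import Mathlib

open MeasureTheory Set Filter Topology
open scoped ENNReal NNReal ContDiff

noncomputable section

namespace Helmholtz

/-- The Euclidean space `ℝ^d`. -/
abbrev Pt (d : ℕ) : Type := EuclideanSpace ℝ (Fin d)

variable {d : ℕ}

/-! ### The geometry -/

/-- A bounded Lipschitz domain: a bounded, connected (in particular non-empty) open set which near
each of its boundary points is, with respect to some unit vector `n`, the region strictly above the
graph of a Lipschitz function `γ` (only the values of `γ` on the hyperplane orthogonal to `n`
matter). -/
structure IsLipschitzDomain (Ω : Set (Pt d)) : Prop where
  isOpen : IsOpen Ω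
  isConnected : IsConnected Ω
  isBounded : Bornology.IsBounded Ω
  local_graph : ∀ x ∈ frontier Ω, ∃ (n : Pt d) (r : ℝ) (L : ℝ≥0) (γ : Pt d → ℝ),
    ‖n‖ = 1 ∧ 0 < r ∧ LipschitzWith L γ ∧
      ∀ y ∈ Metric.ball x r, y ∈ Ω ↔ γ (y - (inner ℝ n y) • n) < inner ℝ n y

/-- The surface measure on `∂Ω`: the `(d-1)`-dimensional Hausdorff measure, normalised to agree with
Lebesgue measure on hyperplanes (the counting measure if `d = 1`), restricted to `∂Ω`. -/
def surfaceMeasure (Ω : Set (Pt d)) : Measure (Pt d) :=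
  (μHE[d - 1] : Measure (Pt d)).restrict (frontier Ω)

/-- The boundary is split into a Dirichlet, a Neumann and a Robin part; the Robin part has positive
surface measure. -/
structure IsBoundaryPartition (Ω ΓD ΓN ΓR : Set (Pt d)) : Prop where
  measurableSet_D : MeasurableSet ΓD
  measurableSet_N : MeasurableSet ΓN
  measurableSet_R : MeasurableSet ΓR
  disjoint_DN : Disjoint ΓD ΓN
  disjoint_DR : Disjoint ΓD ΓR
  disjoint_NR : Disjoint ΓN ΓR
  closure_union : closure (ΓD ∪ ΓN ∪ ΓR) = frontier Ω
  robin_pos : 0 < surfaceMeasure Ω ΓR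

/-! ### Sobolev functions, traces and the Helmholtz form -/

/-- `L²(Ω)`, complex valued. -/
abbrev L2 (Ω : Set (Pt d)) : Type := Lp ℂ 2 ((volume : Measure (Pt d)).restrict Ω)

/-- `L²(Ω)^d`, complex valued. -/
abbrev L2Vec (Ω : Set (Pt d)) : Type :=
  Lp (EuclideanSpace ℂ (Fin d)) 2 ((volume : Measure (Pt d)).restrict Ω)

/-- `L²(∂Ω)`, complex valued. -/
abbrev L2Bdry (Ω : Set (Pt d)) : Type := Lp ℂ 2 (surfaceMeasure Ω)

/-- `G` is the weak gradient of `u` on `Ω`. -/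
def HasWeakGrad (Ω : Set (Pt d)) (u : L2 Ω) (G : L2Vec Ω) : Prop :=
  ∀ φ : Pt d → ℝ, ContDiff ℝ ∞ φ → HasCompactSupport φ → tsupport φ ⊆ Ω → ∀ i : Fin d,
    ∫ x in Ω, (fderiv ℝ φ x (EuclideanSpace.single i 1)) • u x = -∫ x in Ω, φ x • G x i

/-- `W^{1,2}(Ω)`. -/
def H1 (Ω : Set (Pt d)) : Set (L2 Ω) := {u | ∃ G : L2Vec Ω, HasWeakGrad Ω u G}

open Classical in
/-- The weak gradient of a function in `W^{1,2}(Ω)`. -/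
def weakGrad {Ω : Set (Pt d)} (u : L2 Ω) : L2Vec Ω :=
  if h : ∃ G : L2Vec Ω, HasWeakGrad Ω u G then h.choose else 0

/-- The classical gradient of a complex-valued function of `d` real variables. -/
def classicalGrad (φ : Pt d → ℂ) (x : Pt d) : EuclideanSpace ℂ (Fin d) :=
  WithLp.toLp 2 fun i => fderiv ℝ φ x (EuclideanSpace.single i 1)

/-- `g ∈ L²(∂Ω)` is the trace of `u ∈ W^{1,2}(Ω)`: the boundary values of some sequence of functions
smooth up to the boundary that tends to `u` in `W^{1,2}(Ω)` tend to `g` in `L²(∂Ω)`. -/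
def IsTrace (Ω : Set (Pt d)) (u : L2 Ω) (g : L2Bdry Ω) : Prop :=
  ∃ φ : ℕ → Pt d → ℂ, (∀ n, ContDiff ℝ ∞ (φ n)) ∧
    Tendsto (fun n => eLpNorm (fun x => φ n x - u x) 2 (volume.restrict Ω)) atTop (𝓝 0) ∧
    Tendsto (fun n => eLpNorm (fun x => classicalGrad (φ n) x - weakGrad u x) 2
      (volume.restrict Ω)) atTop (𝓝 0) ∧
    Tendsto (fun n => eLpNorm (fun x => φ n x - g x) 2 (surfaceMeasure Ω)) atTop (𝓝 0)

open Classical in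
/-- The trace of a function in `W^{1,2}(Ω)`; on a bounded Lipschitz domain it exists and is
unique. -/
def trace {Ω : Set (Pt d)} (u : L2 Ω) : L2Bdry Ω :=
  if h : ∃ g : L2Bdry Ω, IsTrace Ω u g then h.choose else 0

/-- `V = {v ∈ W^{1,2}(Ω) | v = 0 on Γ_D}`. -/
def V (Ω ΓD : Set (Pt d)) : Set (L2 Ω) :=
  {v | v ∈ H1 Ω ∧ ∃ g : L2Bdry Ω, IsTrace Ω v g ∧ ∀ᵐ x ∂(surfaceMeasure Ω), x ∈ ΓD → g x = 0}

/-- The `κ`-weighted norm `(κ² ‖v‖² + ‖∇v‖²)^{1/2}`. -/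
def normV {Ω : Set (Pt d)} (κ : ℝ) (v : L2 Ω) : ℝ :=
  √(κ ^ 2 * ‖v‖ ^ 2 + ‖weakGrad v‖ ^ 2)

/-- `a(u,v) = (∇u,∇v)_Ω - κ² (u,v)_Ω - iκ (u,v)_{Γ_R}`, antilinear in `v`
(Mathlib's `inner` is antilinear in its first argument). -/
def form {Ω : Set (Pt d)} (ΓR : Set (Pt d)) (κ : ℝ) (u v : L2 Ω) : ℂ :=
  inner ℂ (weakGrad v) (weakGrad u) - (κ : ℂ) ^ 2 * inner ℂ v u
    - Complex.I * κ * ∫ x in ΓR, trace u x * (starRingEnd ℂ) (trace v x) ∂(surfaceMeasure Ω)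

/-- `C` is a continuity constant of the form `a` on `V`. -/
def IsContinuityConst (Ω ΓD ΓR : Set (Pt d)) (κ C : ℝ) : Prop :=
  ∀ u ∈ V Ω ΓD, ∀ v ∈ V Ω ΓD, ‖form ΓR κ u v‖ ≤ C * normV κ u * normV κ v

/-- `C` is a stability constant of the Helmholtz problem: a solution `u ∈ V` with right-hand side
`f ∈ L²(Ω)` satisfies `‖u‖_V ≤ C ‖f‖`. -/
def IsStabilityConst (Ω ΓD ΓR : Set (Pt d)) (κ C : ℝ) : Prop :=
  ∀ f : L2 Ω, ∀ u ∈ V Ω ΓD, (∀ v ∈ V Ω ΓD, form ΓR κ u v = inner ℂ v f) → normV κ u ≤ C * ‖f‖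

/-! ### The mesh -/

/-- The closed simplex with the given vertices. -/
abbrev simplex (s : Finset (Pt d)) : Set (Pt d) := convexHull ℝ (s : Set (Pt d))

/-- The elements of the mesh, i.e. its `d`-dimensional simplices, given by their vertices. -/
def elements (K : Geometry.SimplicialComplex ℝ (Pt d)) : Set (Finset (Pt d)) :=
  {T | T ∈ K.faces ∧ T.card = d + 1}

/-- `K` is a regular (conforming) simplicial mesh of `Ω` that resolves the Dirichlet boundary. -/
structure IsMesh (Ω ΓD : Set (Pt d)) (K : Geometry.SimplicialComplex ℝ (Pt d)) : Prop where
  finite : K.faces.Finite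
  pure : ∀ s ∈ K.faces, ∃ T ∈ elements K, s ⊆ T
  space_eq : K.space = closure Ω
  dirichlet : ∃ F ⊆ K.faces, (∀ s ∈ F, s.card = d) ∧ closure ΓD = ⋃ s ∈ F, simplex s

/-- The mesh size: the maximal diameter of an element. -/
def meshSize (K : Geometry.SimplicialComplex ℝ (Pt d)) : ℝ :=
  sSup ((fun T : Finset (Pt d) => Metric.diam (simplex T)) '' elements K)

/-- The elements that meet `T`, including `T` itself. -/
def neighbours (K : Geometry.SimplicialComplex ℝ (Pt d)) (T : Finset (Pt d)) :
    Set (Finset (Pt d)) :=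
  {T' | T' ∈ elements K ∧ (simplex T' ∩ simplex T).Nonempty}

/-- The first order element patch of `T`. -/
def patch (K : Geometry.SimplicialComplex ℝ (Pt d)) (T : Finset (Pt d)) : Set (Pt d) :=
  ⋃ T' ∈ neighbours K T, simplex T'

/-- The overlap constant: the maximal number of neighbours of an element plus itself. -/
def overlap (K : Geometry.SimplicialComplex ℝ (Pt d)) : ℕ :=
  sSup ((fun T => (neighbours K T).ncard) '' elements K)

/-- `N_H`: the vertices of the mesh that are not on the (closed) Dirichlet boundary. -/
def freeNodes (K : Geometry.SimplicialComplex ℝ (Pt d)) (ΓD : Set (Pt d)) : Set (Pt d) :=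
  K.vertices \ closure ΓD

/-- The nodal hat function of the vertex `z`: `hat K z x` is the barycentric coordinate of `x` with
respect to `z` in a simplex that contains `x` and has `z` as a vertex, and `0` if there is no such
simplex (the set below is then empty; otherwise it consists of that coordinate). -/
def hat (K : Geometry.SimplicialComplex ℝ (Pt d)) (z x : Pt d) : ℝ :=
  sSup {t | ∃ s ∈ K.faces, ∃ w : Pt d → ℝ, (∀ y ∈ s, 0 ≤ w y) ∧ ∑ y ∈ s, w y = 1 ∧
    ∑ y ∈ s, w y • y = x ∧ z ∈ s ∧ t = w z}

open Classical in
/-- The hat function as an element of `L²(Ω)` (it is continuous on the closure of `Ω` and takes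
values in `[0,1]`, so the second case does not occur on a mesh of `Ω`). -/
def hatL2 (Ω : Set (Pt d)) (K : Geometry.SimplicialComplex ℝ (Pt d)) (z : Pt d) : L2 Ω :=
  if h : MemLp (fun x => (hat K z x : ℂ)) 2 ((volume : Measure (Pt d)).restrict Ω)
  then h.toLp _ else 0

/-- The finite element space `V_H`: the functions in `V` that are affine on each element. -/
def VH (Ω ΓD : Set (Pt d)) (K : Geometry.SimplicialComplex ℝ (Pt d)) : Set (L2 Ω) :=
  {v | v ∈ V Ω ΓD ∧ ∀ T ∈ elements K, ∃ p : Pt d →ᵃ[ℝ] ℂ,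
    ∀ᵐ x ∂((volume : Measure (Pt d)).restrict Ω), x ∈ simplex T → v x = p x}

/-- The weighted Clément operator `I_H v = ∑_z ((v,φ_z)_Ω / (1,φ_z)_Ω) φ_z`. -/
def interp {Ω : Set (Pt d)} (ΓD : Set (Pt d)) (K : Geometry.SimplicialComplex ℝ (Pt d))
    (v : L2 Ω) : L2 Ω :=
  ∑ᶠ z ∈ freeNodes K ΓD,
    ((∫ x in Ω, v x * (hat K z x : ℂ)) / (∫ x in Ω, (hat K z x : ℂ))) • hatL2 Ω K z

/-- The `L²(S ∩ Ω)`-norm of a function on `Ω`. -/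
def normOn {Ω : Set (Pt d)} {F : Type*} [NormedAddCommGroup F] (S : Set (Pt d))
    (f : Lp F 2 ((volume : Measure (Pt d)).restrict Ω)) : ℝ :=
  √(∫ x in S ∩ Ω, ‖f x‖ ^ 2)

/-- `C` is a constant in the local approximation and stability estimate
`H_T⁻¹ ‖v - I_H v‖_{L²(T)} + ‖∇(v - I_H v)‖_{L²(T)} ≤ C ‖∇v‖_{L²(patch of T)}`. -/
def IsInterpConst (Ω ΓD : Set (Pt d)) (K : Geometry.SimplicialComplex ℝ (Pt d)) (C : ℝ) : Prop :=
  ∀ v ∈ V Ω ΓD, ∀ T ∈ elements K,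
    (Metric.diam (simplex T))⁻¹ * normOn (simplex T) (v - interp ΓD K v)
        + normOn (simplex T) (weakGrad (v - interp ΓD K v))
      ≤ C * normOn (patch K T) (weakGrad v)

/-! ### Correctors and the ideal spaces -/

/-- The remainder space `W = ker I_H`. -/
def W (Ω ΓD : Set (Pt d)) (K : Geometry.SimplicialComplex ℝ (Pt d)) : Set (L2 Ω) :=
  {w | w ∈ V Ω ΓD ∧ interp ΓD K w = 0}

/-- `c = C_∞ v`: `c ∈ W` and `a(c,w) = a(v,w)` for all `w ∈ W`. -/
def IsCorrector {Ω : Set (Pt d)} (ΓD ΓR : Set (Pt d)) (K : Geometry.SimplicialComplex ℝ (Pt d))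
    (κ : ℝ) (v c : L2 Ω) : Prop :=
  c ∈ W Ω ΓD K ∧ ∀ w ∈ W Ω ΓD K, form ΓR κ c w = form ΓR κ v w

/-- `c = C*_∞ v`: `c ∈ W` and `a(w,c) = a(w,v)` for all `w ∈ W`. -/
def IsAdjointCorrector {Ω : Set (Pt d)} (ΓD ΓR : Set (Pt d))
    (K : Geometry.SimplicialComplex ℝ (Pt d)) (κ : ℝ) (v c : L2 Ω) : Prop :=
  c ∈ W Ω ΓD K ∧ ∀ w ∈ W Ω ΓD K, form ΓR κ w c = form ΓR κ w v

/-- The ideal trial space `V_{H,∞} = (1 - C_∞) V_H`. -/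
def trialSpace (Ω ΓD ΓR : Set (Pt d)) (K : Geometry.SimplicialComplex ℝ (Pt d)) (κ : ℝ) :
    Set (L2 Ω) :=
  {u | ∃ v ∈ VH Ω ΓD K, ∃ c, IsCorrector ΓD ΓR K κ v c ∧ u = v - c}

/-- The ideal test space `V*_{H,∞} = (1 - C*_∞) V_H`. -/
def testSpace (Ω ΓD ΓR : Set (Pt d)) (K : Geometry.SimplicialComplex ℝ (Pt d)) (κ : ℝ) :
    Set (L2 Ω) :=
  {u | ∃ v ∈ VH Ω ΓD K, ∃ c, IsAdjointCorrector ΓD ΓR K κ v c ∧ u = v - c}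

/-- `inf_{u ∈ X \ {0}} sup_{v ∈ Y \ {0}} Re a(u,v) / (‖u‖_V ‖v‖_V)`, an extended real number. -/
def infSup {Ω : Set (Pt d)} (ΓR : Set (Pt d)) (κ : ℝ) (X Y : Set (L2 Ω)) : EReal :=
  ⨅ u ∈ X \ {0}, ⨆ v ∈ Y \ {0},
    (((form ΓR κ u v).re / (normV κ u * normV κ v) : ℝ) : EReal)

end Helmholtz

end

open MeasureTheory Set Filter Topology
open scoped ENNReal NNReal ContDiff

noncomputable section

namespace Helmholtz

variable {d : ℕ} {Ω ΓD : Set (Pt d)}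

/-! ### Weak gradients -/

/-! For w in `W` the interpolation estimate bounds w on an element T by H_T times its gradient on
the patch of T. Squaring, summing and using the resolution condition gives κ²‖w‖² ≤ ½‖∇w‖²
(`norm_sq_le_of_mem_W`). The Robin term is purely imaginary on the diagonal, so Re a(w,w) = ‖∇w‖² -
κ²‖w‖² ≥ ⅓‖w‖_V², and Lax–Milgram on `W` yields both correctors.

A trial function u satisfies a(u,w) = 0 on `W`. Hence a(u,ψ) = a(u,(1-C*)ψ) for every ψ in `V`, and
(1-C*)ψ is a test function, because V is the span of the free hat functions plus `W` and 1-C* kills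
`W`. A nontrivial projection in a Hilbert space has the norm of its complement, so ‖(1-C*)ψ‖ ≤
3C_a‖ψ‖ without an extra 1 (`norm_le_of_adjoint_orthogonal`).

It remains to find ψ in `V` with ‖u‖‖ψ‖ ≤ 2s Re a(u,ψ), where s = C_st κ ≥ 1. Let t = κ‖u‖ in L²,
and let z solve the adjoint problem a(v,z) = κ²(v,u). Then Re a(u,u) = ‖u‖_V² - 2t², Re a(u,z) = t²
and ‖z‖_V ≤ st. If ‖u‖_V ≥ 2t take ψ = u, otherwise ψ = z (`exists_test_function`).

The stability constant is only an a priori bound, so it yields uniqueness. Existence follows because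
the form is coercive on a subspace of finite codimension, which reduces solvability to a square
linear system (`exists_solution`). The adjoint problem reduces to the primal one through a(u, conj
v) = a(v, conj u) (`form_conj`). Compactly supported test functions show 3C_a ≥ 1, and C_st κ ≥ 1
for κ ≥ κ₀.

All this needs `V` to be a Hilbert space with linear gradient and trace that contains the hat
functions. For this, Sobolev functions are treated as triples (function, gradient, trace) in the
closure of the smooth triples. The trace inequality (`exists_trace_bound`) shows that the trace is
determined and controlled by the other two entries, and `exists_bary_bound` makes the hat functions
Lipschitz. -/

/-- The components of a vector field in `L²(Ω)^d`. -/
def component (i : Fin d) : L2Vec Ω →L[ℂ] L2 Ω :=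
  (EuclideanSpace.proj (𝕜 := ℂ) i : EuclideanSpace ℂ (Fin d) →L[ℂ] ℂ).compLpL 2 _

lemma coeFn_component (i : Fin d) (G : L2Vec Ω) :
    component i G =ᵐ[volume.restrict Ω] fun x => G x i :=
  ContinuousLinearMap.coeFn_compLp _ _

lemma memLp_test {ψ : Pt d → ℝ} (hψ : Continuous ψ) (hs : HasCompactSupport ψ) :
    MemLp (fun x => (ψ x : ℂ)) 2 ((volume : Measure (Pt d)).restrict Ω) :=
  ((Complex.continuous_ofReal.comp hψ).memLp_of_hasCompactSupport
    (hs.comp_left Complex.ofReal_zero)).restrict _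

lemma integral_smul_eq_inner {ψ : Pt d → ℝ} (hψ : Continuous ψ) (hs : HasCompactSupport ψ)
    (u : L2 Ω) : ∫ x in Ω, ψ x • u x = inner ℂ ((memLp_test hψ hs).toLp _ : L2 Ω) u := by
  rw [L2.inner_def]
  refine integral_congr_ae ?_
  filter_upwards [(memLp_test (Ω := Ω) hψ hs).coeFn_toLp] with x hx
  rw [hx]
  simp [mul_comm]

lemma contDiff_partial {E : Type*} [NormedAddCommGroup E] [NormedSpace ℝ E] {φ : Pt d → E}
    (hφ : ContDiff ℝ ∞ φ) (v : Pt d) : ContDiff ℝ ∞ fun x => fderiv ℝ φ x v :=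
  (hφ.fderiv_right (m := ∞) (by simp)).clm_apply contDiff_const

lemma hasCompactSupport_partial {E : Type*} [NormedAddCommGroup E] [NormedSpace ℝ E]
    {φ : Pt d → E} (hs : HasCompactSupport φ) (v : Pt d) :
    HasCompactSupport fun x => fderiv ℝ φ x v :=
  (hs.fderiv (𝕜 := ℝ)).comp_left (g := fun L : Pt d →L[ℝ] E => L v) rfl

/-- For a fixed test function both sides are L² inner products against fixed elements, hence
continuous. -/
lemma isClosed_hasWeakGrad : IsClosed {p : L2 Ω × L2Vec Ω | HasWeakGrad Ω p.1 p.2} := by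
  have : {p : L2 Ω × L2Vec Ω | HasWeakGrad Ω p.1 p.2} =
      ⋂ (φ : Pt d → ℝ) (_ : ContDiff ℝ ∞ φ) (_ : HasCompactSupport φ) (_ : tsupport φ ⊆ Ω)
        (i : Fin d), {p : L2 Ω × L2Vec Ω |
          ∫ x in Ω, (fderiv ℝ φ x (EuclideanSpace.single i 1)) • p.1 x =
            -∫ x in Ω, φ x • p.2 x i} := by
    ext p; simp [HasWeakGrad]
  rw [this]
  refine isClosed_iInter fun φ => isClosed_iInter fun hφ => isClosed_iInter fun hs =>
    isClosed_iInter fun _ => isClosed_iInter fun i => ?_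
  have h2 (G : L2Vec Ω) : ∫ x in Ω, φ x • G x i = ∫ x in Ω, φ x • component i G x := by
    refine integral_congr_ae ?_
    filter_upwards [coeFn_component i G] with x hx
    rw [hx]
  simp_rw [h2, integral_smul_eq_inner hφ.continuous hs,
    integral_smul_eq_inner (contDiff_partial hφ _).continuous (hasCompactSupport_partial hs _)]
  exact isClosed_eq (by fun_prop) (by fun_prop)

/-- The fundamental lemma of the calculus of variations, applied to each component. It frees
`weakGrad` from the choice in its definition. -/
lemma HasWeakGrad.unique (hΩ : IsOpen Ω) {u : L2 Ω} {G G' : L2Vec Ω} (h : HasWeakGrad Ω u G)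
    (h' : HasWeakGrad Ω u G') : G = G' := by
  have key (i : Fin d) : ∀ᵐ x ∂(volume : Measure (Pt d)), x ∈ Ω → component i (G - G') x = 0 := by
    refine hΩ.ae_eq_zero_of_integral_contDiff_smul_eq_zero ?_ fun φ hφ hs hsub => ?_
    · exact locallyIntegrableOn_of_locallyIntegrable_restrict
        ((Lp.memLp (component i (G - G'))).locallyIntegrable (by norm_num))
    · rw [← setIntegral_eq_integral_of_forall_compl_eq_zero (s := Ω) fun x hx => by
        rw [image_eq_zero_of_notMem_tsupport (fun h => hx (hsub h)), zero_smul],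
        integral_smul_eq_inner hφ.continuous hs, map_sub, inner_sub_right,
        ← integral_smul_eq_inner hφ.continuous hs,
        ← integral_smul_eq_inner hφ.continuous hs, sub_eq_zero]
      have e (G : L2Vec Ω) : ∫ x in Ω, φ x • component i G x = ∫ x in Ω, φ x • G x i := by
        refine integral_congr_ae ?_
        filter_upwards [coeFn_component i G] with x hx
        rw [hx]
      rw [e, e, ← neg_inj, ← h φ hφ hs hsub i, ← h' φ hφ hs hsub i]
  rw [← sub_eq_zero]
  refine (Lp.eq_zero_iff_ae_eq_zero).2 ?_
  have : ∀ᵐ x ∂(volume : Measure (Pt d)).restrict Ω, ∀ i, (G - G') x i = 0 := by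
    refine ae_all_iff.2 fun i => ?_
    filter_upwards [(ae_restrict_iff' hΩ.measurableSet).2 (key i), coeFn_component i (G - G')]
      with x hx hx'
    rw [← hx', hx]
  filter_upwards [this] with x hx
  ext i
  exact hx i

lemma HasWeakGrad.weakGrad_eq (hΩ : IsOpen Ω) {u : L2 Ω} {G : L2Vec Ω} (h : HasWeakGrad Ω u G) :
    weakGrad u = G := by
  have h' : ∃ G : L2Vec Ω, HasWeakGrad Ω u G := ⟨G, h⟩
  rw [weakGrad, dif_pos h']
  exact h'.choose_spec.unique hΩ h

/-! ### The closure of the smooth functions -/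

lemma classicalGrad_apply (φ : Pt d → ℂ) (x : Pt d) (i : Fin d) :
    classicalGrad φ x i = fderiv ℝ φ x (EuclideanSpace.single i 1) := rfl

lemma continuous_classicalGrad {φ : Pt d → ℂ} (hφ : ContDiff ℝ ∞ φ) :
    Continuous (classicalGrad φ) :=
  (PiLp.continuous_toLp 2 _).comp (continuous_pi fun _ => (contDiff_partial hφ _).continuous)

/-- The triples of a smooth function on `Ω`, its gradient and its boundary values. -/
def smoothTriples (Ω : Set (Pt d)) : Submodule ℂ (L2 Ω × L2Vec Ω × L2Bdry Ω) where
  carrier := {p | ∃ φ : Pt d → ℂ, ContDiff ℝ ∞ φ ∧ p.1 =ᵐ[volume.restrict Ω] φ ∧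
    p.2.1 =ᵐ[volume.restrict Ω] classicalGrad φ ∧ p.2.2 =ᵐ[surfaceMeasure Ω] φ}
  zero_mem' := by
    refine ⟨0, contDiff_const, Lp.coeFn_zero _ _ _, ?_, Lp.coeFn_zero _ _ _⟩
    filter_upwards [Lp.coeFn_zero (EuclideanSpace ℂ (Fin d)) 2 (volume.restrict Ω)] with x hx
    change (0 : L2Vec Ω) x = _
    rw [hx]
    ext i
    simp [classicalGrad_apply]
  add_mem' := by
    rintro p q ⟨φ, hφ, h1, h2, h3⟩ ⟨ψ, hψ, k1, k2, k3⟩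
    refine ⟨φ + ψ, hφ.add hψ, (Lp.coeFn_add _ _).trans (h1.add k1), ?_,
      (Lp.coeFn_add _ _).trans (h3.add k3)⟩
    refine (Lp.coeFn_add _ _).trans ?_
    filter_upwards [h2, k2] with x hx kx
    ext i
    simp only [Pi.add_apply, hx, kx, PiLp.add_apply, classicalGrad_apply]
    rw [fderiv_add (hφ.differentiable (by simp) x) (hψ.differentiable (by simp) x)]
    rfl
  smul_mem' := by
    rintro c p ⟨φ, hφ, h1, h2, h3⟩
    refine ⟨c • φ, hφ.const_smul c, (Lp.coeFn_smul _ _).trans (h1.const_smul c), ?_,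
      (Lp.coeFn_smul _ _).trans (h3.const_smul c)⟩
    refine (Lp.coeFn_smul _ _).trans ?_
    filter_upwards [h2] with x hx
    ext i
    simp only [Pi.smul_apply, hx, PiLp.smul_apply, classicalGrad_apply]
    rw [fderiv_const_smul (hφ.differentiable (by simp) x) c]
    rfl

/-- The triples of a Sobolev function, its weak gradient and its trace. -/
def sobolevGraph (Ω : Set (Pt d)) : Submodule ℂ (L2 Ω × L2Vec Ω × L2Bdry Ω) :=
  (smoothTriples Ω).topologicalClosure

lemma integral_partial_smul {φ : Pt d → ℝ} (hφ : ContDiff ℝ ∞ φ) (hs : HasCompactSupport φ)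
    {ψ : Pt d → ℂ} (hψ : ContDiff ℝ ∞ ψ) (v : Pt d) :
    ∫ x, fderiv ℝ φ x v • ψ x = -∫ x, φ x • fderiv ℝ ψ x v := by
  rw [integral_smul_fderiv_eq_neg_fderiv_smul_of_integrable, neg_neg]
  · exact ((contDiff_partial hφ v).continuous.smul hψ.continuous).integrable_of_hasCompactSupport
      (hasCompactSupport_partial hs v).smul_right
  · exact (hφ.continuous.smul (contDiff_partial hψ v).continuous).integrable_of_hasCompactSupport
      hs.smul_right
  · exact (hφ.continuous.smul hψ.continuous).integrable_of_hasCompactSupport hs.smul_right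
  · exact fun x _ => hφ.differentiable (by simp) x
  · exact fun x _ => hψ.differentiable (by simp) x

lemma hasWeakGrad_of_mem_smoothTriples {p : L2 Ω × L2Vec Ω × L2Bdry Ω}
    (hp : p ∈ smoothTriples Ω) : HasWeakGrad Ω p.1 p.2.1 := by
  obtain ⟨ψ, hψ, h1, h2, -⟩ := hp
  intro φ hφ hs hsub i
  have e1 : ∫ x in Ω, (fderiv ℝ φ x (EuclideanSpace.single i 1)) • p.1 x =
      ∫ x in Ω, (fderiv ℝ φ x (EuclideanSpace.single i 1)) • ψ x := by
    refine integral_congr_ae ?_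
    filter_upwards [h1] with x hx
    rw [hx]
  have e2 : ∫ x in Ω, φ x • p.2.1 x i =
      ∫ x in Ω, φ x • fderiv ℝ ψ x (EuclideanSpace.single i 1) := by
    refine integral_congr_ae ?_
    filter_upwards [h2] with x hx
    rw [hx, classicalGrad_apply]
  have hz (x : Pt d) (hx : x ∉ Ω) : x ∉ tsupport φ := fun h => hx (hsub h)
  rw [e1, e2, setIntegral_eq_integral_of_forall_compl_eq_zero,
    setIntegral_eq_integral_of_forall_compl_eq_zero, integral_partial_smul hφ hs hψ]
  · intro x hx
    rw [image_eq_zero_of_notMem_tsupport (hz x hx), zero_smul]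
  · intro x hx
    rw [fderiv_of_notMem_tsupport ℝ (hz x hx)]
    simp

lemma hasWeakGrad_of_mem_sobolevGraph {p : L2 Ω × L2Vec Ω × L2Bdry Ω}
    (hp : p ∈ sobolevGraph Ω) : HasWeakGrad Ω p.1 p.2.1 := by
  have hc : IsClosed {p : L2 Ω × L2Vec Ω × L2Bdry Ω | HasWeakGrad Ω p.1 p.2.1} :=
    isClosed_hasWeakGrad.preimage (f := fun p : L2 Ω × L2Vec Ω × L2Bdry Ω => (p.1, p.2.1))
      (by fun_prop)
  exact closure_minimal (fun q hq => hasWeakGrad_of_mem_smoothTriples hq) hc hp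

lemma weakGrad_eq_of_mem (hΩ : IsOpen Ω) {u : L2 Ω} {G : L2Vec Ω} {g : L2Bdry Ω}
    (hp : (u, G, g) ∈ sobolevGraph Ω) : weakGrad u = G :=
  (hasWeakGrad_of_mem_sobolevGraph hp).weakGrad_eq hΩ

/-! ### Convergence in `eLpNorm` and convergence in `Lp` -/

section Lp

variable {α E : Type*} [MeasurableSpace α] {μ : Measure α} [NormedAddCommGroup E]

lemma tendsto_toLp_of_eLpNorm_sub {φ : ℕ → α → E} (hφ : ∀ n, MemLp (φ n) 2 μ) {u : Lp E 2 μ}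
    (h : Tendsto (fun n => eLpNorm (fun x => φ n x - u x) 2 μ) atTop (𝓝 0)) :
    Tendsto (fun n => (hφ n).toLp (φ n)) atTop (𝓝 u) := by
  rw [Lp.tendsto_Lp_iff_tendsto_eLpNorm']
  refine h.congr fun n => eLpNorm_congr_ae ?_
  filter_upwards [(hφ n).coeFn_toLp] with x hx
  simp [hx]

lemma tendsto_eLpNorm_sub_of_tendsto {φ : ℕ → α → E} {v : ℕ → Lp E 2 μ} {u : Lp E 2 μ}
    (hφ : ∀ n, v n =ᵐ[μ] φ n) (h : Tendsto v atTop (𝓝 u)) :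
    Tendsto (fun n => eLpNorm (fun x => φ n x - u x) 2 μ) atTop (𝓝 0) := by
  rw [Lp.tendsto_Lp_iff_tendsto_eLpNorm'] at h
  refine h.congr fun n => eLpNorm_congr_ae ?_
  filter_upwards [hφ n] with x hx
  simp [hx]

lemma memLp_of_eLpNorm_sub_lt {φ : α → E} (hφ : AEStronglyMeasurable φ μ) (u : Lp E 2 μ)
    (h : eLpNorm (fun x => φ x - u x) 2 μ < ⊤) : MemLp φ 2 μ := by
  have h1 : MemLp (fun x => φ x - u x) 2 μ := ⟨hφ.sub (Lp.aestronglyMeasurable u), h⟩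
  exact (memLp_congr_ae (Eventually.of_forall fun x => by simp)).1 (h1.add (Lp.memLp u))

end Lp

lemma mem_sobolevGraph_of_tendsto {u : L2 Ω} {G : L2Vec Ω} {g : L2Bdry Ω} {φ : ℕ → Pt d → ℂ}
    (hφ : ∀ n, ContDiff ℝ ∞ (φ n))
    (h1 : Tendsto (fun n => eLpNorm (fun x => φ n x - u x) 2 (volume.restrict Ω)) atTop (𝓝 0))
    (h2 : Tendsto (fun n => eLpNorm (fun x => classicalGrad (φ n) x - G x) 2
      (volume.restrict Ω)) atTop (𝓝 0))
    (h3 : Tendsto (fun n => eLpNorm (fun x => φ n x - g x) 2 (surfaceMeasure Ω)) atTop (𝓝 0)) :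
    (u, G, g) ∈ sobolevGraph Ω := by
  have fin : ∀ᶠ n in atTop, eLpNorm (fun x => φ n x - u x) 2 (volume.restrict Ω) < ⊤ ∧
      eLpNorm (fun x => classicalGrad (φ n) x - G x) 2 (volume.restrict Ω) < ⊤ ∧
      eLpNorm (fun x => φ n x - g x) 2 (surfaceMeasure Ω) < ⊤ :=
    (h1.eventually (gt_mem_nhds ENNReal.zero_lt_top)).and
      ((h2.eventually (gt_mem_nhds ENNReal.zero_lt_top)).and
        (h3.eventually (gt_mem_nhds ENNReal.zero_lt_top)))
  -- The approximating functions are known to be square integrable only once the distances are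
  -- finite, so the first N are dropped.
  obtain ⟨N, hN⟩ := eventually_atTop.1 fin
  have m1 (n : ℕ) : MemLp (φ (n + N)) 2 (volume.restrict Ω) :=
    memLp_of_eLpNorm_sub_lt (hφ _).continuous.aestronglyMeasurable u (hN _ (by omega)).1
  have m2 (n : ℕ) : MemLp (classicalGrad (φ (n + N))) 2 (volume.restrict Ω) :=
    memLp_of_eLpNorm_sub_lt (continuous_classicalGrad (hφ _)).aestronglyMeasurable G
      (hN _ (by omega)).2.1
  have m3 (n : ℕ) : MemLp (φ (n + N)) 2 (surfaceMeasure Ω) :=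
    memLp_of_eLpNorm_sub_lt (hφ _).continuous.aestronglyMeasurable g (hN _ (by omega)).2.2
  refine mem_closure_of_tendsto (b := atTop)
    (f := fun n => ((m1 n).toLp _, (m2 n).toLp _, (m3 n).toLp _)) ?_ ?_
  · exact (tendsto_toLp_of_eLpNorm_sub m1 ((tendsto_add_atTop_iff_nat N).2 h1)).prodMk_nhds
      ((tendsto_toLp_of_eLpNorm_sub m2 ((tendsto_add_atTop_iff_nat N).2 h2)).prodMk_nhds
        (tendsto_toLp_of_eLpNorm_sub m3 ((tendsto_add_atTop_iff_nat N).2 h3)))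
  · exact Eventually.of_forall fun n =>
      ⟨φ (n + N), hφ _, (m1 n).coeFn_toLp, (m2 n).coeFn_toLp, (m3 n).coeFn_toLp⟩

lemma isTrace_iff {u : L2 Ω} {g : L2Bdry Ω} :
    IsTrace Ω u g ↔ (u, weakGrad u, g) ∈ sobolevGraph Ω := by
  constructor
  · rintro ⟨φ, hφ, h1, h2, h3⟩
    exact mem_sobolevGraph_of_tendsto hφ h1 h2 h3
  · intro h
    obtain ⟨p, hp, hlim⟩ := mem_closure_iff_seq_limit.1 h
    choose φ hφ h1 h2 h3 using hp
    exact ⟨φ, hφ, tendsto_eLpNorm_sub_of_tendsto h1 ((continuous_fst.tendsto _).comp hlim),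
      tendsto_eLpNorm_sub_of_tendsto h2
        (((continuous_fst.comp continuous_snd).tendsto _).comp hlim),
      tendsto_eLpNorm_sub_of_tendsto h3
        (((continuous_snd.comp continuous_snd).tendsto _).comp hlim)⟩

lemma isTrace_of_mem (hΩ : IsOpen Ω) {u : L2 Ω} {G : L2Vec Ω} {g : L2Bdry Ω}
    (hp : (u, G, g) ∈ sobolevGraph Ω) : IsTrace Ω u g := by
  rw [isTrace_iff, weakGrad_eq_of_mem hΩ hp]
  exact hp

/-- Membership in `H1` is automatic: a limit of smooth triples carries its own weak gradient. From
here on `V` is handled only through the closed graph. -/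
lemma mem_V_iff (hΩ : IsOpen Ω) {v : L2 Ω} :
    v ∈ V Ω ΓD ↔ ∃ G g, (v, G, g) ∈ sobolevGraph Ω ∧
      ∀ᵐ x ∂(surfaceMeasure Ω), x ∈ ΓD → g x = 0 := by
  constructor
  · rintro ⟨-, g, hg, h0⟩
    exact ⟨weakGrad v, g, isTrace_iff.1 hg, h0⟩
  · rintro ⟨G, g, hp, h0⟩
    exact ⟨⟨G, hasWeakGrad_of_mem_sobolevGraph hp⟩, g, isTrace_of_mem hΩ hp, h0⟩

end Helmholtz

end

noncomputable section

namespace Helmholtz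

variable {d : ℕ} {Ω ΓD : Set (Pt d)}

/-! ### The trace inequality -/

/-! ### Fubini and surface area for graphs over a hyperplane -/

section Hyperplane

variable {n : Pt d}

/-- The hyperplane orthogonal to `n`. -/
abbrev hyperplane (n : Pt d) : Submodule ℝ (Pt d) := (Submodule.span ℝ {n})ᗮ

lemma sub_inner_smul_mem (hn : ‖n‖ = 1) (y : Pt d) : y - (inner ℝ n y) • n ∈ hyperplane n := by
  rw [Submodule.mem_orthogonal_singleton_iff_inner_right, inner_sub_right, inner_smul_right,
    real_inner_self_eq_norm_sq, hn]
  simp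

lemma finrank_hyperplane (hn : ‖n‖ = 1) : Module.finrank ℝ (hyperplane n) = d - 1 := by
  have h0 : n ≠ 0 := by rintro rfl; simp at hn
  have h := (Submodule.span ℝ {n}).finrank_add_finrank_orthogonal
  rw [finrank_span_singleton h0, finrank_euclideanSpace_fin] at h
  exact (Nat.sub_eq_of_eq_add' h.symm).symm

/-- The splitting of the space into a hyperplane and the line orthogonal to it. -/
def hyperplaneEquiv (hn : ‖n‖ = 1) : (hyperplane n × ℝ) ≃L[ℝ] Pt d :=
  LinearEquiv.toContinuousLinearEquiv
    { toFun := fun p => (p.1 : Pt d) + p.2 • n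
      map_add' := fun p q => by simp only [Prod.fst_add, Prod.snd_add, Submodule.coe_add]; module
      map_smul' := fun c p => by
        simp only [Prod.smul_fst, Prod.smul_snd, Submodule.coe_smul, RingHom.id_apply, smul_eq_mul]
        module
      invFun := fun y => (⟨y - (inner ℝ n y) • n, sub_inner_smul_mem hn y⟩, inner ℝ n y)
      left_inv := fun p => by
        have h : inner ℝ n ((p.1 : Pt d) + p.2 • n) = p.2 := by
          rw [inner_add_right, inner_smul_right, real_inner_self_eq_norm_sq, hn,
            Submodule.mem_orthogonal_singleton_iff_inner_right.1 p.1.2]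
          simp
        ext1
        · simp [h]
        · exact h
      right_inv := fun y => by simp }

/-- The splitting pushes the product measure forward to a Haar measure, which is a multiple of
Lebesgue measure by uniqueness. Any finite factor suffices for the trace inequality, so its value is
left open. -/
lemma exists_lintegral_hyperplane (hn : ‖n‖ = 1) : ∃ C : ℝ≥0∞, C ≠ ⊤ ∧
    ∀ F : Pt d → ℝ≥0∞, Measurable F →
      ∫⁻ q : hyperplane n, ∫⁻ s : ℝ, F ((q : Pt d) + s • n) = C * ∫⁻ x, F x := by
  let μ : Measure (Pt d) := Measure.map (hyperplaneEquiv hn) (volume.prod volume)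
  have hμ : μ.IsAddHaarMeasure := ContinuousLinearEquiv.isAddHaarMeasure_map _ _
  refine ⟨(μ.addHaarScalarFactor volume : ℝ≥0∞), ENNReal.coe_ne_top, fun F hF => ?_⟩
  have h1 : μ = μ.addHaarScalarFactor volume • volume :=
    Measure.isAddLeftInvariant_eq_smul _ _
  have hm : Measurable (hyperplaneEquiv hn) := (hyperplaneEquiv hn).continuous.measurable
  have h2 : ∫⁻ x, F x ∂μ = ∫⁻ q : hyperplane n, ∫⁻ s : ℝ, F ((q : Pt d) + s • n) := by
    rw [lintegral_map hF hm, lintegral_prod (fun p => F (hyperplaneEquiv hn p)) (hF.comp hm).aemeasurable]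
    rfl
  rw [← h2]
  conv_lhs => rw [h1]
  rw [lintegral_smul_measure]
  rfl

variable {γ : Pt d → ℝ} {L : ℝ≥0}

/-- The parametrisation of a graph over a hyperplane. -/
def graphMap (n : Pt d) (γ : Pt d → ℝ) (q : hyperplane n) : Pt d := (q : Pt d) + γ q • n

lemma lipschitzWith_graphMap (hn : ‖n‖ = 1) (hγ : LipschitzWith L γ) :
    LipschitzWith (1 + L) (graphMap n γ) := by
  have h2 : LipschitzWith L fun q : hyperplane n => γ q • n := by
    refine LipschitzWith.of_dist_le_mul fun p q => ?_
    rw [dist_eq_norm, ← sub_smul, norm_smul, hn, mul_one]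
    exact hγ.dist_le_mul p q
  exact (LipschitzWith.subtype_val _).add h2

/-- A Lipschitz image enlarges (d-1)-dimensional Hausdorff measure by at most the (d-1)-st power of
the Lipschitz constant, and on the hyperplane this measure is Lebesgue measure. -/
lemma hausdorffMeasure_graph_le (hn : ‖n‖ = 1) (hγ : LipschitzWith L γ) (E : Set (Pt d))
    (hE : E ⊆ range (graphMap n γ)) :
    (μHE[d - 1] : Measure (Pt d)) E ≤
      ((1 + L : ℝ≥0) : ℝ≥0∞) ^ ((d - 1 : ℕ) : ℝ) * volume (graphMap n γ ⁻¹' E) := by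
  have hv : (μHE[d - 1] : Measure (hyperplane n)) = volume := by
    rw [← finrank_hyperplane hn]
    exact InnerProductSpace.euclideanHausdorffMeasure_eq_volume
  rw [← hv, Measure.euclideanHausdorffMeasure_def, Measure.euclideanHausdorffMeasure_def,
    Measure.smul_apply, Measure.smul_apply, mul_smul_comm]
  gcongr
  calc _ = μH[((d - 1 : ℕ) : ℝ)] (graphMap n γ '' (graphMap n γ ⁻¹' E)) := by
        rw [image_preimage_eq_of_subset hE]
    _ ≤ _ := (lipschitzWith_graphMap hn hγ).hausdorffMeasure_image_le (by positivity) _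

end Hyperplane

/-! ### The trace inequality near a boundary point -/

section Local

variable {x₀ n : Pt d} {r : ℝ} {L : ℝ≥0} {γ : Pt d → ℝ}

/-- Strictly above the graph the point would lie in the open set Ω; strictly below it, a whole
neighbourhood would miss Ω. -/
lemma inner_eq_of_mem_frontier (hΩ : IsOpen Ω) (hγ : LipschitzWith L γ)
    (h : ∀ y ∈ Metric.ball x₀ r, y ∈ Ω ↔ γ (y - (inner ℝ n y) • n) < inner ℝ n y)
    {y : Pt d} (hy : y ∈ frontier Ω) (hyr : y ∈ Metric.ball x₀ r) :
    inner ℝ n y = γ (y - (inner ℝ n y) • n) := by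
  rw [hΩ.frontier_eq] at hy
  refine le_antisymm (not_lt.1 fun hlt => hy.2 ((h y hyr).2 hlt)) (not_lt.1 fun hlt => ?_)
  have hc : Continuous fun z : Pt d => γ (z - (inner ℝ n z) • n) :=
    hγ.continuous.comp (by fun_prop)
  have hc' : Continuous fun z : Pt d => inner ℝ n z := by fun_prop
  have hev : ∀ᶠ z in 𝓝 y, z ∉ Ω := by
    filter_upwards [hc'.continuousAt.eventually_lt hc.continuousAt hlt,
      Metric.isOpen_ball.mem_nhds hyr] with z hz hzr hzΩ
    exact lt_asymm ((h z hzr).1 hzΩ) hz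
  obtain ⟨z, hz, hz'⟩ := mem_closure_iff_nhds.1 hy.1 _ hev
  exact hz hz'

lemma mem_range_graphMap (hΩ : IsOpen Ω) (hn : ‖n‖ = 1) (hγ : LipschitzWith L γ)
    (h : ∀ y ∈ Metric.ball x₀ r, y ∈ Ω ↔ γ (y - (inner ℝ n y) • n) < inner ℝ n y) :
    frontier Ω ∩ Metric.ball x₀ r ⊆ range (graphMap n γ) := by
  rintro y ⟨hy, hyr⟩
  refine ⟨⟨_, sub_inner_smul_mem hn y⟩, ?_⟩
  simp only [graphMap]
  rw [← inner_eq_of_mem_frontier hΩ hγ h hy hyr]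
  simp

/-- Moving along `n` raises the height but keeps the foot on the hyperplane. The halved radii keep
the moved point in the ball where Ω is described by the graph. -/
lemma add_smul_mem (hΩ : IsOpen Ω) (hn : ‖n‖ = 1) (hγ : LipschitzWith L γ)
    (h : ∀ y ∈ Metric.ball x₀ r, y ∈ Ω ↔ γ (y - (inner ℝ n y) • n) < inner ℝ n y)
    {y : Pt d} (hy : y ∈ frontier Ω) (hyr : y ∈ Metric.ball x₀ (r / 2)) {t : ℝ} (ht : 0 < t)
    (htr : t ≤ r / 2) : y + t • n ∈ Ω := by
  have hi : inner ℝ n (y + t • n) = inner ℝ n y + t := by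
    rw [inner_add_right, inner_smul_right, real_inner_self_eq_norm_sq, hn]; ring
  have hball : y + t • n ∈ Metric.ball x₀ r := by
    rw [Metric.mem_ball, dist_eq_norm] at hyr ⊢
    calc ‖y + t • n - x₀‖ = ‖(y - x₀) + t • n‖ := by congr 1; abel
      _ ≤ ‖y - x₀‖ + ‖t • n‖ := norm_add_le _ _
      _ < r / 2 + r / 2 := by
        rw [norm_smul, hn, mul_one, Real.norm_of_nonneg ht.le]
        linarith
      _ = r := by ring
  have hyr' : y ∈ Metric.ball x₀ r :=
    Metric.ball_subset_ball (by linarith) hyr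
  rw [h _ hball, hi]
  have e : y + t • n - (inner ℝ n y + t) • n = y - (inner ℝ n y) • n := by module
  rw [e, ← inner_eq_of_mem_frontier hΩ hγ h hy hyr']
  linarith

/-- The density of the squared `W^{1,2}`-norm. -/
def energyDensity (φ : Pt d → ℂ) (x : Pt d) : ℝ := ‖φ x‖ ^ 2 + ‖classicalGrad φ x‖ ^ 2

lemma continuous_energyDensity {φ : Pt d → ℂ} (hφ : ContDiff ℝ ∞ φ) :
    Continuous (energyDensity φ) :=
  (hφ.continuous.norm.pow 2).add ((continuous_classicalGrad hφ).norm.pow 2)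

lemma energyDensity_nonneg (φ : Pt d → ℂ) (x : Pt d) : 0 ≤ energyDensity φ x := by
  unfold energyDensity; positivity

lemma norm_fderiv_apply_le (φ : Pt d → ℂ) (x v : Pt d) :
    ‖fderiv ℝ φ x v‖ ≤ ‖classicalGrad φ x‖ * ‖v‖ := by
  have h1 : fderiv ℝ φ x v = ∑ i, v i • classicalGrad φ x i := by
    conv_lhs => rw [← (EuclideanSpace.basisFun (Fin d) ℝ).sum_repr v]
    simp [classicalGrad_apply]
  rw [h1]
  calc ‖∑ i, v i • classicalGrad φ x i‖ ≤ ∑ i, ‖classicalGrad φ x i‖ * ‖v i‖ := by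
        refine (norm_sum_le _ _).trans (Finset.sum_le_sum fun i _ => ?_)
        rw [norm_smul, mul_comm]
    _ ≤ √(∑ i, ‖classicalGrad φ x i‖ ^ 2) * √(∑ i, ‖v i‖ ^ 2) :=
        Real.sum_mul_le_sqrt_mul_sqrt _ _ _
    _ = _ := by rw [EuclideanSpace.norm_eq, EuclideanSpace.norm_eq]

lemma norm_sq_le_integral (hn : ‖n‖ = 1) {φ : Pt d → ℂ} (hφ : ContDiff ℝ ∞ φ) (y : Pt d)
    {δ : ℝ} (hδ : 0 < δ) :
    ‖φ y‖ ^ 2 ≤ (1 + δ) / δ * ∫ s in (0)..δ, energyDensity φ (y + s • n) := by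
  have hΘ : Continuous fun s : ℝ => energyDensity φ (y + s • n) :=
    (continuous_energyDensity hφ).comp (by fun_prop)
  have hh : Continuous fun s : ℝ => ‖φ (y + s • n)‖ ^ 2 :=
    (hφ.continuous.comp (by fun_prop)).norm.pow 2
  have hder (s : ℝ) : HasDerivAt (fun s : ℝ => ‖φ (y + s • n)‖ ^ 2)
      (2 * inner ℝ (φ (y + s • n)) (fderiv ℝ φ (y + s • n) n)) s := by
    have h1 : HasDerivAt (fun s : ℝ => y + s • n) n s := by
      simpa using ((hasDerivAt_id s).smul_const n).const_add y
    exact ((hφ.differentiable (by simp) _).hasFDerivAt.comp_hasDerivAt s h1).norm_sq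
  have hcont : Continuous fun s : ℝ =>
      2 * inner ℝ (φ (y + s • n)) (fderiv ℝ φ (y + s • n) n) := by
    have := hφ.continuous
    have := (contDiff_partial hφ n).continuous
    fun_prop
  have hbound (s : ℝ) : |2 * inner ℝ (φ (y + s • n)) (fderiv ℝ φ (y + s • n) n)| ≤
      energyDensity φ (y + s • n) := by
    have h1 := abs_real_inner_le_norm (φ (y + s • n)) (fderiv ℝ φ (y + s • n) n)
    have h2 := norm_fderiv_apply_le φ (y + s • n) n
    rw [hn, mul_one] at h2
    rw [abs_mul, abs_two]
    unfold energyDensity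
    nlinarith [sq_nonneg (‖φ (y + s • n)‖ - ‖classicalGrad φ (y + s • n)‖),
      mul_le_mul_of_nonneg_left h2 (norm_nonneg (φ (y + s • n)))]
  have key (t : ℝ) (ht : t ∈ Icc 0 δ) : ‖φ y‖ ^ 2 ≤
      energyDensity φ (y + t • n) + ∫ s in (0)..δ, energyDensity φ (y + s • n) := by
    have hftc := intervalIntegral.integral_eq_sub_of_hasDerivAt (a := 0) (b := t)
      (fun s _ => hder s) (hcont.intervalIntegrable _ _)
    simp only [zero_smul, add_zero] at hftc
    have h1 : |∫ s in (0)..t, 2 * inner ℝ (φ (y + s • n)) (fderiv ℝ φ (y + s • n) n)| ≤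
        ∫ s in (0)..t, energyDensity φ (y + s • n) := by
      refine (intervalIntegral.abs_integral_le_integral_abs ht.1).trans ?_
      exact intervalIntegral.integral_mono_on ht.1 (hcont.abs.intervalIntegrable _ _)
        (hΘ.intervalIntegrable _ _) fun s _ => hbound s
    have h2 : ∫ s in (0)..t, energyDensity φ (y + s • n) ≤
        ∫ s in (0)..δ, energyDensity φ (y + s • n) :=
      intervalIntegral.integral_mono_interval le_rfl ht.1 ht.2
        (Eventually.of_forall fun s => energyDensity_nonneg _ _) (hΘ.intervalIntegrable _ _)
    have h3 : ‖φ (y + t • n)‖ ^ 2 ≤ energyDensity φ (y + t • n) := by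
      unfold energyDensity
      nlinarith [sq_nonneg ‖classicalGrad φ (y + t • n)‖]
    have := (abs_le.1 h1).1
    linarith
  -- Averaging the pointwise bound over t in [0, δ] turns its first term into an integral; this is
  -- the source of the factor (1 + δ) / δ.
  have h4 : ∫ _t in (0)..δ, ‖φ y‖ ^ 2 ≤ ∫ t in (0)..δ,
      (energyDensity φ (y + t • n) + ∫ s in (0)..δ, energyDensity φ (y + s • n)) :=
    intervalIntegral.integral_mono_on hδ.le (by simp)
      ((hΘ.add continuous_const).intervalIntegrable _ _) key
  rw [intervalIntegral.integral_add (hΘ.intervalIntegrable _ _) (by simp),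
    intervalIntegral.integral_const, intervalIntegral.integral_const] at h4
  simp only [sub_zero, smul_eq_mul] at h4
  rw [div_mul_eq_mul_div, le_div_iff₀ hδ]
  linarith

/-- Each boundary value is controlled by the energy on a segment entering Ω along `n`. The surface
measure is dominated by Lebesgue measure on the hyperplane, and Fubini assembles the segments into a
volume integral over Ω. -/
lemma exists_local_trace_bound (hΩ : IsOpen Ω) (hn : ‖n‖ = 1) (hr : 0 < r)
    (hγ : LipschitzWith L γ)
    (h : ∀ y ∈ Metric.ball x₀ r, y ∈ Ω ↔ γ (y - (inner ℝ n y) • n) < inner ℝ n y) :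
    ∃ C : ℝ≥0∞, C ≠ ⊤ ∧ ∀ φ : Pt d → ℂ, ContDiff ℝ ∞ φ →
      ∫⁻ y in Metric.ball x₀ (r / 2), ENNReal.ofReal (‖φ y‖ ^ 2) ∂(surfaceMeasure Ω) ≤
        C * ∫⁻ x in Ω, ENNReal.ofReal (energyDensity φ x) := by
  obtain ⟨C₁, hC₁, hFub⟩ := exists_lintegral_hyperplane hn
  set δ := r / 2 with hδdef
  have hδ : 0 < δ := by positivity
  set C₂ : ℝ≥0∞ := ((1 + L : ℝ≥0) : ℝ≥0∞) ^ ((d - 1 : ℕ) : ℝ)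
  have hC₂ : C₂ ≠ ⊤ := ENNReal.rpow_ne_top_of_nonneg (by positivity) ENNReal.coe_ne_top
  refine ⟨ENNReal.ofReal ((1 + δ) / δ) * (C₂ * C₁),
    ENNReal.mul_ne_top ENNReal.ofReal_ne_top (ENNReal.mul_ne_top hC₂ hC₁), fun φ hφ => ?_⟩
  set A := frontier Ω ∩ Metric.ball x₀ δ
  have hA : MeasurableSet A := isClosed_frontier.measurableSet.inter measurableSet_ball
  have hgm : Measurable (graphMap n γ) := (lipschitzWith_graphMap hn hγ).continuous.measurable
  let F : Pt d → ℝ≥0∞ := Ω.indicator fun x => ENNReal.ofReal (energyDensity φ x)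
  have hF : Measurable F :=
    (ENNReal.measurable_ofReal.comp (continuous_energyDensity hφ).measurable).indicator
      hΩ.measurableSet
  have hFm : Measurable fun y : Pt d => ∫⁻ s : ℝ, F (y + s • n) :=
    Measurable.lintegral_prod_right' (f := fun p : Pt d × ℝ => F (p.1 + p.2 • n))
      (hF.comp (by fun_prop))
  have hmeas : (surfaceMeasure Ω).restrict (Metric.ball x₀ δ) ≤
      C₂ • Measure.map (graphMap n γ) volume := by
    refine Measure.le_iff.2 fun E hE => ?_
    rw [surfaceMeasure, Measure.restrict_restrict measurableSet_ball, Measure.restrict_apply hE,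
      Measure.smul_apply, Measure.map_apply hgm hE, smul_eq_mul]
    refine (hausdorffMeasure_graph_le hn hγ _ ?_).trans ?_
    · rintro y ⟨-, hy1, hy2⟩
      exact mem_range_graphMap hΩ hn hγ h ⟨hy2, Metric.ball_subset_ball (by linarith) hy1⟩
    · gcongr
      exact inter_subset_left
  have hpt (y : Pt d) (hy : y ∈ A) : ENNReal.ofReal (‖φ y‖ ^ 2) ≤
      ENNReal.ofReal ((1 + δ) / δ) * ∫⁻ s : ℝ, F (y + s • n) := by
    have hΘ : Continuous fun s : ℝ => energyDensity φ (y + s • n) :=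
      (continuous_energyDensity hφ).comp (by fun_prop)
    refine (ENNReal.ofReal_le_ofReal (norm_sq_le_integral hn hφ y hδ)).trans ?_
    rw [ENNReal.ofReal_mul (by positivity), intervalIntegral.integral_of_le hδ.le,
      ofReal_integral_eq_lintegral_ofReal (hΘ.integrableOn_Ioc)
        (Eventually.of_forall fun s => energyDensity_nonneg _ _)]
    refine mul_le_mul_right ?_ _
    refine (setLIntegral_mono' measurableSet_Ioc fun s hs => ?_).trans
      (setLIntegral_le_lintegral (Ioc 0 δ) fun s : ℝ => F (y + s • n))
    rw [show F (y + s • n) = ENNReal.ofReal (energyDensity φ (y + s • n)) from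
      indicator_of_mem (add_smul_mem hΩ hn hγ h hy.1 hy.2 hs.1 hs.2) _]
  calc ∫⁻ y in Metric.ball x₀ δ, ENNReal.ofReal (‖φ y‖ ^ 2) ∂(surfaceMeasure Ω)
      ≤ ∫⁻ y in Metric.ball x₀ δ, ENNReal.ofReal ((1 + δ) / δ) * (∫⁻ s : ℝ, F (y + s • n))
          ∂(surfaceMeasure Ω) := by
        refine lintegral_mono_ae ?_
        rw [surfaceMeasure, Measure.restrict_restrict measurableSet_ball]
        refine (ae_restrict_iff' (measurableSet_ball.inter isClosed_frontier.measurableSet)).2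
          (Eventually.of_forall fun y hy => hpt y ⟨hy.2, hy.1⟩)
    _ = ENNReal.ofReal ((1 + δ) / δ) *
          ∫⁻ y in Metric.ball x₀ δ, (∫⁻ s : ℝ, F (y + s • n)) ∂(surfaceMeasure Ω) :=
        lintegral_const_mul _ hFm
    _ ≤ ENNReal.ofReal ((1 + δ) / δ) *
          ∫⁻ y, (∫⁻ s : ℝ, F (y + s • n)) ∂(C₂ • Measure.map (graphMap n γ) volume) :=
        mul_le_mul_right (lintegral_mono' hmeas le_rfl) _
    _ = ENNReal.ofReal ((1 + δ) / δ) *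
          (C₂ * ∫⁻ q : hyperplane n, ∫⁻ s : ℝ, F ((q : Pt d) + s • n)) := by
        rw [lintegral_smul_measure, lintegral_map hFm hgm, smul_eq_mul]
        congr 3
        ext q
        -- The integral over the full line is translation invariant, so starting at height γ q
        -- instead of 0 changes nothing; this flattens the graph.
        conv_rhs => rw [← lintegral_add_left_eq_self _ (γ q)]
        refine lintegral_congr fun s => ?_
        rw [graphMap, add_smul, add_assoc]
    _ = _ := by
        rw [hFub F hF, lintegral_indicator hΩ.measurableSet]
        ring

end Local

lemma isCompact_frontier_of_isLipschitzDomain (hΩ : IsLipschitzDomain Ω) :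
    IsCompact (frontier Ω) :=
  hΩ.isBounded.isCompact_closure.of_isClosed_subset isClosed_frontier frontier_subset_closure

lemma exists_lintegral_trace_bound (hΩ : IsLipschitzDomain Ω) :
    ∃ C : ℝ≥0∞, C ≠ ⊤ ∧ ∀ φ : Pt d → ℂ, ContDiff ℝ ∞ φ →
      ∫⁻ y, ENNReal.ofReal (‖φ y‖ ^ 2) ∂(surfaceMeasure Ω) ≤
        C * ∫⁻ x in Ω, ENNReal.ofReal (energyDensity φ x) := by
  have := (isCompact_frontier_of_isLipschitzDomain hΩ).induction_on
    (p := fun s => ∃ C : ℝ≥0∞, C ≠ ⊤ ∧ ∀ φ : Pt d → ℂ, ContDiff ℝ ∞ φ →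
      ∫⁻ y in s, ENNReal.ofReal (‖φ y‖ ^ 2) ∂(surfaceMeasure Ω) ≤
        C * ∫⁻ x in Ω, ENNReal.ofReal (energyDensity φ x))
    ⟨0, by simp, fun φ _ => by simp⟩
    (fun s t hst ⟨C, hC, h⟩ => ⟨C, hC, fun φ hφ =>
      (lintegral_mono_set hst).trans (h φ hφ)⟩)
    (fun s t ⟨C, hC, h⟩ ⟨C', hC', h'⟩ => ⟨C + C', ENNReal.add_ne_top.2 ⟨hC, hC'⟩, fun φ hφ =>
      (lintegral_union_le _ _ _).trans (by rw [add_mul]; exact add_le_add (h φ hφ) (h' φ hφ))⟩)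
    (fun x hx => by
      obtain ⟨n, r, L, γ, hn, hr, hγ, h⟩ := hΩ.local_graph x hx
      exact ⟨_, mem_nhdsWithin_of_mem_nhds (Metric.ball_mem_nhds x (half_pos hr)),
        exists_local_trace_bound hΩ.isOpen hn hr hγ h⟩)
  obtain ⟨C, hC, h⟩ := this
  refine ⟨C, hC, fun φ hφ => le_of_eq_of_le ?_ (h φ hφ)⟩
  rw [surfaceMeasure, Measure.restrict_restrict isClosed_frontier.measurableSet, inter_self]

/-- The trace inequality for the constant 1 bounds the area of the boundary by the volume of the
bounded set Ω. -/
lemma isFiniteMeasure_surfaceMeasure (hΩ : IsLipschitzDomain Ω) :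
    IsFiniteMeasure (surfaceMeasure Ω) := by
  obtain ⟨C, hC, h⟩ := exists_lintegral_trace_bound hΩ
  have h1 := h (fun _ => 1) contDiff_const
  have h2 (x : Pt d) : energyDensity (fun _ => 1) x = 1 := by
    have : classicalGrad (fun _ : Pt d => (1 : ℂ)) x = 0 := by
      ext i; simp [classicalGrad_apply]
    simp [energyDensity, this]
  simp only [h2] at h1
  refine ⟨lt_of_le_of_lt ?_ (ENNReal.mul_lt_top hC.lt_top (hΩ.isBounded.measure_lt_top (μ := volume)))⟩
  simpa using h1

lemma ofReal_norm_sq_Lp {α E : Type*} [MeasurableSpace α] {μ : Measure α}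
    [NormedAddCommGroup E] [InnerProductSpace ℂ E] (f : Lp E 2 μ) :
    ENNReal.ofReal (‖f‖ ^ 2) = ∫⁻ x, ENNReal.ofReal (‖f x‖ ^ 2) ∂μ := by
  have h : ‖f‖ ^ 2 = ∫ x, ‖f x‖ ^ 2 ∂μ := by
    have h1 := inner_self_eq_norm_sq_to_K (𝕜 := ℂ) f
    rw [L2.inner_def] at h1
    simp_rw [inner_self_eq_norm_sq_to_K] at h1
    have h2 : ((‖f‖ ^ 2 : ℝ) : ℂ) = ((∫ x, ‖f x‖ ^ 2 ∂μ : ℝ) : ℂ) := by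
      rw [← integral_complex_ofReal]
      push_cast
      exact h1.symm
    exact_mod_cast h2
  rw [h, ofReal_integral_eq_lintegral_ofReal
    ((memLp_two_iff_integrable_sq_norm (Lp.aestronglyMeasurable f)).1 (Lp.memLp f))
    (Eventually.of_forall fun x => by positivity)]

/-- The trace inequality. -/
lemma exists_trace_bound (hΩ : IsLipschitzDomain Ω) :
    ∃ C : ℝ, 0 ≤ C ∧ ∀ p ∈ sobolevGraph Ω, ‖p.2.2‖ ^ 2 ≤ C * (‖p.1‖ ^ 2 + ‖p.2.1‖ ^ 2) := by
  obtain ⟨C, hC, h⟩ := exists_lintegral_trace_bound hΩ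
  refine ⟨C.toReal, ENNReal.toReal_nonneg, ?_⟩
  have hcl : IsClosed {p : L2 Ω × L2Vec Ω × L2Bdry Ω |
      ‖p.2.2‖ ^ 2 ≤ C.toReal * (‖p.1‖ ^ 2 + ‖p.2.1‖ ^ 2)} :=
    isClosed_le (by fun_prop) (by fun_prop)
  refine fun p hp => closure_minimal (fun q hq => ?_) hcl hp
  obtain ⟨φ, hφ, h1, h2, h3⟩ := hq
  have h4 := h φ hφ
  have e3 : ENNReal.ofReal (‖q.2.2‖ ^ 2) =
      ∫⁻ y, ENNReal.ofReal (‖φ y‖ ^ 2) ∂(surfaceMeasure Ω) := by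
    rw [ofReal_norm_sq_Lp]
    exact lintegral_congr_ae (h3.mono fun x hx => by simp only [hx])
  have e1 : ENNReal.ofReal (‖q.1‖ ^ 2 + ‖q.2.1‖ ^ 2) =
      ∫⁻ x in Ω, ENNReal.ofReal (energyDensity φ x) := by
    rw [ENNReal.ofReal_add (by positivity) (by positivity), ofReal_norm_sq_Lp, ofReal_norm_sq_Lp,
      ← lintegral_add_left']
    · refine lintegral_congr_ae ?_
      filter_upwards [h1, h2] with x hx hx'
      rw [hx, hx', energyDensity, ENNReal.ofReal_add (by positivity) (by positivity)]
    · exact ((Lp.aestronglyMeasurable q.1).norm.aemeasurable.pow_const 2).ennreal_ofReal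
  rw [← e3, ← e1, ← ENNReal.ofReal_toReal hC, ← ENNReal.ofReal_mul ENNReal.toReal_nonneg] at h4
  exact (ENNReal.ofReal_le_ofReal_iff (by positivity)).1 h4

/-- Two traces of u differ by some h with (0, 0, h) in the graph, and the trace inequality forces h
= 0. -/
lemma trace_eq_of_mem (hΩ : IsLipschitzDomain Ω) {u : L2 Ω} {G : L2Vec Ω} {g : L2Bdry Ω}
    (hp : (u, G, g) ∈ sobolevGraph Ω) : trace u = g := by
  have h : ∃ g : L2Bdry Ω, IsTrace Ω u g := ⟨g, isTrace_of_mem hΩ.isOpen hp⟩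
  rw [trace, dif_pos h]
  have h1 := isTrace_iff.1 h.choose_spec
  rw [weakGrad_eq_of_mem hΩ.isOpen hp] at h1
  obtain ⟨C, -, hC⟩ := exists_trace_bound hΩ
  have h2 := hC _ ((sobolevGraph Ω).sub_mem h1 hp)
  simp only [Prod.mk_sub_mk, sub_self, norm_zero] at h2
  rw [← sub_eq_zero, ← norm_eq_zero]
  nlinarith [norm_nonneg (h.choose - g)]

end Helmholtz

end

noncomputable section

namespace Helmholtz

variable {d : ℕ} {Ω ΓD : Set (Pt d)}

/-! ### Lipschitz functions are Sobolev functions -/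

lemma tendsto_eLpNorm_of_ae_tendsto_zero {α E : Type*} [MeasurableSpace α] {μ : Measure α}
    [IsFiniteMeasure μ] [NormedAddCommGroup E] {h : ℕ → α → E} {B : ℝ}
    (hm : ∀ k, AEStronglyMeasurable (h k) μ) (hB : ∀ k x, ‖h k x‖ ≤ B)
    (hlim : ∀ᵐ x ∂μ, Tendsto (fun k => h k x) atTop (𝓝 0)) :
    Tendsto (fun k => eLpNorm (h k) 2 μ) atTop (𝓝 0) := by
  have h1 : Tendsto (fun k => ∫⁻ x, ‖h k x‖ₑ ^ (2 : ℝ) ∂μ) atTop (𝓝 (∫⁻ _, 0 ∂μ)) := by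
    refine tendsto_lintegral_of_dominated_convergence' (fun _ => ENNReal.ofReal B ^ (2 : ℝ))
      (fun k => (hm k).enorm.pow_const _) (fun k => Eventually.of_forall fun x => ?_) ?_ ?_
    · refine ENNReal.rpow_le_rpow ?_ (by norm_num)
      rw [← ofReal_norm]
      exact ENNReal.ofReal_le_ofReal (hB k x)
    · rw [lintegral_const]
      exact ENNReal.mul_ne_top (ENNReal.rpow_ne_top_of_nonneg (by norm_num) ENNReal.ofReal_ne_top)
        (measure_ne_top _ _)
    · filter_upwards [hlim] with x hx
      have h2 : Tendsto (fun k => ‖h k x‖ₑ) atTop (𝓝 0) := by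
        have := (continuous_enorm.tendsto (0 : E)).comp hx
        rwa [enorm_zero] at this
      simpa using h2.ennrpow_const 2
  have h3 := h1.ennrpow_const (1 / 2)
  rw [lintegral_zero, ENNReal.zero_rpow_of_pos (by norm_num)] at h3
  refine h3.congr fun k => ?_
  rw [eLpNorm_eq_lintegral_rpow_enorm_toReal (by norm_num) (by norm_num)]
  norm_num

/-- A sequence of bump functions whose supports shrink to the origin. -/
def shrinkingBump (d k : ℕ) : ContDiffBump (0 : Pt d) :=
  ⟨1 / (k + 1), 2 / (k + 1), by positivity, by gcongr; norm_num⟩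

lemma tendsto_shrinkingBump_rOut : Tendsto (fun k => (shrinkingBump d k).rOut) atTop (𝓝 0) := by
  have := (tendsto_one_div_add_atTop_nhds_zero_nat (𝕜 := ℝ)).const_mul 2
  simp only [mul_zero] at this
  refine this.congr fun k => ?_
  simp [shrinkingBump]; ring

open scoped Convolution in
/-- The mollification of a function. -/
def mollify (f : Pt d → ℝ) (k : ℕ) : Pt d → ℝ :=
  (shrinkingBump d k).normed volume ⋆[ContinuousLinearMap.lsmul ℝ ℝ, volume] f

section Mollify

variable {f : Pt d → ℝ} {C : ℝ≥0}

lemma contDiff_mollify (hf : Continuous f) (k : ℕ) : ContDiff ℝ ∞ (mollify f k) :=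
  (shrinkingBump d k).hasCompactSupport_normed.contDiff_convolution_left _
    (shrinkingBump d k).contDiff_normed hf.locallyIntegrable

/-- The derivative first falls on the smooth kernel. Integration by parts, valid for a Lipschitz
function against a compactly supported Lipschitz one, moves it to f. -/
lemma fderiv_mollify (hf : LipschitzWith C f) (k : ℕ) (x v : Pt d) :
    fderiv ℝ (mollify f k) x v = mollify (fun y => lineDeriv ℝ f y v) k x := by
  set ψ := (shrinkingBump d k).normed volume with hψ
  have hs : HasCompactSupport ψ := (shrinkingBump d k).hasCompactSupport_normed
  have hc : ContDiff ℝ ∞ ψ := (shrinkingBump d k).contDiff_normed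
  have h1 := hs.hasFDerivAt_convolution_left (ContinuousLinearMap.lsmul ℝ ℝ) (hc.of_le (by simp))
    (hf.continuous.locallyIntegrable (μ := volume)) x
  have h2 := (hs.fderiv (𝕜 := ℝ)).convolutionExists_left
    ((ContinuousLinearMap.lsmul ℝ ℝ).precompL (Pt d)) (hc.continuous_fderiv (by simp))
    (hf.continuous.locallyIntegrable (μ := volume)) x
  rw [mollify, h1.fderiv, convolution_def, ContinuousLinearMap.integral_apply h2, mollify,
    convolution_def]
  have hg : LipschitzWith C fun t => f (x - t) := by
    refine LipschitzWith.of_dist_le_mul fun s t => (hf.dist_le_mul _ _).trans_eq ?_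
    rw [dist_sub_left]
  obtain ⟨D, hD⟩ := hc.lipschitzWith_of_hasCompactSupport hs (by simp)
  have h3 := hg.integral_lineDeriv_mul_eq (μ := volume) hD hs v
  have h4 (t : Pt d) : lineDeriv ℝ (fun t => f (x - t)) t v = - lineDeriv ℝ f (x - t) v := by
    rw [← lineDeriv_neg]
    simp only [lineDeriv]
    congr 1
    ext s
    congr 1
    module
  have h5 (t : Pt d) : lineDeriv ℝ ψ t (-v) = - fderiv ℝ ψ t v := by
    rw [lineDeriv_neg, (hc.differentiable (by simp) t).lineDeriv_eq_fderiv]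
  simp only [h4, h5, neg_mul, integral_neg, neg_inj] at h3
  calc _ = ∫ t, fderiv ℝ ψ t v * f (x - t) := rfl
    _ = _ := by
      rw [← h3]
      refine integral_congr_ae (Eventually.of_forall fun t => ?_)
      simp [hψ, mul_comm]

lemma dist_mollify_le {g : Pt d → ℝ} (hg : AEStronglyMeasurable g volume) {B : ℝ}
    (hB : ∀ x, |g x| ≤ B) (k : ℕ) (x : Pt d) : dist (mollify g k x) (g x) ≤ 2 * B :=
  ContDiffBump.dist_normed_convolution_le hg fun y _ => by
    rw [Real.dist_eq]
    have := abs_sub (g y) (g x)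
    have := hB y
    have := hB x
    linarith

lemma dist_mollify_le_of_lipschitzWith (hf : LipschitzWith C f) (k : ℕ) (x : Pt d) :
    dist (mollify f k x) (f x) ≤ C * (shrinkingBump d k).rOut :=
  ContDiffBump.dist_normed_convolution_le hf.continuous.aestronglyMeasurable fun y hy =>
    (hf.dist_le_mul y x).trans (by gcongr; exact (Metric.mem_ball.1 hy).le)

/-- Lebesgue differentiation; it applies because the outer radius of the bump stays within a factor
2 of the inner one. -/
lemma ae_tendsto_mollify {g : Pt d → ℝ} (hg : LocallyIntegrable g) :
    ∀ᵐ x, Tendsto (fun k => mollify g k x) atTop (𝓝 (g x)) :=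
  ContDiffBump.ae_convolution_tendsto_right_of_locallyIntegrable tendsto_shrinkingBump_rOut
    (K := 2) (Eventually.of_forall fun k => by simp [shrinkingBump]; ring_nf; rfl) hg

lemma classicalGrad_ofReal {g : Pt d → ℝ} {x : Pt d} (hg : DifferentiableAt ℝ g x) (i : Fin d) :
    classicalGrad (fun y => (g y : ℂ)) x i = (fderiv ℝ g x (EuclideanSpace.single i 1) : ℝ) := by
  rw [classicalGrad_apply]
  have := (Complex.ofRealCLM.hasFDerivAt (x := g x)).comp x hg.hasFDerivAt
  rw [show (fun y => (g y : ℂ)) = Complex.ofRealCLM ∘ g from rfl, this.fderiv]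
  rfl

end Mollify

lemma norm_euclidean_le {x : EuclideanSpace ℂ (Fin d)} {B : ℝ} (hB : 0 ≤ B)
    (h : ∀ i, ‖x i‖ ≤ B) : ‖x‖ ≤ √d * B := by
  rw [EuclideanSpace.norm_eq]
  calc √(∑ i, ‖x i‖ ^ 2) ≤ √(∑ _i : Fin d, B ^ 2) := by
        gcongr with i
        exact h i
    _ = √d * B := by simp [Real.sqrt_mul, Real.sqrt_sq hB]

/-- Mollifications converge uniformly, which handles f in Ω and on the boundary at once. Their
gradients are mollified line derivatives: uniformly bounded and convergent almost everywhere, hence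
convergent in L² by domination. -/
lemma exists_mem_sobolevGraph_of_lipschitzWith (hΩ : IsLipschitzDomain Ω) {f : Pt d → ℝ}
    {C : ℝ≥0} (hf : LipschitzWith C f) : ∃ (u : L2 Ω) (G : L2Vec Ω) (g : L2Bdry Ω),
      (u, G, g) ∈ sobolevGraph Ω ∧ u =ᵐ[volume.restrict Ω] (fun x => (f x : ℂ)) ∧
        g =ᵐ[surfaceMeasure Ω] fun x => (f x : ℂ) := by
  have hfin := isFiniteMeasure_surfaceMeasure hΩ
  have hfin' : IsFiniteMeasure ((volume : Measure (Pt d)).restrict Ω) :=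
    ⟨by simpa using hΩ.isBounded.measure_lt_top (μ := volume)⟩
  have hfc : Continuous fun x => (f x : ℂ) := Complex.continuous_ofReal.comp hf.continuous
  obtain ⟨B, hB⟩ := hΩ.isBounded.isCompact_closure.exists_bound_of_continuousOn hfc.continuousOn
  have m1 : MemLp (fun x => (f x : ℂ)) 2 ((volume : Measure (Pt d)).restrict Ω) := by
    refine MemLp.of_bound hfc.aestronglyMeasurable B ?_
    filter_upwards [ae_restrict_mem hΩ.isOpen.measurableSet] with x hx
    exact hB x (subset_closure hx)
  have m3 : MemLp (fun x => (f x : ℂ)) 2 (surfaceMeasure Ω) := by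
    refine MemLp.of_bound hfc.aestronglyMeasurable B ?_
    filter_upwards [ae_restrict_mem isClosed_frontier.measurableSet] with x hx
    exact hB x (frontier_subset_closure hx)
  let e (i : Fin d) : Pt d := EuclideanSpace.single i 1
  have he (i : Fin d) : ‖e i‖ = 1 := by simp [e]
  have hld (i : Fin d) (x : Pt d) : |lineDeriv ℝ f x (e i)| ≤ C := by
    simpa [he i] using norm_lineDeriv_le_of_lipschitz ℝ (v := e i) (x₀ := x) hf
  have hmeas (i : Fin d) : Measurable fun x => lineDeriv ℝ f x (e i) :=
    measurable_lineDeriv hf.continuous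
  let Gf : Pt d → EuclideanSpace ℂ (Fin d) := fun x =>
    WithLp.toLp 2 fun i => ((lineDeriv ℝ f x (e i) : ℝ) : ℂ)
  have hGm : Measurable Gf :=
    (PiLp.continuous_toLp 2 _).measurable.comp
      (measurable_pi_iff.2 fun i => Complex.measurable_ofReal.comp (hmeas i))
  have m2 : MemLp Gf 2 ((volume : Measure (Pt d)).restrict Ω) := by
    refine MemLp.of_bound hGm.aestronglyMeasurable (√d * C) (Eventually.of_forall fun x => ?_)
    refine norm_euclidean_le C.coe_nonneg fun i => ?_
    simpa [Gf] using hld i x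
  refine ⟨m1.toLp _, m2.toLp _, m3.toLp _, ?_, m1.coeFn_toLp, m3.coeFn_toLp⟩
  have hunif (k : ℕ) (x : Pt d) : ‖(mollify f k x : ℂ) - f x‖ ≤ C * (shrinkingBump d k).rOut := by
    rw [← Complex.ofReal_sub, Complex.norm_real, ← dist_eq_norm]
    exact dist_mollify_le_of_lipschitzWith hf k x
  have hpt (x : Pt d) : Tendsto (fun k => (mollify f k x : ℂ) - f x) atTop (𝓝 0) := by
    refine squeeze_zero_norm (fun k => hunif k x) ?_
    simpa using tendsto_shrinkingBump_rOut.const_mul (C : ℝ)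
  have hunif' (k : ℕ) (x : Pt d) : ‖(mollify f k x : ℂ) - f x‖ ≤ C * 2 := by
    refine (hunif k x).trans ?_
    gcongr
    simp only [shrinkingBump]
    exact div_le_self (by norm_num) (by linarith [Nat.cast_nonneg (α := ℝ) k])
  have hcm (k : ℕ) : ContDiff ℝ ∞ fun x => (mollify f k x : ℂ) :=
    Complex.ofRealCLM.contDiff.comp (contDiff_mollify hf.continuous k)
  refine mem_sobolevGraph_of_tendsto (φ := fun k x => (mollify f k x : ℂ)) hcm ?_ ?_ ?_
  · refine (tendsto_eLpNorm_of_ae_tendsto_zero (fun k =>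
      ((hcm k).continuous.sub hfc).aestronglyMeasurable) hunif'
      (Eventually.of_forall hpt)).congr fun k => eLpNorm_congr_ae ?_
    filter_upwards [m1.coeFn_toLp] with x hx
    rw [hx, Pi.sub_apply]
  · have hcl (k : ℕ) (x : Pt d) (i : Fin d) : classicalGrad (fun y => (mollify f k y : ℂ)) x i =
        ((mollify (fun y => lineDeriv ℝ f y (e i)) k x : ℝ) : ℂ) := by
      rw [classicalGrad_ofReal ((contDiff_mollify hf.continuous k).differentiable (by simp) x),
        fderiv_mollify hf]
    refine (tendsto_eLpNorm_of_ae_tendsto_zero (B := √d * (2 * C)) (h := fun k x =>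
      classicalGrad (fun y => (mollify f k y : ℂ)) x - Gf x) (fun k =>
      ((continuous_classicalGrad (hcm k)).measurable.sub hGm).aestronglyMeasurable)
      (fun k x => ?_) ?_).congr fun k => eLpNorm_congr_ae ?_
    · refine norm_euclidean_le (by positivity) fun i => ?_
      rw [PiLp.sub_apply, hcl]
      simp only [Gf]
      rw [← Complex.ofReal_sub, Complex.norm_real, ← dist_eq_norm]
      exact dist_mollify_le (hmeas i).aestronglyMeasurable (hld i) k x
    · refine ae_restrict_of_ae ?_
      filter_upwards [ae_all_iff.2 fun i : Fin d =>
        ae_tendsto_mollify (hf.locallyIntegrable_lineDeriv (μ := volume) (e i))] with x hx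
      have : Tendsto (fun k => WithLp.toLp 2 fun i =>
          ((mollify (fun y => lineDeriv ℝ f y (e i)) k x : ℝ) : ℂ) - ((lineDeriv ℝ f x (e i) : ℝ) : ℂ))
          atTop (𝓝 (WithLp.toLp 2 fun _ : Fin d => (0 : ℂ))) := by
        refine ((PiLp.continuous_toLp 2 _).tendsto _).comp (tendsto_pi_nhds.2 fun i => ?_)
        have := ((Complex.continuous_ofReal.tendsto _).comp (hx i)).sub_const
          ((lineDeriv ℝ f x (e i) : ℝ) : ℂ)
        simpa using this
      refine this.congr fun k => ?_
      ext i
      rw [PiLp.sub_apply, hcl]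
    · filter_upwards [m2.coeFn_toLp] with x hx
      rw [hx]
  · refine (tendsto_eLpNorm_of_ae_tendsto_zero (fun k =>
      ((hcm k).continuous.sub hfc).aestronglyMeasurable) hunif'
      (Eventually.of_forall hpt)).congr fun k => eLpNorm_congr_ae ?_
    filter_upwards [m3.coeFn_toLp] with x hx
    rw [hx, Pi.sub_apply]

end Helmholtz

end

noncomputable section

namespace Helmholtz

variable {d : ℕ} {Ω ΓD : Set (Pt d)} {K : Geometry.SimplicialComplex ℝ (Pt d)}

/-! ### Barycentric coordinates and hat functions -/

lemma isCompact_simplex (s : Finset (Pt d)) : IsCompact (simplex s) :=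
  Set.Finite.isCompact_convexHull ℝ s.finite_toSet

/-- `a` are the barycentric coordinates of `x` in the face `s`, extended by zero. -/
structure IsBary (K : Geometry.SimplicialComplex ℝ (Pt d)) (s : Finset (Pt d)) (a : Pt d → ℝ)
    (x : Pt d) : Prop where
  mem : s ∈ K.faces
  nonneg : ∀ y, 0 ≤ a y
  eq_zero : ∀ y ∉ s, a y = 0
  sum_eq : ∑ y ∈ s, a y = 1
  sum_smul : ∑ y ∈ s, a y • y = x

lemma isBary_of_weights {s : Finset (Pt d)} (hs : s ∈ K.faces) {w : Pt d → ℝ} {x : Pt d}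
    (h0 : ∀ y ∈ s, 0 ≤ w y) (h1 : ∑ y ∈ s, w y = 1) (hx : ∑ y ∈ s, w y • y = x) :
    IsBary K s ((s : Set (Pt d)).indicator w) x where
  mem := hs
  nonneg := indicator_nonneg h0
  eq_zero y hy := indicator_of_notMem (by simpa using hy) _
  sum_eq := by
    rw [← h1]
    exact Finset.sum_congr rfl fun y hy => by simp [hy]
  sum_smul := by
    rw [← hx]
    exact Finset.sum_congr rfl fun y hy => by simp [hy]

lemma exists_isBary {s : Finset (Pt d)} (hs : s ∈ K.faces) {x : Pt d} (hx : x ∈ simplex s) :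
    ∃ a, IsBary K s a x := by
  obtain ⟨w, h0, h1, h2⟩ := Finset.mem_convexHull'.1 hx
  exact ⟨_, isBary_of_weights hs h0 h1 h2⟩

/-- Faces of a complex meet only in the hull of their common vertices, so vertex-disjoint faces are
disjoint compact sets. There are finitely many pairs, so one δ serves all. -/
lemma exists_pos_le_dist_of_disjoint_faces (hK : K.faces.Finite) :
    ∃ δ : ℝ, 0 < δ ∧ ∀ s ∈ K.faces, ∀ t ∈ K.faces, Disjoint s t →
      ∀ x ∈ simplex s, ∀ y ∈ simplex t, δ ≤ dist x y := by
  have h : ∀ᶠ δ in 𝓝[>] (0 : ℝ), ∀ s ∈ K.faces, ∀ t ∈ K.faces, Disjoint s t →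
      ∀ x ∈ simplex s, ∀ y ∈ simplex t, δ ≤ dist x y := by
    refine (eventually_all_finite hK).2 fun s hs => (eventually_all_finite hK).2 fun t ht => ?_
    by_cases hst : Disjoint s t
    · have hne : (simplex s ×ˢ simplex t).Nonempty :=
        (convexHull_nonempty_iff.2 (K.nonempty_of_mem_faces hs)).prod
          (convexHull_nonempty_iff.2 (K.nonempty_of_mem_faces ht))
      obtain ⟨p, hp, hmin⟩ := ((isCompact_simplex s).prod (isCompact_simplex t)).exists_isMinOn hne
        continuous_dist.continuousOn
      have hpos : 0 < dist p.1 p.2 := by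
        refine dist_pos.2 fun heq => ?_
        have h2 : p.1 ∈ simplex t := by rw [heq]; exact hp.2
        have := K.inter_subset_convexHull hs ht ⟨hp.1, h2⟩
        rw [← Finset.coe_inter, Finset.disjoint_iff_inter_eq_empty.1 hst] at this
        simp at this
      filter_upwards [Ioo_mem_nhdsGT hpos] with δ hδ _ x hx y hy
      have hle : dist p.1 p.2 ≤ dist x y := isMinOn_iff.1 hmin (x, y) ⟨hx, hy⟩
      exact hδ.2.le.trans hle
    · exact Eventually.of_forall fun _ h => absurd h hst
  obtain ⟨δ, hδ, h0⟩ := (h.and self_mem_nhdsWithin).exists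
  exact ⟨δ, h0, hδ⟩

/-- Subtract from both coordinate vectors their pointwise minimum. The remainders have disjoint
supports and a common mass μ that bounds every |a z - b z|. If μ > 0, then x - y is μ times the
difference of points in two disjoint faces, so μ δ ≤ dist x y. The estimate compares points of
different simplices, and at x = y it shows that coordinates do not depend on the simplex. -/
lemma exists_bary_bound (hK : K.faces.Finite) : ∃ C : ℝ≥0, ∀ s t a b x y,
    IsBary K s a x → IsBary K t b y → ∀ z, |a z - b z| ≤ C * dist x y := by
  classical
  obtain ⟨δ, hδ, hdist⟩ := exists_pos_le_dist_of_disjoint_faces hK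
  refine ⟨⟨δ⁻¹, by positivity⟩, fun s t a b x y ha hb z => ?_⟩
  set m : Pt d → ℝ := fun v => min (a v) (b v)
  set a' : Pt d → ℝ := fun v => a v - m v
  set b' : Pt d → ℝ := fun v => b v - m v
  have ha' (v) : 0 ≤ a' v := sub_nonneg.2 (min_le_left _ _)
  have hb' (v) : 0 ≤ b' v := sub_nonneg.2 (min_le_right _ _)
  have hab (v) : a' v = 0 ∨ b' v = 0 := by
    rcases le_total (a v) (b v) with h | h
    · left; simp [a', m, h]
    · right; simp [b', m, h]
  have hm (v) : 0 ≤ m v := le_min (ha.nonneg v) (hb.nonneg v)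
  have ha0 (v) (hv : v ∉ s) : a' v = 0 :=
    le_antisymm (by simp only [a', ha.eq_zero v hv]; linarith [hm v]) (ha' v)
  have hb0 (v) (hv : v ∉ t) : b' v = 0 :=
    le_antisymm (by simp only [b', hb.eq_zero v hv]; linarith [hm v]) (hb' v)
  have sums {E : Type} [AddCommGroup E] [Module ℝ E] (f : Pt d → E) :
      (∑ v ∈ s, a v • f v) - ∑ v ∈ t, b v • f v =
        (∑ v ∈ s, a' v • f v) - ∑ v ∈ t, b' v • f v := by
    have e1 : ∑ v ∈ s, a v • f v = ∑ v ∈ s ∪ t, a v • f v :=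
      Finset.sum_subset Finset.subset_union_left fun v _ hv => by simp [ha.eq_zero v hv]
    have e2 : ∑ v ∈ t, b v • f v = ∑ v ∈ s ∪ t, b v • f v :=
      Finset.sum_subset Finset.subset_union_right fun v _ hv => by simp [hb.eq_zero v hv]
    have e3 : ∑ v ∈ s, a' v • f v = ∑ v ∈ s ∪ t, a' v • f v :=
      Finset.sum_subset Finset.subset_union_left fun v _ hv => by simp [ha0 v hv]
    have e4 : ∑ v ∈ t, b' v • f v = ∑ v ∈ s ∪ t, b' v • f v :=
      Finset.sum_subset Finset.subset_union_right fun v _ hv => by simp [hb0 v hv]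
    rw [e1, e2, e3, e4, ← Finset.sum_sub_distrib, ← Finset.sum_sub_distrib]
    refine Finset.sum_congr rfl fun v _ => ?_
    simp only [a', b']
    module
  set μ := ∑ v ∈ s, a' v with hμ
  have hμb : ∑ v ∈ t, b' v = μ := by
    have := sums (fun _ => (1 : ℝ))
    simp only [smul_eq_mul, mul_one, ha.sum_eq, hb.sum_eq] at this
    linarith
  have hμ0 : 0 ≤ μ := Finset.sum_nonneg fun v _ => ha' v
  have haμ (v) : a' v ≤ μ := by
    by_cases hv : v ∈ s
    · exact Finset.single_le_sum (fun v _ => ha' v) hv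
    · rw [ha0 v hv]; exact hμ0
  have hbμ (v) : b' v ≤ μ := by
    by_cases hv : v ∈ t
    · rw [← hμb]; exact Finset.single_le_sum (fun v _ => hb' v) hv
    · rw [hb0 v hv]; exact hμ0
  have hz : |a z - b z| ≤ μ := by
    have : a z - b z = a' z - b' z := by simp [a', b']
    rw [this, abs_le]
    constructor <;> linarith [ha' z, hb' z, haμ z, hbμ z]
  have hxy : μ * δ ≤ dist x y := by
    rcases hμ0.eq_or_lt with h0 | hpos
    · rw [← h0, zero_mul]; exact dist_nonneg
    have face {u : Finset (Pt d)} (hu : u ∈ K.faces) {c : Pt d → ℝ} (hc : ∀ v, 0 ≤ c v)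
        (hcμ : ∑ v ∈ u, c v = μ) : u.filter (fun v => c v ≠ 0) ∈ K.faces ∧
          μ⁻¹ • ∑ v ∈ u, c v • v ∈ simplex (u.filter fun v => c v ≠ 0) := by
      have hsum : ∑ v ∈ u.filter (fun v => c v ≠ 0), c v = μ := by
        rw [Finset.sum_filter_ne_zero, hcμ]
      refine ⟨K.down_closed hu (Finset.filter_subset _ _) ?_,
        Finset.mem_convexHull'.2 ⟨fun v => μ⁻¹ * c v, fun v _ => by have := hc v; positivity, ?_, ?_⟩⟩
      · rw [Finset.nonempty_iff_ne_empty]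
        intro he
        rw [he, Finset.sum_empty] at hsum
        exact hpos.ne hsum
      · rw [← Finset.mul_sum, hsum, inv_mul_cancel₀ hpos.ne']
      · simp_rw [mul_smul]
        rw [← Finset.smul_sum, Finset.sum_filter_of_ne]
        intro v _ hv h0
        simp [h0] at hv
    obtain ⟨hs1, hs2⟩ := face ha.mem ha' hμ.symm
    obtain ⟨ht1, ht2⟩ := face hb.mem hb' hμb
    have hd := hdist _ hs1 _ ht1 (Finset.disjoint_left.2 fun v h1 h2 =>
      (hab v).elim (Finset.mem_filter.1 h1).2 (Finset.mem_filter.1 h2).2) _ hs2 _ ht2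
    have key : x - y = μ • (μ⁻¹ • ∑ v ∈ s, a' v • v - μ⁻¹ • ∑ v ∈ t, b' v • v) := by
      rw [← ha.sum_smul, ← hb.sum_smul, sums (fun v => v), ← smul_sub, smul_smul,
        mul_inv_cancel₀ hpos.ne', one_smul]
    rw [dist_eq_norm x y, key, norm_smul, ← dist_eq_norm, Real.norm_of_nonneg hμ0]
    gcongr
  calc |a z - b z| ≤ μ := hz
    _ = δ⁻¹ * (μ * δ) := by field_simp
    _ ≤ δ⁻¹ * dist x y := by gcongr

lemma IsBary.hat_eq (hK : K.faces.Finite) {s : Finset (Pt d)} {a : Pt d → ℝ} {x : Pt d}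
    (h : IsBary K s a x) (z : Pt d) : hat K z x = a z := by
  obtain ⟨C, hC⟩ := exists_bary_bound hK
  have hsub : ∀ t ∈ {t | ∃ s ∈ K.faces, ∃ w : Pt d → ℝ, (∀ y ∈ s, 0 ≤ w y) ∧ ∑ y ∈ s, w y = 1 ∧
      ∑ y ∈ s, w y • y = x ∧ z ∈ s ∧ t = w z}, t = a z := by
    rintro t ⟨s', hs', w, h0, h1, h2, hz, rfl⟩
    have := hC _ _ _ _ _ _ (isBary_of_weights hs' h0 h1 h2) h z
    rw [dist_self, mul_zero, indicator_of_mem (by simpa using hz)] at this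
    exact sub_eq_zero.1 (abs_nonpos_iff.1 this)
  unfold hat
  by_cases hz : z ∈ s
  · refine (congrArg sSup (Subset.antisymm hsub (singleton_subset_iff.2 ?_))).trans
      (csSup_singleton (a z))
    exact ⟨s, h.mem, a, fun y _ => h.nonneg y, h.sum_eq, h.sum_smul, hz, rfl⟩
  · rw [h.eq_zero z hz] at hsub ⊢
    rcases subset_singleton_iff_eq.1 hsub with he | he
    -- If no face containing x has z as a vertex, the convention that the supremum of the empty set
    -- is 0 gives the right value.
    · exact (congrArg sSup he).trans Real.sSup_empty
    · exact (congrArg sSup he).trans (csSup_singleton 0)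

/-- `hat` is 0 off the mesh and may jump there, whereas mollification needs a Lipschitz function on
the whole space; hence the extension. -/
lemma exists_lipschitzWith_eqOn_hat (hK : K.faces.Finite) (z : Pt d) :
    ∃ (C : ℝ≥0) (f : Pt d → ℝ), LipschitzWith C f ∧ EqOn (hat K z) f K.space := by
  obtain ⟨C, hC⟩ := exists_bary_bound hK
  have h : LipschitzOnWith C (hat K z) K.space := by
    refine LipschitzOnWith.of_dist_le_mul fun x hx y hy => ?_
    obtain ⟨s, hs, hxs⟩ := Geometry.SimplicialComplex.mem_space_iff.1 hx
    obtain ⟨t, ht, hyt⟩ := Geometry.SimplicialComplex.mem_space_iff.1 hy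
    obtain ⟨a, ha⟩ := exists_isBary hs hxs
    obtain ⟨b, hb⟩ := exists_isBary ht hyt
    rw [ha.hat_eq hK, hb.hat_eq hK]
    exact hC _ _ _ _ _ _ ha hb z
  obtain ⟨f, hf, hfe⟩ := h.extend_real
  exact ⟨C, f, hf, hfe⟩

lemma hat_nonneg (hK : K.faces.Finite) (z : Pt d) {x : Pt d} (hx : x ∈ K.space) :
    0 ≤ hat K z x := by
  obtain ⟨s, hs, hxs⟩ := Geometry.SimplicialComplex.mem_space_iff.1 hx
  obtain ⟨a, ha⟩ := exists_isBary hs hxs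
  rw [ha.hat_eq hK]
  exact ha.nonneg z

/-- The Dirichlet boundary is a union of faces, and a vertex off it belongs to none of them. This is
where the mesh must resolve Γ_D. -/
lemma hat_eq_zero_of_mem_dirichlet (hM : IsMesh Ω ΓD K) {z x : Pt d} (hz : z ∉ closure ΓD)
    (hx : x ∈ closure ΓD) : hat K z x = 0 := by
  obtain ⟨F, hF, -, hcl⟩ := hM.dirichlet
  rw [hcl] at hx
  obtain ⟨s, hs, hxs⟩ := mem_iUnion₂.1 hx
  obtain ⟨a, ha⟩ := exists_isBary (hF hs) hxs
  rw [ha.hat_eq hM.finite]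
  refine ha.eq_zero z fun hzs => hz ?_
  rw [hcl]
  exact mem_iUnion₂.2 ⟨s, hs, subset_convexHull ℝ _ hzs⟩

lemma affineSpan_element {T : Finset (Pt d)} (hT : T ∈ elements K) :
    affineSpan ℝ (range ((↑) : T → Pt d)) = ⊤ := by
  rw [(K.indep hT.1).affineSpan_eq_top_iff_card_eq_finrank_add_one]
  simp [hT.2]

lemma exists_affineMap_eq_hat (hK : K.faces.Finite) {T : Finset (Pt d)} (hT : T ∈ elements K)
    (z : Pt d) : ∃ p : Pt d →ᵃ[ℝ] ℂ, ∀ x ∈ simplex T, (hat K z x : ℂ) = p x := by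
  by_cases hz : z ∈ T
  · let b : AffineBasis T ℝ (Pt d) := ⟨_, K.indep hT.1, affineSpan_element hT⟩
    refine ⟨(Complex.ofRealCLM : ℝ →ₗ[ℝ] ℂ).toAffineMap.comp (b.coord ⟨z, hz⟩), fun x hx => ?_⟩
    obtain ⟨a, ha⟩ := exists_isBary hT.1 hx
    rw [ha.hat_eq hK]
    have h1 : ∑ v : T, a v = 1 := by
      rw [← ha.sum_eq]; exact Finset.sum_coe_sort T a
    have h2 : x = Finset.univ.affineCombination ℝ b fun v : T => a v := by
      rw [Finset.univ.affineCombination_eq_linear_combination _ _ h1, ← ha.sum_smul]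
      exact (Finset.sum_coe_sort T fun v => a v • v).symm
    have h3 : b.coord ⟨z, hz⟩ x = a z := by
      rw [h2, b.coord_apply_combination_of_mem (Finset.mem_univ _) h1]
    simp [h3]
  · refine ⟨0, fun x hx => ?_⟩
    obtain ⟨a, ha⟩ := exists_isBary hT.1 hx
    rw [ha.hat_eq hK, ha.eq_zero z hz]
    simp

lemma exists_mem_sobolevGraph_hatL2 (hΩ : IsLipschitzDomain Ω) (hM : IsMesh Ω ΓD K) (z : Pt d) :
    hatL2 Ω K z =ᵐ[volume.restrict Ω] (fun x => (hat K z x : ℂ)) ∧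
    ∃ G g, (hatL2 Ω K z, G, g) ∈ sobolevGraph Ω ∧
      g =ᵐ[surfaceMeasure Ω] fun x => (hat K z x : ℂ) := by
  obtain ⟨C, f, hf, hfe⟩ := exists_lipschitzWith_eqOn_hat hM.finite z
  rw [hM.space_eq] at hfe
  obtain ⟨u, G, g, hp, hu, hg⟩ := exists_mem_sobolevGraph_of_lipschitzWith hΩ hf
  have h1 : u =ᵐ[volume.restrict Ω] fun x => (hat K z x : ℂ) := by
    filter_upwards [hu, ae_restrict_mem hΩ.isOpen.measurableSet] with x hx hxΩ
    rw [hx, hfe (subset_closure hxΩ)]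
  have h2 : MemLp (fun x => (hat K z x : ℂ)) 2 ((volume : Measure (Pt d)).restrict Ω) :=
    (memLp_congr_ae h1).1 (Lp.memLp u)
  have h3 : hatL2 Ω K z =ᵐ[volume.restrict Ω] fun x => (hat K z x : ℂ) := by
    rw [hatL2, dif_pos h2]
    exact h2.coeFn_toLp
  have h4 : hatL2 Ω K z = u := Lp.ext (h3.trans h1.symm)
  refine ⟨h3, G, g, h4 ▸ hp, ?_⟩
  filter_upwards [hg, ae_restrict_mem isClosed_frontier.measurableSet] with x hx hxΩ
  rw [hx, hfe (frontier_subset_closure hxΩ)]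

lemma hatL2_mem_VH (hΩ : IsLipschitzDomain Ω) (hM : IsMesh Ω ΓD K) {z : Pt d}
    (hz : z ∈ freeNodes K ΓD) : hatL2 Ω K z ∈ VH Ω ΓD K := by
  obtain ⟨h1, G, g, hp, hg⟩ := exists_mem_sobolevGraph_hatL2 hΩ hM z
  refine ⟨(mem_V_iff hΩ.isOpen).2 ⟨G, g, hp, ?_⟩, fun T hT => ?_⟩
  · filter_upwards [hg] with x hx hxD
    rw [hx, hat_eq_zero_of_mem_dirichlet hM hz.2 (subset_closure hxD), Complex.ofReal_zero]
  · obtain ⟨p, hpT⟩ := exists_affineMap_eq_hat hM.finite hT z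
    refine ⟨p, ?_⟩
    filter_upwards [h1] with x hx hxT
    rw [hx, hpT x hxT]

/-! ### The interpolation operator -/

lemma finite_freeNodes (hM : IsMesh Ω ΓD K) : (freeNodes K ΓD).Finite := by
  have : (K.vertices).Finite :=
    hM.finite.preimage (f := fun x : Pt d => ({x} : Finset (Pt d)))
      (fun x _ y _ h => Finset.singleton_injective h)
  exact this.subset sdiff_subset

/-- The mass of a hat function. -/
def hatMass (Ω : Set (Pt d)) (K : Geometry.SimplicialComplex ℝ (Pt d)) (z : Pt d) : ℝ :=
  ∫ x in Ω, hat K z x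

lemma hatMass_nonneg (hΩ : IsLipschitzDomain Ω) (hM : IsMesh Ω ΓD K) (z : Pt d) :
    0 ≤ hatMass Ω K z :=
  setIntegral_nonneg hΩ.isOpen.measurableSet fun _ hx =>
    hat_nonneg hM.finite z (hM.space_eq ▸ subset_closure hx)

lemma hatL2_eq_zero_of_hatMass (hΩ : IsLipschitzDomain Ω) (hM : IsMesh Ω ΓD K) {z : Pt d}
    (h : hatMass Ω K z = 0) : hatL2 Ω K z = 0 := by
  have hfin' : IsFiniteMeasure ((volume : Measure (Pt d)).restrict Ω) :=
    ⟨by simpa using hΩ.isBounded.measure_lt_top (μ := volume)⟩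
  obtain ⟨h1, -⟩ := exists_mem_sobolevGraph_hatL2 hΩ hM z
  have hint : Integrable (fun x => hat K z x) ((volume : Measure (Pt d)).restrict Ω) := by
    have h2 : Integrable (fun x => (hat K z x : ℂ)) ((volume : Measure (Pt d)).restrict Ω) :=
      ((Lp.memLp (hatL2 Ω K z)).integrable (by norm_num)).congr h1
    exact h2.re
  have h0 : 0 ≤ᵐ[(volume : Measure (Pt d)).restrict Ω] fun x => hat K z x := by
    filter_upwards [ae_restrict_mem hΩ.isOpen.measurableSet] with x hx
    exact hat_nonneg hM.finite z (hM.space_eq ▸ subset_closure hx)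
  have h3 := (integral_eq_zero_iff_of_nonneg_ae h0 hint).1 h
  refine Lp.eq_zero_iff_ae_eq_zero.2 ?_
  filter_upwards [h1, h3] with x hx hx3
  rw [hx, hx3]
  simp

/-- The interpolation operator as a bounded operator on `L²(Ω)`. -/
def interpL (hM : IsMesh Ω ΓD K) : L2 Ω →L[ℂ] L2 Ω :=
  ∑ z ∈ (finite_freeNodes hM).toFinset,
    ((hatMass Ω K z : ℂ)⁻¹ • innerSL ℂ (hatL2 Ω K z)).smulRight (hatL2 Ω K z)

lemma interp_eq (hΩ : IsLipschitzDomain Ω) (hM : IsMesh Ω ΓD K) (v : L2 Ω) :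
    interp ΓD K v = interpL hM v := by
  rw [interp, finsum_mem_eq_finite_toFinset_sum _ (finite_freeNodes hM), interpL,
    sum_apply]
  refine Finset.sum_congr rfl fun z _ => ?_
  obtain ⟨h1, -⟩ := exists_mem_sobolevGraph_hatL2 hΩ hM z
  have e1 : ∫ x in Ω, v x * (hat K z x : ℂ) = inner ℂ (hatL2 Ω K z) v := by
    rw [L2.inner_def]
    refine integral_congr_ae ?_
    filter_upwards [h1] with x hx
    rw [hx]
    simp
  have e2 : ∫ x in Ω, (hat K z x : ℂ) = hatMass Ω K z := integral_complex_ofReal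
  rw [e1, e2, div_eq_inv_mul]
  rfl

/-- The span of the hat functions of the free nodes. -/
def hatSpan (Ω ΓD : Set (Pt d)) (K : Geometry.SimplicialComplex ℝ (Pt d)) :
    Submodule ℂ (L2 Ω) :=
  Submodule.span ℂ (hatL2 Ω K '' freeNodes K ΓD)

lemma finiteDimensional_hatSpan (hM : IsMesh Ω ΓD K) :
    FiniteDimensional ℂ (hatSpan Ω ΓD K) :=
  FiniteDimensional.span_of_finite ℂ ((finite_freeNodes hM).image _)

lemma interpL_mem_hatSpan (hM : IsMesh Ω ΓD K) (v : L2 Ω) :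
    interpL hM v ∈ hatSpan Ω ΓD K := by
  rw [interpL, sum_apply]
  refine Submodule.sum_mem _ fun z hz => Submodule.smul_mem _ _ (Submodule.subset_span ?_)
  exact ⟨z, (finite_freeNodes hM).mem_toFinset.1 hz, rfl⟩

/-- The operator is positive semidefinite: ⟨v, I v⟩ is the sum of |⟨φ_z, v⟩|² over the masses of
φ_z. If it vanishes, v is orthogonal to every φ_z, hence to its own span. A hat function of zero
mass, where Lean's inverse is 0, is itself zero in L². -/
lemma eq_zero_of_interpL_eq_zero (hΩ : IsLipschitzDomain Ω) (hM : IsMesh Ω ΓD K) {v : L2 Ω}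
    (hv : v ∈ hatSpan Ω ΓD K) (h : interpL hM v = 0) : v = 0 := by
  have h1 : inner ℂ v (interpL hM v) = ((∑ z ∈ (finite_freeNodes hM).toFinset,
      (hatMass Ω K z)⁻¹ * ‖inner ℂ (hatL2 Ω K z) v‖ ^ 2 : ℝ) : ℂ) := by
    rw [interpL, sum_apply, inner_sum, Complex.ofReal_sum]
    refine Finset.sum_congr rfl fun z _ => ?_
    simp only [ContinuousLinearMap.smulRight_apply, smul_apply,
      innerSL_apply_apply, inner_smul_right, smul_eq_mul]
    rw [mul_assoc, ← inner_conj_symm v, Complex.mul_conj']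
    push_cast
    rfl
  rw [h, inner_zero_right, eq_comm, Complex.ofReal_eq_zero, Finset.sum_eq_zero_iff_of_nonneg
    fun z _ => mul_nonneg (inv_nonneg.2 (hatMass_nonneg hΩ hM z)) (sq_nonneg _)] at h1
  have h2 : hatSpan Ω ΓD K ≤ LinearMap.ker (innerSL ℂ v : L2 Ω →ₗ[ℂ] ℂ) := by
    refine Submodule.span_le.2 ?_
    rintro _ ⟨z, hz, rfl⟩
    change inner ℂ v (hatL2 Ω K z) = 0
    rcases mul_eq_zero.1 (h1 z ((finite_freeNodes hM).mem_toFinset.2 hz)) with h3 | h3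
    · rw [hatL2_eq_zero_of_hatMass hΩ hM (inv_eq_zero.1 h3), inner_zero_right]
    · rw [inner_eq_zero_symm]
      simpa using h3
  exact inner_self_eq_zero.1 (h2 hv)

end Helmholtz

end

noncomputable section

namespace Helmholtz

variable {d : ℕ} {Ω ΓD : Set (Pt d)} {K : Geometry.SimplicialComplex ℝ (Pt d)}

/-! ### Summation over the elements -/

section Elements

lemma finite_elements (hM : IsMesh Ω ΓD K) : (elements K).Finite :=
  hM.finite.subset fun _ hT => hT.1

lemma finite_neighbours (hM : IsMesh Ω ΓD K) (T : Finset (Pt d)) : (neighbours K T).Finite :=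
  (finite_elements hM).subset fun _ hT => hT.1

lemma measurableSet_simplex (s : Finset (Pt d)) : MeasurableSet (simplex s) :=
  (isCompact_simplex s).isClosed.measurableSet

lemma domain_subset_iUnion_elements (hM : IsMesh Ω ΓD K) : Ω ⊆ ⋃ T ∈ elements K, simplex T := by
  intro x hx
  have hx' : x ∈ K.space := hM.space_eq ▸ subset_closure hx
  obtain ⟨s, hs, hxs⟩ := Geometry.SimplicialComplex.mem_space_iff.1 hx'
  obtain ⟨T, hT, hsT⟩ := hM.pure s hs
  exact mem_iUnion₂.2 ⟨T, hT, convexHull_mono (by exact_mod_cast hsT) hxs⟩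

lemma volume_simplex_eq_zero {s : Finset (Pt d)} (hs : s.card < d + 1) :
    volume (simplex s) = 0 := by
  rcases s.eq_empty_or_nonempty with rfl | hne
  · rw [simplex, Finset.coe_empty, convexHull_empty, measure_empty]
  have hlt : Module.finrank ℝ (vectorSpan ℝ (s : Set (Pt d))) < d := by
    have hpos := hne.card_pos
    have h1 := finrank_vectorSpan_image_finset_le ℝ (id : Pt d → Pt d) s (n := s.card - 1)
      (by omega)
    rw [Finset.image_id] at h1
    omega
  refine measure_mono_null (convexHull_subset_affineSpan _) (Measure.addHaar_affineSubspace _ _ ?_)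
  intro htop
  have h2 : vectorSpan ℝ (s : Set (Pt d)) = ⊤ := by
    rw [← direction_affineSpan, htop, AffineSubspace.direction_top]
  rw [h2, finrank_top, finrank_euclideanSpace_fin] at hlt
  exact lt_irrefl _ hlt

/-- Distinct elements meet in the simplex on their common vertices, of which there are at most d,
and such a simplex lies in a proper affine subspace. -/
lemma volume_inter_elements {T T' : Finset (Pt d)} (hT : T ∈ elements K) (hT' : T' ∈ elements K)
    (hne : T ≠ T') : volume (simplex T ∩ simplex T') = 0 := by
  classical
  refine measure_mono_null (K.inter_subset_convexHull hT.1 hT'.1) ?_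
  rw [← Finset.coe_inter]
  refine volume_simplex_eq_zero ?_
  refine (Finset.card_lt_card (Finset.inter_subset_left.ssubset_of_ne fun h => hne ?_)).trans_eq hT.2
  exact Finset.eq_of_subset_of_card_le (Finset.inter_eq_left.1 h) (by rw [hT.2, hT'.2])

/-- The measure with density `‖f‖²` on `Ω`. -/
def energyMeasure {F : Type*} [NormedAddCommGroup F]
    (f : Lp F 2 ((volume : Measure (Pt d)).restrict Ω)) : Measure (Pt d) :=
  (volume.restrict Ω).withDensity fun x => ENNReal.ofReal (‖f x‖ ^ 2)

variable {F : Type*} [NormedAddCommGroup F] (f : Lp F 2 ((volume : Measure (Pt d)).restrict Ω))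

lemma integrable_norm_sq : Integrable (fun x => ‖f x‖ ^ 2) (volume.restrict Ω) :=
  (memLp_two_iff_integrable_sq_norm (Lp.aestronglyMeasurable f)).1 (Lp.memLp f)

instance isFiniteMeasure_energyMeasure : IsFiniteMeasure (energyMeasure f) :=
  isFiniteMeasure_withDensity_ofReal (integrable_norm_sq f).2

lemma energyMeasure_real {S : Set (Pt d)} (hS : MeasurableSet S) :
    (energyMeasure f).real S = ∫ x in S ∩ Ω, ‖f x‖ ^ 2 := by
  rw [Measure.real, energyMeasure, withDensity_apply _ hS, Measure.restrict_restrict hS,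
    ← ofReal_integral_eq_lintegral_ofReal, ENNReal.toReal_ofReal]
  · positivity
  · have := (integrable_norm_sq f).restrict (s := S)
    rwa [Measure.restrict_restrict hS] at this
  · exact Eventually.of_forall fun x => by positivity

lemma normOn_sq {S : Set (Pt d)} (hS : MeasurableSet S) :
    normOn S f ^ 2 = (energyMeasure f).real S := by
  rw [energyMeasure_real f hS, normOn, Real.sq_sqrt (by positivity)]

lemma normOn_nonneg (S : Set (Pt d)) : 0 ≤ normOn S f := Real.sqrt_nonneg _

lemma norm_sq_Lp {F : Type*} [NormedAddCommGroup F] [InnerProductSpace ℂ F]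
    (f : Lp F 2 ((volume : Measure (Pt d)).restrict Ω)) :
    ‖f‖ ^ 2 = (energyMeasure f).real univ := by
  have h := ofReal_norm_sq_Lp f
  rw [Measure.real, energyMeasure, withDensity_apply _ MeasurableSet.univ, Measure.restrict_univ,
    ← h, ENNReal.toReal_ofReal (by positivity)]

lemma energyMeasure_compl_domain (hΩ : IsOpen Ω) : energyMeasure f Ωᶜ = 0 := by
  rw [energyMeasure, withDensity_apply _ hΩ.measurableSet.compl,
    Measure.restrict_restrict hΩ.measurableSet.compl]
  simp

lemma energyMeasure_univ_le (hΩ : IsOpen Ω) (hM : IsMesh Ω ΓD K) :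
    (energyMeasure f).real univ ≤
      ∑ T ∈ (finite_elements hM).toFinset, (energyMeasure f).real (simplex T) := by
  have h1 : (energyMeasure f).real univ ≤ (energyMeasure f).real
      (⋃ T ∈ (finite_elements hM).toFinset, simplex T) := by
    refine ENNReal.toReal_mono (measure_ne_top _ _) ?_
    calc energyMeasure f univ ≤ energyMeasure f Ω + energyMeasure f Ωᶜ := by
          rw [← union_compl_self Ω]; exact measure_union_le _ _
      _ ≤ _ := by
          rw [energyMeasure_compl_domain f hΩ, add_zero]
          refine measure_mono ?_
          simpa using domain_subset_iUnion_elements hM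
  exact h1.trans (measureReal_biUnion_finset_le _ _)

lemma sum_energyMeasure_le (hM : IsMesh Ω ΓD K) :
    ∑ T ∈ (finite_elements hM).toFinset, (energyMeasure f).real (simplex T) ≤
      (energyMeasure f).real univ := by
  rw [← measureReal_biUnion_finset₀]
  · exact measureReal_mono (subset_univ _)
  · intro T hT T' hT' hne
    have h1 := volume_inter_elements (K := K) (by simpa using hT) (by simpa using hT') hne
    exact ((withDensity_absolutelyContinuous _ _).trans
      Measure.restrict_le_self.absolutelyContinuous) h1
  · exact fun T _ => (measurableSet_simplex T).nullMeasurableSet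

lemma ncard_neighbours_le (hM : IsMesh Ω ΓD K) {T : Finset (Pt d)} (hT : T ∈ elements K) :
    (neighbours K T).ncard ≤ overlap K :=
  le_csSup ((finite_elements hM).image _).bddAbove (mem_image_of_mem _ hT)

lemma diam_le_meshSize (hM : IsMesh Ω ΓD K) {T : Finset (Pt d)} (hT : T ∈ elements K) :
    Metric.diam (simplex T) ≤ meshSize K :=
  le_csSup ((finite_elements hM).image _).bddAbove (mem_image_of_mem _ hT)

lemma diam_element_pos (hd : 1 ≤ d) {T : Finset (Pt d)} (hT : T ∈ elements K) :
    0 < Metric.diam (simplex T) := by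
  obtain ⟨x, hx, y, hy, hxy⟩ := Finset.one_lt_card.1 (show 1 < T.card by rw [hT.2]; omega)
  refine (dist_pos.2 hxy).trans_le (Metric.dist_le_diam_of_mem (isCompact_simplex T).isBounded ?_ ?_)
  · exact subset_convexHull ℝ _ hx
  · exact subset_convexHull ℝ _ hy

/-- Double counting: meeting is a symmetric relation, so each element lies in at most `overlap K`
patches. -/
lemma sum_energyMeasure_patch_le (hM : IsMesh Ω ΓD K) :
    ∑ T ∈ (finite_elements hM).toFinset, (energyMeasure f).real (patch K T) ≤
      overlap K * (energyMeasure f).real univ := by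
  classical
  set E := (finite_elements hM).toFinset
  have hnb (T) : neighbours K T = (E.filter fun T' => (simplex T' ∩ simplex T).Nonempty :
      Set (Finset (Pt d))) := by
    ext T'; simp [neighbours, E]
  calc ∑ T ∈ E, (energyMeasure f).real (patch K T)
      ≤ ∑ T ∈ E, ∑ T' ∈ E.filter (fun T' => (simplex T' ∩ simplex T).Nonempty),
          (energyMeasure f).real (simplex T') := by
        refine Finset.sum_le_sum fun T _ => ?_
        refine le_trans (le_of_eq ?_) (measureReal_biUnion_finset_le _ _)
        congr 1
        rw [patch, hnb]
        simp
    _ = ∑ T' ∈ E, ∑ T ∈ E.filter (fun T => (simplex T' ∩ simplex T).Nonempty),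
          (energyMeasure f).real (simplex T') := by
        refine Finset.sum_comm' fun T T' => ?_
        simp only [Finset.mem_filter]
        tauto
    _ ≤ ∑ T' ∈ E, overlap K * (energyMeasure f).real (simplex T') := by
        refine Finset.sum_le_sum fun T' hT' => ?_
        rw [Finset.sum_const, nsmul_eq_mul]
        refine mul_le_mul_of_nonneg_right ?_ measureReal_nonneg
        have h1 := ncard_neighbours_le hM ((finite_elements hM).mem_toFinset.1 hT')
        rw [hnb, ncard_coe_finset] at h1
        simp_rw [inter_comm (simplex T')]
        exact_mod_cast h1
    _ ≤ _ := by
        rw [← Finset.mul_sum]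
        gcongr
        exact sum_energyMeasure_le f hM

lemma measurableSet_patch (hM : IsMesh Ω ΓD K) (T : Finset (Pt d)) :
    MeasurableSet (patch K T) :=
  (finite_neighbours hM T).measurableSet_biUnion fun _ _ => measurableSet_simplex _

end Elements

/-- Functions in the kernel of the interpolation operator are small compared with their gradient
if the resolution condition holds. -/
lemma norm_sq_le_of_mem_W (hd : 1 ≤ d) (hΩ : IsLipschitzDomain Ω) (hM : IsMesh Ω ΓD K)
    {κ CI : ℝ} (hκ : 0 < κ) (hCI : IsInterpConst Ω ΓD K CI)
    (hres : meshSize K * κ ≤ 1 / (√(2 * (overlap K : ℝ)) * CI)) {w : L2 Ω}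
    (hw : w ∈ W Ω ΓD K) : κ ^ 2 * ‖w‖ ^ 2 ≤ 1 / 2 * ‖weakGrad w‖ ^ 2 := by
  obtain ⟨x, hx⟩ := hΩ.isConnected.nonempty
  obtain ⟨T₀, hT₀, -⟩ := mem_iUnion₂.1 (domain_subset_iUnion_elements hM hx)
  have hH : 0 < meshSize K := (diam_element_pos hd hT₀).trans_le (diam_le_meshSize hM hT₀)
  -- The left side of the resolution condition is positive, so the right side is too. Hence the
  -- denominator is not 0 and CI > 0, neither of which is assumed.
  have hq : 0 < √(2 * (overlap K : ℝ)) * CI := by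
    by_contra! hle
    have h1 : 1 / (√(2 * (overlap K : ℝ)) * CI) ≤ 0 := div_nonpos_of_nonneg_of_nonpos zero_le_one hle
    exact absurd (hres.trans h1) (not_le.2 (mul_pos hH hκ))
  have hCI0 : 0 < CI := pos_of_mul_pos_right hq (Real.sqrt_nonneg _)
  have hbound : (meshSize K * κ * CI) ^ 2 * overlap K ≤ 1 / 2 := by
    rw [le_div_iff₀ hq] at hres
    have h2 : (meshSize K * κ * (√(2 * (overlap K : ℝ)) * CI)) ^ 2 ≤ 1 := by
      have : 0 ≤ meshSize K * κ * (√(2 * (overlap K : ℝ)) * CI) := by positivity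
      nlinarith
    have h3 : √(2 * (overlap K : ℝ)) ^ 2 = 2 * overlap K := Real.sq_sqrt (by positivity)
    have h4 : (meshSize K * κ * (√(2 * (overlap K : ℝ)) * CI)) ^ 2 =
        (meshSize K * κ * CI) ^ 2 * √(2 * (overlap K : ℝ)) ^ 2 := by ring
    rw [h4, h3] at h2
    linarith
  have hloc (T) (hT : T ∈ elements K) : (energyMeasure w).real (simplex T) ≤
      (meshSize K * CI) ^ 2 * (energyMeasure (weakGrad w)).real (patch K T) := by
    have h1 := hCI w hw.1 T hT
    rw [hw.2, sub_zero] at h1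
    have hdT := diam_element_pos hd hT
    have h2 : (Metric.diam (simplex T))⁻¹ * normOn (simplex T) w ≤
        CI * normOn (patch K T) (weakGrad w) := by
      linarith [normOn_nonneg (weakGrad w) (simplex T)]
    rw [inv_mul_le_iff₀ hdT] at h2
    have h3 : normOn (simplex T) w ≤ meshSize K * CI * normOn (patch K T) (weakGrad w) := by
      refine h2.trans ?_
      rw [mul_assoc]
      refine mul_le_mul_of_nonneg_right (diam_le_meshSize hM hT) ?_
      exact mul_nonneg hCI0.le (normOn_nonneg _ _)
    rw [← normOn_sq w (measurableSet_simplex T), ← normOn_sq _ (measurableSet_patch hM T),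
      ← mul_pow]
    exact pow_le_pow_left₀ (normOn_nonneg _ _) h3 2
  have hsum : ‖w‖ ^ 2 ≤ (meshSize K * CI) ^ 2 * (overlap K * ‖weakGrad w‖ ^ 2) := by
    rw [norm_sq_Lp w, norm_sq_Lp (weakGrad w)]
    calc _ ≤ _ := energyMeasure_univ_le w hΩ.isOpen hM
      _ ≤ ∑ T ∈ (finite_elements hM).toFinset,
          (meshSize K * CI) ^ 2 * (energyMeasure (weakGrad w)).real (patch K T) :=
        Finset.sum_le_sum fun T hT => hloc T ((finite_elements hM).mem_toFinset.1 hT)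
      _ ≤ _ := by
        rw [← Finset.mul_sum]
        gcongr
        exact sum_energyMeasure_patch_le _ hM
  calc κ ^ 2 * ‖w‖ ^ 2 ≤ κ ^ 2 * ((meshSize K * CI) ^ 2 * (overlap K * ‖weakGrad w‖ ^ 2)) := by
        gcongr
    _ = (meshSize K * κ * CI) ^ 2 * overlap K * ‖weakGrad w‖ ^ 2 := by ring
    _ ≤ _ := by gcongr

end Helmholtz

end

noncomputable section

namespace Helmholtz

/-! ### Sesquilinear forms that are coercive on a subspace -/

section Abstract

variable {E : Type*} [NormedAddCommGroup E] [InnerProductSpace ℂ E]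

/-- The complex Lax–Milgram theorem. -/
lemma existsUnique_of_coercive [CompleteSpace E] (B : E →ₗ⋆[ℂ] E →ₗ[ℂ] ℂ) {C α : ℝ}
    (hB : ∀ u v, ‖B u v‖ ≤ C * ‖u‖ * ‖v‖) (hα : 0 < α) (hco : ∀ u, α * ‖u‖ ^ 2 ≤ ‖B u u‖)
    (ℓ : E →L[ℂ] ℂ) : ∃! c, ∀ w, B c w = ℓ w := by
  let A := InnerProductSpace.continuousLinearMapOfBilin (𝕜 := ℂ) (B.mkContinuous₂ C hB)
  have hA (u v : E) : inner ℂ (A u) v = B u v :=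
    InnerProductSpace.continuousLinearMapOfBilin_apply _ _ _
  have hlow (u : E) : α * ‖u‖ ≤ ‖A u‖ := by
    rcases eq_or_ne u 0 with rfl | hu
    · simp
    · have h1 : α * ‖u‖ ^ 2 ≤ ‖A u‖ * ‖u‖ :=
        ((hco u).trans_eq (by rw [hA])).trans (norm_inner_le_norm (𝕜 := ℂ) (A u) u)
      have h2 : 0 < ‖u‖ := norm_pos_iff.2 hu
      nlinarith
  have hanti : AntilipschitzWith (α⁻¹).toNNReal A := by
    refine AddMonoidHomClass.antilipschitz_of_bound A fun u => ?_
    rw [Real.coe_toNNReal _ (by positivity), ← div_eq_inv_mul, le_div_iff₀ hα, mul_comm]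
    exact hlow u
  have hcl : IsClosed (A.range : Set E) := hanti.isClosed_range A.uniformContinuous
  -- The closed range is everything: a vector w orthogonal to it has B w w = 0, hence w = 0 by
  -- coercivity.
  have htop : A.range = ⊤ := by
    have := hcl.completeSpace_coe
    rw [← A.range.orthogonal_orthogonal, Submodule.eq_top_iff']
    intro v w hw
    have h0 : B w w = 0 := by rw [← hA]; exact hw _ ⟨w, rfl⟩
    have h1 := hco w
    rw [h0, norm_zero] at h1
    have h2 : ‖w‖ ^ 2 ≤ 0 := nonpos_of_mul_nonpos_right h1 hα
    have h3 : w = 0 := by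
      rw [← norm_eq_zero]
      exact pow_eq_zero_iff two_ne_zero |>.1 (le_antisymm h2 (sq_nonneg _))
    rw [h3, inner_zero_left]
  obtain ⟨c, hc⟩ := LinearMap.range_eq_top.1 htop ((InnerProductSpace.toDual ℂ E).symm ℓ)
  have hc' : A c = (InnerProductSpace.toDual ℂ E).symm ℓ := hc
  refine ⟨c, fun w => ?_, fun c' hc'' => hanti.injective ?_⟩
  · rw [← hA, hc', InnerProductSpace.toDual_symm_apply]
  · refine ext_inner_right ℂ fun w => ?_
    rw [hA, hc'' w, hc', InnerProductSpace.toDual_symm_apply]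

variable {W : Submodule ℂ E}

lemma existsUnique_mem_of_coercive [CompleteSpace E] (hW : IsClosed (W : Set E))
    (B : E →ₗ⋆[ℂ] E →ₗ[ℂ] ℂ) {C α : ℝ} (hB : ∀ u v, ‖B u v‖ ≤ C * ‖u‖ * ‖v‖) (hα : 0 < α)
    (hco : ∀ u ∈ W, α * ‖u‖ ^ 2 ≤ ‖B u u‖) (ℓ : E →L[ℂ] ℂ) :
    ∃! c, c ∈ W ∧ ∀ w ∈ W, B c w = ℓ w := by
  have := hW.completeSpace_coe
  obtain ⟨c, hc, huniq⟩ := existsUnique_of_coercive (E := W)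
    (B.domRestrict₁₂ W W) (fun u v => hB u v) hα (fun u => hco u u.2) (ℓ.comp W.subtypeL)
  refine ⟨c, ⟨c.2, fun w hw => hc ⟨w, hw⟩⟩, fun c' ⟨h1, h2⟩ => ?_⟩
  exact congrArg Subtype.val (huniq ⟨c', h1⟩ fun w => h2 w w.2)

variable (a : E →ₗ[ℂ] E →ₗ⋆[ℂ] ℂ)

/-- The sesquilinear form `(u, v) ↦ conj (a u v)`. -/
def conjForm : E →ₗ⋆[ℂ] E →ₗ[ℂ] ℂ :=
  LinearMap.mk₂'ₛₗ (starRingEnd ℂ) (RingHom.id ℂ) (fun u v => starRingEnd ℂ (a u v))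
    (fun u u' v => by simp) (fun c u v => by simp) (fun u v v' => by simp) (fun c u v => by simp)

lemma conjForm_apply (u v : E) : conjForm a u v = starRingEnd ℂ (a u v) := rfl

variable {a} {Ca : ℝ}

/-- The functional `conj (a u ·)`. -/
def conjFormL (hb : ∀ u v, ‖a u v‖ ≤ Ca * ‖u‖ * ‖v‖) (u : E) : E →L[ℂ] ℂ :=
  (conjForm a u).mkContinuous (Ca * ‖u‖) fun v => by
    rw [conjForm_apply, RCLike.norm_conj]; exact hb u v

/-- The functional `a · v`. -/
def flipFormL (hb : ∀ u v, ‖a u v‖ ≤ Ca * ‖u‖ * ‖v‖) (v : E) : E →L[ℂ] ℂ :=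
  (a.flip v).mkContinuous (Ca * ‖v‖) fun u => by
    rw [LinearMap.flip_apply]; exact (hb u v).trans_eq (by ring)

lemma conjForm_eq_iff {z w : ℂ} : starRingEnd ℂ z = starRingEnd ℂ w ↔ z = w :=
  (starRingEnd ℂ).injective.eq_iff

section Solve

variable [CompleteSpace E]

lemma existsUnique_functional (hW : IsClosed (W : Set E))
    (hb : ∀ u v, ‖a u v‖ ≤ Ca * ‖u‖ * ‖v‖) (hco : ∀ w ∈ W, ‖w‖ ^ 2 ≤ 3 * (a w w).re)
    (ℓ : E →L[ℂ] ℂ) : ∃! c, c ∈ W ∧ ∀ w ∈ W, conjForm a c w = ℓ w := by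
  refine existsUnique_mem_of_coercive hW (conjForm a) (C := Ca) (α := 1 / 3)
    (fun u v => ?_) (by norm_num) (fun w hw => ?_) ℓ
  · rw [conjForm_apply, RCLike.norm_conj]; exact hb u v
  · rw [conjForm_apply, RCLike.norm_conj]
    linarith [hco w hw, Complex.re_le_norm (a w w)]

lemma existsUnique_corrector (hW : IsClosed (W : Set E))
    (hb : ∀ u v, ‖a u v‖ ≤ Ca * ‖u‖ * ‖v‖) (hco : ∀ w ∈ W, ‖w‖ ^ 2 ≤ 3 * (a w w).re) (v : E) :
    ∃! c, c ∈ W ∧ ∀ w ∈ W, a c w = a v w := by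
  have h := existsUnique_functional hW hb hco (conjFormL hb v)
  simpa only [conjFormL, LinearMap.mkContinuous_apply, conjForm_apply, conjForm_eq_iff] using h

lemma existsUnique_adjointCorrector (hW : IsClosed (W : Set E))
    (hb : ∀ u v, ‖a u v‖ ≤ Ca * ‖u‖ * ‖v‖) (hco : ∀ w ∈ W, ‖w‖ ^ 2 ≤ 3 * (a w w).re) (v : E) :
    ∃! c, c ∈ W ∧ ∀ w ∈ W, a w c = a w v := by
  refine existsUnique_mem_of_coercive hW a.flip (C := Ca) (α := 1 / 3)
    (fun u v => ?_) (by norm_num) (fun w hw => ?_) (flipFormL hb v)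
  · rw [LinearMap.flip_apply]; exact (hb v u).trans_eq (by ring)
  · rw [LinearMap.flip_apply]
    linarith [hco w hw, Complex.re_le_norm (a w w)]

/-- If the form is injective and coercive on a closed subspace of finite codimension, every
bounded functional is represented. -/
lemma exists_solution (hW : IsClosed (W : Set E))
    (hb : ∀ u v, ‖a u v‖ ≤ Ca * ‖u‖ * ‖v‖) (hco : ∀ w ∈ W, ‖w‖ ^ 2 ≤ 3 * (a w w).re)
    {S : Submodule ℂ E} [FiniteDimensional ℂ S] (hSW : ∀ x, ∃ s ∈ S, x - s ∈ W)
    (hdisj : ∀ x ∈ S, x ∈ W → x = 0) (hinj : ∀ u, (∀ v, a u v = 0) → u = 0) (ℓ : E →L[ℂ] ℂ) :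
    ∃ ζ, ∀ v, conjForm a ζ v = ℓ v := by
  choose c hc huniq using existsUnique_corrector hW hb hco
  let cor : E →ₗ[ℂ] E :=
    { toFun := c
      map_add' := fun u v => (huniq _ _ ⟨W.add_mem (hc u).1 (hc v).1, fun w hw => by
        simp [(hc u).2 w hw, (hc v).2 w hw]⟩).symm
      map_smul' := fun k u => (huniq _ _ ⟨W.smul_mem k (hc u).1, fun w hw => by
        simp [(hc u).2 w hw]⟩).symm }
  let b := Module.finBasis ℂ S
  have extS {u : E} (h : ∀ i, a u (b i) = 0) (s : E) (hs : s ∈ S) : a u s = 0 := by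
    have hle : (⊤ : Submodule ℂ S) ≤ LinearMap.ker ((a u).domRestrict S) := by
      rw [← b.span_eq, Submodule.span_le]
      rintro _ ⟨i, rfl⟩
      exact h i
    exact hle (show (⟨s, hs⟩ : S) ∈ ⊤ from trivial)
  have extE {u : E} (hS : ∀ i, a u (b i) = 0) (hW' : ∀ w ∈ W, a u w = 0) (v : E) :
      a u v = 0 := by
    obtain ⟨s, hs, hsW⟩ := hSW v
    rw [← add_sub_cancel s v, map_add, extS hS s hs, hW' _ hsW, add_zero]
  have hcorW (v w : E) (hw : w ∈ W) : a (v - cor v) w = 0 := by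
    rw [map_sub, LinearMap.sub_apply, sub_eq_zero]
    exact ((hc v).2 w hw).symm
  -- After removal of its corrector, an element of S is invisible to W, so only its pairing with a
  -- basis of S is left: a square system. If Φ s = 0 then s - cor s annihilates everything, so s =
  -- cor s by injectivity of the form; then s lies in both S and W and is 0.
  let Φ : S →ₗ[ℂ] (Fin (Module.finrank ℂ S) → ℂ) :=
    LinearMap.pi fun i => (a.flip (b i)).comp ((LinearMap.id - cor).comp S.subtype)
  have hΦ (s : S) (i) : Φ s i = a ((s : E) - cor s) (b i) := rfl
  have hΦinj : Function.Injective Φ := by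
    rw [injective_iff_map_eq_zero]
    intro s hs
    have h0 : (s : E) - cor s = 0 := hinj _ fun v =>
      extE (fun i => by rw [← hΦ, hs]; rfl) (fun w hw => hcorW s w hw) v
    have h1 : (s : E) ∈ W := by rw [sub_eq_zero.1 h0]; exact (hc s).1
    exact Subtype.ext (hdisj s s.2 h1)
  have hΦsurj : Function.Surjective Φ :=
    (LinearMap.injective_iff_surjective_of_finrank_eq_finrank (by simp)).1 hΦinj
  -- First w₀ solves the problem against W. Then s - cor s repairs the values on S and does not
  -- disturb those on W.
  obtain ⟨w₀, ⟨-, hw₀⟩, -⟩ := existsUnique_functional hW hb hco ℓ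
  obtain ⟨s, hs⟩ := hΦsurj fun i => starRingEnd ℂ (ℓ (b i)) - a w₀ (b i)
  refine ⟨w₀ + (s - cor s), fun v => ?_⟩
  have hcS (i) : conjForm a (w₀ + (s - cor s)) (b i) = ℓ (b i) := by
    have h1 := congrFun hs i
    rw [hΦ] at h1
    rw [conjForm_apply, map_add, LinearMap.add_apply, h1]
    simp
  have hcW (w : E) (hw : w ∈ W) : conjForm a (w₀ + (s - cor s)) w = ℓ w := by
    rw [← hw₀ w hw, conjForm_apply, conjForm_apply, map_add, LinearMap.add_apply, hcorW _ _ hw,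
      add_zero]
  have hle : (⊤ : Submodule ℂ S) ≤
      LinearMap.ker ((conjForm a (w₀ + (s - cor s)) - (ℓ : E →ₗ[ℂ] ℂ)).domRestrict S) := by
    rw [← b.span_eq, Submodule.span_le]
    rintro _ ⟨i, rfl⟩
    exact sub_eq_zero.2 (hcS i)
  obtain ⟨t, ht, htW⟩ := hSW v
  have h2 : conjForm a (w₀ + (s - cor s)) t = ℓ t :=
    sub_eq_zero.1 (hle (show (⟨t, ht⟩ : S) ∈ ⊤ from trivial))
  rw [← add_sub_cancel t v, map_add ℓ, LinearMap.map_add (conjForm a _), h2, hcW _ htW]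

end Solve

/-- The norm of the complementary projection is bounded like the norm of the projection. -/
lemma norm_le_of_adjoint_orthogonal (hb : ∀ u v, ‖a u v‖ ≤ Ca * ‖u‖ * ‖v‖)
    (hco : ∀ w ∈ W, ‖w‖ ^ 2 ≤ 3 * (a w w).re) (hCa : 1 ≤ 3 * Ca) {p q : E} (hp : p ∈ W)
    (hq : ∀ w ∈ W, a w q = 0) : ‖q‖ ≤ 3 * Ca * ‖p + q‖ := by
  -- p is the adjoint projection of p + q onto W, bounded by coercivity and continuity. The bound
  -- holds for all such pairs, so it may be used for rescaled ones.
  have proj {p q : E} (hp : p ∈ W) (hq : ∀ w ∈ W, a w q = 0) : ‖p‖ ≤ 3 * Ca * ‖p + q‖ := by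
    rcases eq_or_ne p 0 with rfl | h0
    · rw [norm_zero]; positivity
    · have h1 : a p p = a p (p + q) := by rw [map_add, hq p hp, add_zero]
      have h2 := hco p hp
      rw [h1] at h2
      have h3 := (Complex.re_le_norm _).trans (hb p (p + q))
      have h4 : 0 < ‖p‖ := norm_pos_iff.2 h0
      nlinarith
  rcases eq_or_ne p 0 with rfl | hp0
  · rw [zero_add]
    nlinarith [norm_nonneg q]
  rcases eq_or_ne q 0 with rfl | hq0
  · rw [norm_zero]; positivity
  have hp' : ‖p‖ ≠ 0 := norm_ne_zero_iff.2 hp0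
  have hq' : ‖q‖ ≠ 0 := norm_ne_zero_iff.2 hq0
  -- Rescaling by α and β swaps the norms of p and q, and αβ = 1 preserves their inner product, so
  -- the norm of the sum is unchanged. The bound for the rescaled p is then the bound for q. The
  -- case p = 0 above is where 1 ≤ 3 Ca is needed.
  set α : ℝ := ‖q‖ / ‖p‖
  set β : ℝ := ‖p‖ / ‖q‖
  have h1 := proj (p := (α : ℂ) • p) (q := (β : ℂ) • q) (W.smul_mem _ hp)
    (fun w hw => by rw [map_smulₛₗ, hq w hw, smul_zero])
  have h2 : ‖(α : ℂ) • p‖ = ‖q‖ := by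
    rw [norm_smul, Complex.norm_real, Real.norm_of_nonneg (by positivity)]
    exact div_mul_cancel₀ _ hp'
  have h3 : ‖(β : ℂ) • q‖ = ‖p‖ := by
    rw [norm_smul, Complex.norm_real, Real.norm_of_nonneg (by positivity)]
    exact div_mul_cancel₀ _ hq'
  have h4 : inner ℂ ((α : ℂ) • p) ((β : ℂ) • q) = inner ℂ p q := by
    rw [inner_smul_left, inner_smul_right, Complex.conj_ofReal, ← mul_assoc, ← Complex.ofReal_mul]
    have : α * β = 1 := by simp only [α, β]; field_simp
    rw [this, Complex.ofReal_one, one_mul]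
  have h5 : ‖(α : ℂ) • p + (β : ℂ) • q‖ = ‖p + q‖ := by
    have e1 := norm_add_sq (𝕜 := ℂ) ((α : ℂ) • p) ((β : ℂ) • q)
    have e2 := norm_add_sq (𝕜 := ℂ) p q
    rw [h2, h3, h4] at e1
    exact (sq_eq_sq₀ (norm_nonneg _) (norm_nonneg _)).1 (by rw [e1, e2]; ring)
  rwa [h2, h5] at h1

/-- The inf-sup bound for one trial function: `t` is the weighted `L²`-norm of `u` and `z` the
solution of the adjoint problem with right-hand side `u`. -/
lemma exists_test_function [CompleteSpace E] (hb : ∀ u v, ‖a u v‖ ≤ Ca * ‖u‖ * ‖v‖)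
    (hco : ∀ w ∈ W, ‖w‖ ^ 2 ≤ 3 * (a w w).re) (hCa : 1 ≤ 3 * Ca) (hW : IsClosed (W : Set E))
    {S : Submodule ℂ E} (hSW : ∀ x, ∃ s ∈ S, x - s ∈ W) {u z : E} {t s : ℝ} (hu : u ≠ 0)
    (huW : ∀ w ∈ W, a u w = 0) (huu : (a u u).re = ‖u‖ ^ 2 - 2 * t ^ 2)
    (huz : (a u z).re = t ^ 2) (hz : ‖z‖ ≤ s * t) (ht : 0 ≤ t) (hs : 1 ≤ s) :
    ∃ p ∈ S, ∃ c ∈ W, (∀ w ∈ W, a w c = a w p) ∧ p - c ≠ 0 ∧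
      1 / (2 * (3 * Ca) * s) ≤ (a u (p - c)).re / (‖u‖ * ‖p - c‖) := by
  have hu0 : 0 < ‖u‖ := norm_pos_iff.2 hu
  -- For ‖u‖ ≤ 2t the adjoint solution works: ‖u‖‖z‖ ≤ 2t · st. Otherwise 2t² ≤ ‖u‖²/2, so Re a(u,u)
  -- ≥ ‖u‖²/2 and u itself works because s ≥ 1. Choosing one of the two, rather than a combination,
  -- gives the factor 2s.
  obtain ⟨ψ, hψ0, hψ⟩ : ∃ ψ, 0 < (a u ψ).re ∧ ‖u‖ * ‖ψ‖ ≤ 2 * s * (a u ψ).re := by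
    rcases le_total (‖u‖) (2 * t) with h | h
    · refine ⟨z, by rw [huz]; nlinarith, ?_⟩
      rw [huz]
      calc ‖u‖ * ‖z‖ ≤ 2 * t * (s * t) := by gcongr
        _ = _ := by ring
    · refine ⟨u, by rw [huu]; nlinarith, ?_⟩
      rw [huu]
      have h4 : (2 * t) ^ 2 ≤ ‖u‖ ^ 2 := pow_le_pow_left₀ (by positivity) h 2
      nlinarith [mul_nonneg (sub_nonneg.2 hs)
        (show 0 ≤ ‖u‖ ^ 2 - 2 * t ^ 2 by nlinarith [sq_nonneg ‖u‖])]
  obtain ⟨c', ⟨hc'W, hc'⟩, -⟩ := existsUnique_adjointCorrector hW hb hco ψ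
  obtain ⟨p, hp, hpW⟩ := hSW ψ
  have horth (w : E) (hw : w ∈ W) : a w (ψ - c') = 0 := by rw [map_sub, hc' w hw, sub_self]
  -- ψ and its part p in S differ by an element of W, which is its own corrector. So ψ - c' is also
  -- the corrected version of p.
  have e1 : p - (c' - (ψ - p)) = ψ - c' := by abel
  have e2 : a u (ψ - c') = a u ψ := by rw [map_sub, huW c' hc'W, sub_zero]
  refine ⟨p, hp, c' - (ψ - p), W.sub_mem hc'W hpW, fun w hw => ?_, ?_, ?_⟩
  · rw [map_sub, hc' w hw, map_sub]; abel
  · rw [e1]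
    rintro h0
    rw [h0, map_zero] at e2
    rw [← e2] at hψ0
    simp at hψ0
  · have hq := norm_le_of_adjoint_orthogonal hb hco hCa hc'W horth
    rw [add_sub_cancel] at hq
    have hq0 : 0 < ‖ψ - c'‖ := by
      rw [norm_pos_iff]
      rintro h0
      rw [h0, map_zero] at e2
      rw [← e2] at hψ0
      simp at hψ0
    rw [e1, e2, div_le_div_iff₀ (by positivity) (by positivity), one_mul]
    calc ‖u‖ * ‖ψ - c'‖ ≤ ‖u‖ * (3 * Ca * ‖ψ‖) := by gcongr
      _ = 3 * Ca * (‖u‖ * ‖ψ‖) := by ring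
      _ ≤ 3 * Ca * (2 * s * (a u ψ).re) := by gcongr
      _ = _ := by ring

end Abstract

end Helmholtz

end

noncomputable section

namespace Helmholtz

variable {d : ℕ} {Ω ΓD ΓR : Set (Pt d)}

/-! ### Test functions and lower bounds for the constants -/

lemma memLp_compactSupport {E : Type*} [NormedAddCommGroup E] {φ : Pt d → E}
    (hφ : Continuous φ) (hs : HasCompactSupport φ) :
    MemLp φ 2 ((volume : Measure (Pt d)).restrict Ω) :=
  (hφ.memLp_of_hasCompactSupport hs).restrict _

lemma hasCompactSupport_classicalGrad {φ : Pt d → ℂ} (hs : HasCompactSupport φ) :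
    HasCompactSupport (classicalGrad φ) :=
  (hs.fderiv (𝕜 := ℝ)).comp_left
    (g := fun L : Pt d →L[ℝ] ℂ => WithLp.toLp 2 fun i => L (EuclideanSpace.single i 1)) rfl

section TestFunction

variable {φ : Pt d → ℂ} (hφ : ContDiff ℝ ∞ φ) (hs : HasCompactSupport φ)

/-- A test function as an element of `L²(Ω)`. -/
def testL2 (Ω : Set (Pt d)) (hφ : ContDiff ℝ ∞ φ) (hs : HasCompactSupport φ) : L2 Ω :=
  (memLp_compactSupport hφ.continuous hs).toLp φ

/-- The gradient of a test function as an element of `L²(Ω)^d`. -/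
def testGrad (Ω : Set (Pt d)) (hφ : ContDiff ℝ ∞ φ) (hs : HasCompactSupport φ) : L2Vec Ω :=
  (memLp_compactSupport (continuous_classicalGrad hφ)
    (hasCompactSupport_classicalGrad hs)).toLp (classicalGrad φ)

lemma coeFn_testL2 : testL2 Ω hφ hs =ᵐ[volume.restrict Ω] φ := MemLp.coeFn_toLp _

lemma coeFn_testGrad : testGrad Ω hφ hs =ᵐ[volume.restrict Ω] classicalGrad φ :=
  MemLp.coeFn_toLp _

lemma testL2_mem_sobolevGraph (hΩ : IsOpen Ω) (hsub : tsupport φ ⊆ Ω) :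
    (testL2 Ω hφ hs, testGrad Ω hφ hs, (0 : L2Bdry Ω)) ∈ sobolevGraph Ω := by
  refine subset_closure ⟨φ, hφ, coeFn_testL2 hφ hs, coeFn_testGrad hφ hs, ?_⟩
  filter_upwards [Lp.coeFn_zero ℂ 2 (surfaceMeasure Ω),
    ae_restrict_mem isClosed_frontier.measurableSet] with x hx hxf
  rw [hx, image_eq_zero_of_notMem_tsupport fun h => hΩ.inter_frontier_eq.subset ⟨hsub h, hxf⟩]
  rfl

lemma testL2_mem_V (hΩ : IsOpen Ω) (hsub : tsupport φ ⊆ Ω) : testL2 Ω hφ hs ∈ V Ω ΓD := by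
  refine (mem_V_iff hΩ).2 ⟨_, _, testL2_mem_sobolevGraph hφ hs hΩ hsub, ?_⟩
  filter_upwards [Lp.coeFn_zero ℂ 2 (surfaceMeasure Ω)] with x hx _
  rw [hx]; rfl

lemma weakGrad_testL2 (hΩ : IsOpen Ω) (hsub : tsupport φ ⊆ Ω) :
    weakGrad (testL2 Ω hφ hs) = testGrad Ω hφ hs :=
  weakGrad_eq_of_mem hΩ (testL2_mem_sobolevGraph hφ hs hΩ hsub)

lemma form_testL2 (hΩ : IsLipschitzDomain Ω) (hsub : tsupport φ ⊆ Ω) (κ : ℝ) (v : L2 Ω) :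
    form ΓR κ (testL2 Ω hφ hs) v = inner ℂ (weakGrad v) (testGrad Ω hφ hs) -
      (κ : ℂ) ^ 2 * inner ℂ v (testL2 Ω hφ hs) := by
  have h0 : ∫ x in ΓR, trace (testL2 Ω hφ hs) x * (starRingEnd ℂ) (trace v x)
      ∂(surfaceMeasure Ω) = 0 := by
    refine integral_eq_zero_of_ae (ae_restrict_of_ae ?_)
    rw [trace_eq_of_mem hΩ (testL2_mem_sobolevGraph hφ hs hΩ.isOpen hsub)]
    filter_upwards [Lp.coeFn_zero ℂ 2 (surfaceMeasure Ω)] with x hx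
    rw [hx]
    simp
  rw [form, weakGrad_testL2 hφ hs hΩ.isOpen hsub, h0]
  simp

end TestFunction

section RealTestFunction

variable {χ : Pt d → ℝ}

/-- The Laplacian of a real function, complex valued. -/
def laplacianC (χ : Pt d → ℝ) (x : Pt d) : ℂ :=
  ∑ i : Fin d, ((fderiv ℝ (fun y => fderiv ℝ χ y (EuclideanSpace.single i 1)) x
    (EuclideanSpace.single i 1) : ℝ) : ℂ)

lemma contDiff_laplacianC (hχ : ContDiff ℝ ∞ χ) : ContDiff ℝ ∞ (laplacianC χ) :=
  ContDiff.sum fun _ _ => Complex.ofRealCLM.contDiff.comp (contDiff_partial (contDiff_partial hχ _) _)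

lemma hasCompactSupport_laplacianC (hs : HasCompactSupport χ) :
    HasCompactSupport (laplacianC χ) := by
  refine HasCompactSupport.intro hs fun x hx => ?_
  refine Finset.sum_eq_zero fun i _ => ?_
  have h1 : x ∉ tsupport fun y => fderiv ℝ χ y (EuclideanSpace.single i 1) := fun h => by
    refine hx (closure_minimal (fun y hy => ?_) (isClosed_tsupport χ) h)
    by_contra h2
    rw [Function.mem_support, fderiv_of_notMem_tsupport ℝ h2] at hy
    simp at hy
  rw [fderiv_of_notMem_tsupport ℝ h1]
  simp

lemma contDiff_ofReal (hχ : ContDiff ℝ ∞ χ) : ContDiff ℝ ∞ fun x => (χ x : ℂ) :=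
  Complex.ofRealCLM.contDiff.comp hχ

lemma hasCompactSupport_ofReal (hs : HasCompactSupport χ) :
    HasCompactSupport fun x => (χ x : ℂ) :=
  hs.comp_left Complex.ofReal_zero

lemma tsupport_ofReal : tsupport (fun x => (χ x : ℂ)) = tsupport χ := by
  unfold tsupport
  congr 1
  ext x
  simp

/-- Each partial derivative of χ is itself an admissible test function in the definition of the weak
gradient of v. -/
lemma inner_weakGrad_testGrad (hχ : ContDiff ℝ ∞ χ) (hs : HasCompactSupport χ)
    (hsub : tsupport χ ⊆ Ω) {v : L2 Ω} (hv : HasWeakGrad Ω v (weakGrad v)) :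
    inner ℂ (weakGrad v) (testGrad Ω (contDiff_ofReal hχ) (hasCompactSupport_ofReal hs)) =
      -inner ℂ v (testL2 Ω (contDiff_laplacianC hχ) (hasCompactSupport_laplacianC hs)) := by
  let e (i : Fin d) : Pt d := EuclideanSpace.single i 1
  have hc1 (i : Fin d) := contDiff_partial hχ (e i)
  have hs1 (i : Fin d) := hasCompactSupport_partial hs (e i)
  have hsub1 (i : Fin d) : tsupport (fun y => fderiv ℝ χ y (e i)) ⊆ Ω := by
    refine Subset.trans (closure_minimal (fun y hy => ?_) (isClosed_tsupport χ)) hsub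
    by_contra h2
    rw [Function.mem_support, fderiv_of_notMem_tsupport ℝ h2] at hy
    simp at hy
  have hc2 (i : Fin d) := contDiff_partial (hc1 i) (e i)
  have hs2 (i : Fin d) := hasCompactSupport_partial (hs1 i) (e i)
  have hL : inner ℂ (testGrad Ω (contDiff_ofReal hχ) (hasCompactSupport_ofReal hs)) (weakGrad v) =
      ∑ i, ∫ x in Ω, fderiv ℝ χ x (e i) • weakGrad v x i := by
    rw [L2.inner_def, ← integral_finsetSum]
    · refine integral_congr_ae ?_
      filter_upwards [coeFn_testGrad (Ω := Ω) (contDiff_ofReal hχ) (hasCompactSupport_ofReal hs)]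
        with x hx
      rw [hx, PiLp.inner_apply]
      refine Finset.sum_congr rfl fun i _ => ?_
      rw [classicalGrad_ofReal (hχ.differentiable (by simp) x)]
      simp [e, mul_comm]
    · intro i _
      have h1 := MemLp.integrable_mul (memLp_test (Ω := Ω) (hc1 i).continuous (hs1 i))
        (Lp.memLp (component i (weakGrad v)))
      refine h1.congr ?_
      filter_upwards [coeFn_component i (weakGrad v)] with x hx
      simp [hx]
  have hR : inner ℂ (testL2 Ω (contDiff_laplacianC hχ) (hasCompactSupport_laplacianC hs)) v =
      ∑ i, ∫ x in Ω, fderiv ℝ (fun y => fderiv ℝ χ y (e i)) x (e i) • v x := by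
    rw [L2.inner_def, ← integral_finsetSum]
    · refine integral_congr_ae ?_
      filter_upwards [coeFn_testL2 (Ω := Ω) (contDiff_laplacianC hχ)
        (hasCompactSupport_laplacianC hs)] with x hx
      rw [hx, laplacianC]
      simp [e, Finset.mul_sum, mul_comm]
    · intro i _
      have h1 := MemLp.integrable_mul (memLp_test (Ω := Ω) (hc2 i).continuous (hs2 i)) (Lp.memLp v)
      refine h1.congr (Eventually.of_forall fun x => ?_)
      simp
  rw [← inner_conj_symm, ← inner_conj_symm v, hL, hR, ← map_neg, ← Finset.sum_neg_distrib]
  congr 1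
  refine Finset.sum_congr rfl fun i _ => ?_
  rw [hv _ (hc1 i) (hs1 i) (hsub1 i) i, neg_neg]

lemma exists_test_function_of_isOpen (hΩ : IsOpen Ω) (hne : Ω.Nonempty) :
    ∃ χ : Pt d → ℝ, ContDiff ℝ ∞ χ ∧ HasCompactSupport χ ∧ tsupport χ ⊆ Ω ∧ 0 < ∫ x, χ x := by
  obtain ⟨c, hc⟩ := hne
  obtain ⟨ε, hε, hball⟩ := Metric.isOpen_iff.1 hΩ c hc
  let b : ContDiffBump c := ⟨ε / 4, ε / 2, by positivity, by linarith⟩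
  refine ⟨b, b.contDiff, b.hasCompactSupport, ?_, b.integral_pos⟩
  rw [b.tsupport_eq]
  exact (Metric.closedBall_subset_ball (by simp [b]; linarith)).trans hball

/-- Integration by parts against a coordinate function: a vanishing gradient would give 0 = ∫ ∂ᵢχ xᵢ
= -∫ χ. -/
lemma testGrad_ne_zero (hd : 1 ≤ d) (hΩ : IsOpen Ω) (hχ : ContDiff ℝ ∞ χ)
    (hs : HasCompactSupport χ) (hsub : tsupport χ ⊆ Ω) (hpos : 0 < ∫ x, χ x) :
    testGrad Ω (contDiff_ofReal hχ) (hasCompactSupport_ofReal hs) ≠ 0 := by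
  intro h0
  let i : Fin d := ⟨0, hd⟩
  let ℓ : Pt d →L[ℝ] ℂ := Complex.ofRealCLM.comp (EuclideanSpace.proj i)
  have h1 := integral_partial_smul hχ hs ℓ.contDiff (EuclideanSpace.single i 1)
  have h2 (x : Pt d) : fderiv ℝ ℓ x (EuclideanSpace.single i 1) = 1 := by
    simp [ℓ]
  have h3 : ∀ᵐ x : Pt d, fderiv ℝ χ x (EuclideanSpace.single i 1) = 0 := by
    have h4 := (ae_restrict_iff' hΩ.measurableSet).1
      ((coeFn_testGrad (Ω := Ω) (contDiff_ofReal hχ) (hasCompactSupport_ofReal hs)).symm.trans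
        (Lp.eq_zero_iff_ae_eq_zero.1 h0))
    filter_upwards [h4] with x hx
    by_cases hxΩ : x ∈ Ω
    · have h5 := congrArg (fun y : EuclideanSpace ℂ (Fin d) => y i) (hx hxΩ)
      rw [classicalGrad_ofReal (hχ.differentiable (by simp) x)] at h5
      exact Complex.ofReal_eq_zero.1 h5
    · rw [fderiv_of_notMem_tsupport ℝ fun h => hxΩ (hsub h)]
      rfl
  have h6 : ∫ x, fderiv ℝ χ x (EuclideanSpace.single i 1) • ℓ x = 0 :=
    integral_eq_zero_of_ae (h3.mono fun x hx => by simp [hx])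
  have h7 : ∫ x, χ x • fderiv ℝ ℓ x (EuclideanSpace.single i 1) = ((∫ x, χ x : ℝ) : ℂ) := by
    rw [← integral_complex_ofReal]
    exact integral_congr_ae (Eventually.of_forall fun x => by simp only [h2]; simp)
  rw [h6, h7, zero_eq_neg] at h1
  exact hpos.ne' (by exact_mod_cast h1)

end RealTestFunction

lemma normV_sq (κ : ℝ) (v : L2 Ω) : normV κ v ^ 2 = κ ^ 2 * ‖v‖ ^ 2 + ‖weakGrad v‖ ^ 2 :=
  Real.sq_sqrt (by positivity)

lemma normV_nonneg (κ : ℝ) (v : L2 Ω) : 0 ≤ normV κ v := Real.sqrt_nonneg _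

/-- For large wave numbers the stability constant is bounded below by `1 / κ`. -/
lemma exists_forall_one_le_stabilityConst_mul (hd : 1 ≤ d) (hΩ : IsLipschitzDomain Ω) :
    ∃ κ₀ : ℝ, 0 < κ₀ ∧ ∀ (ΓD ΓR : Set (Pt d)) (κ C : ℝ), κ₀ ≤ κ →
      IsStabilityConst Ω ΓD ΓR κ C → 1 ≤ C * κ := by
  obtain ⟨χ, hχ, hs, hsub, hpos⟩ :=
    exists_test_function_of_isOpen hΩ.isOpen hΩ.isConnected.nonempty
  set u := testL2 Ω (contDiff_ofReal hχ) (hasCompactSupport_ofReal hs) with hu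
  set G := testGrad Ω (contDiff_ofReal hχ) (hasCompactSupport_ofReal hs) with hG
  set l := testL2 Ω (contDiff_laplacianC hχ) (hasCompactSupport_laplacianC hs)
  have hsub' : tsupport (fun x => (χ x : ℂ)) ⊆ Ω := tsupport_ofReal.trans_subset hsub
  have hG0 : 0 < ‖G‖ := norm_pos_iff.2 (testGrad_ne_zero hd hΩ.isOpen hχ hs hsub hpos)
  have huG : weakGrad u = G := weakGrad_testL2 _ _ hΩ.isOpen hsub'
  -- With this threshold κ‖G‖ ≥ ‖l‖ + ‖G‖. Only the bump function enters, and it was fixed from Ω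
  -- alone.
  refine ⟨‖l‖ / ‖G‖ + 1, by positivity, fun ΓD ΓR κ C hκ hC => ?_⟩
  have hκ0 : 0 < κ := lt_of_lt_of_le (by positivity) hκ
  have huV : u ∈ V Ω ΓD := testL2_mem_V _ _ hΩ.isOpen hsub'
  have hweak {v : L2 Ω} (hv : v ∈ V Ω ΓD) : inner ℂ (weakGrad v) G = -inner ℂ v l := by
    obtain ⟨G', g, hp, -⟩ := (mem_V_iff hΩ.isOpen).1 hv
    refine inner_weakGrad_testGrad hχ hs hsub ?_
    rw [weakGrad_eq_of_mem hΩ.isOpen hp]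
    exact hasWeakGrad_of_mem_sobolevGraph hp
  -- The bump u solves the Helmholtz problem with data f = -(Δu + κ²u). Green's formula gives ‖f‖² =
  -- ‖l‖² - 2κ²‖G‖² + κ⁴‖u‖², which is below κ²‖u‖_V² = κ⁴‖u‖² + κ²‖G‖² as soon as 3κ²‖G‖² > ‖l‖².
  -- Then C κ < 1 is impossible.
  have hstab := hC (-(l + ((κ : ℂ) ^ 2) • u)) u huV fun v hv => by
    rw [hu, form_testL2 _ _ hΩ hsub', ← hu, ← hG, hweak hv, inner_neg_right, inner_add_right,
      inner_smul_right]
    ring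
  rw [norm_neg] at hstab
  have hul : inner ℂ u l = -((‖G‖ ^ 2 : ℝ) : ℂ) := by
    have h1 := hweak huV
    rw [huG, inner_self_eq_norm_sq_to_K] at h1
    rw [← neg_eq_iff_eq_neg, ← h1]
    push_cast
    rfl
  have hf : ‖l + ((κ : ℂ) ^ 2) • u‖ ^ 2 =
      ‖l‖ ^ 2 - 2 * κ ^ 2 * ‖G‖ ^ 2 + κ ^ 4 * ‖u‖ ^ 2 := by
    rw [norm_add_sq (𝕜 := ℂ), inner_smul_right, ← inner_conj_symm, hul, norm_smul]
    have h2 : (κ : ℂ) ^ 2 * (starRingEnd ℂ) (-((‖G‖ ^ 2 : ℝ) : ℂ)) =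
        ((-(κ ^ 2 * ‖G‖ ^ 2) : ℝ) : ℂ) := by
      rw [map_neg, Complex.conj_ofReal]
      push_cast
      ring
    rw [h2]
    change _ + 2 * (-(κ ^ 2 * ‖G‖ ^ 2)) + _ = _
    rw [norm_pow, Complex.norm_real, Real.norm_of_nonneg hκ0.le]
    ring
  by_contra! hlt
  have h3 : κ * normV κ u ≤ ‖l + ((κ : ℂ) ^ 2) • u‖ := by
    calc κ * normV κ u ≤ κ * (C * ‖l + ((κ : ℂ) ^ 2) • u‖) := by gcongr
      _ = C * κ * ‖l + ((κ : ℂ) ^ 2) • u‖ := by ring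
      _ ≤ 1 * ‖l + ((κ : ℂ) ^ 2) • u‖ := by gcongr
      _ = _ := one_mul _
  have h4 := pow_le_pow_left₀ (mul_nonneg hκ0.le (normV_nonneg κ u)) h3 2
  rw [mul_pow, normV_sq, hf, huG] at h4
  have h5 : ‖l‖ + ‖G‖ ≤ κ * ‖G‖ := by
    calc ‖l‖ + ‖G‖ = (‖l‖ / ‖G‖ + 1) * ‖G‖ := by field_simp
      _ ≤ κ * ‖G‖ := by gcongr
  have h6 : (‖l‖ + ‖G‖) ^ 2 ≤ (κ * ‖G‖) ^ 2 := pow_le_pow_left₀ (by positivity) h5 2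
  nlinarith [norm_nonneg l]

lemma norm_testL2_le_testGrad {χ : Pt d → ℝ} {φ : Pt d → ℂ} (hφ : ContDiff ℝ ∞ φ)
    (hs : HasCompactSupport φ) {c : ℝ} (hc : 0 < c) {i : Fin d}
    (h : ∀ x, ‖φ x‖ = |χ x|)
    (h' : ∀ x, c * |χ x| ≤ ‖fderiv ℝ φ x (EuclideanSpace.single i 1)‖) :
    c * ‖testL2 Ω hφ hs‖ ≤ ‖testGrad Ω hφ hs‖ := by
  rw [← le_div_iff₀' hc, div_eq_inv_mul]
  refine Lp.norm_le_mul_norm_of_ae_le_mul ?_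
  filter_upwards [coeFn_testL2 (Ω := Ω) hφ hs, coeFn_testGrad (Ω := Ω) hφ hs] with x hx hx'
  rw [hx, hx', h, ← div_eq_inv_mul, le_div_iff₀' hc]
  exact (h' x).trans (PiLp.norm_apply_le (classicalGrad φ x) i)

/-- The continuity constant is at least `1 / 3`. -/
lemma one_le_three_mul_continuityConst (hd : 1 ≤ d) (hΩ : IsLipschitzDomain Ω) {κ Ca : ℝ}
    (hκ : 0 < κ) (hCa : IsContinuityConst Ω ΓD ΓR κ Ca) : 1 ≤ 3 * Ca := by
  obtain ⟨χ, hχ, hs, hsub, hpos⟩ :=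
    exists_test_function_of_isOpen hΩ.isOpen hΩ.isConnected.nonempty
  let i : Fin d := ⟨0, hd⟩
  -- The bump is multiplied by exp(2iκxᵢ). Since χ is real, the derivative has modulus at least
  -- 2κ|χ|, so ‖∇φ‖² ≥ 4κ²‖φ‖², whereas Ca < 1/3 would force ‖∇φ‖² < 2κ²‖φ‖².
  let ℓ : Pt d →L[ℝ] ℂ := (Complex.I * (2 * κ : ℝ)) • Complex.ofRealCLM.comp (EuclideanSpace.proj i)
  have hℓ : ℓ (EuclideanSpace.single i 1) = Complex.I * (2 * κ : ℝ) := by simp [ℓ]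
  let φ : Pt d → ℂ := fun x => (χ x : ℂ) * Complex.exp (ℓ x)
  have hφ : ContDiff ℝ ∞ φ := (contDiff_ofReal hχ).mul ℓ.contDiff.cexp
  have hsφ : HasCompactSupport φ := (hasCompactSupport_ofReal hs).mul_right
  have hsubφ : tsupport φ ⊆ Ω :=
    ((tsupport_mul_subset_left (f := fun x => (χ x : ℂ))).trans_eq tsupport_ofReal).trans hsub
  have hexp (x : Pt d) : ‖Complex.exp (ℓ x)‖ = 1 := by
    have : ℓ x = ((2 * κ * x i : ℝ) : ℂ) * Complex.I := by
      simp [ℓ]; ring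
    rw [this, Complex.norm_exp_ofReal_mul_I]
  have h1 (x : Pt d) : ‖φ x‖ = |χ x| := by
    simp only [φ]
    rw [norm_mul, hexp, mul_one, Complex.norm_real, Real.norm_eq_abs]
  have h2 (x : Pt d) : 2 * κ * |χ x| ≤ ‖fderiv ℝ φ x (EuclideanSpace.single i 1)‖ := by
    have e1 : HasFDerivAt (fun x => (χ x : ℂ)) (Complex.ofRealCLM.comp (fderiv ℝ χ x)) x :=
      (Complex.ofRealCLM.hasFDerivAt (x := χ x)).comp x
        (hχ.differentiable (by simp) x).hasFDerivAt
    have e2 := e1.mul (ℓ.hasFDerivAt (x := x)).cexp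
    have e3 : fderiv ℝ φ x (EuclideanSpace.single i 1) =
        Complex.exp (ℓ x) * ((fderiv ℝ χ x (EuclideanSpace.single i 1) : ℂ) +
          ((2 * κ * χ x : ℝ) : ℂ) * Complex.I) := by
      have e4 : HasFDerivAt φ _ x := e2
      rw [e4.fderiv]
      simp only [add_apply, smul_apply, hℓ, smul_eq_mul,
        ContinuousLinearMap.comp_apply, Complex.ofRealCLM_apply]
      push_cast
      ring
    rw [e3, norm_mul, hexp, one_mul]
    refine le_trans (le_of_eq ?_) (Complex.abs_im_le_norm _)
    rw [Complex.add_im, Complex.ofReal_im, Complex.im_ofReal_mul, Complex.I_im, zero_add,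
      mul_one, abs_mul, abs_of_pos (show 0 < 2 * κ by positivity)]
  have hle : 2 * κ * ‖testL2 Ω hφ hsφ‖ ≤ ‖testGrad Ω hφ hsφ‖ :=
    norm_testL2_le_testGrad hφ hsφ (by positivity) h1 h2
  have hne : testL2 Ω hφ hsφ ≠ 0 := by
    intro h0
    have h3 := (ae_restrict_iff' hΩ.isOpen.measurableSet).1
      ((coeFn_testL2 (Ω := Ω) hφ hsφ).symm.trans (Lp.eq_zero_iff_ae_eq_zero.1 h0))
    refine hpos.ne' (integral_eq_zero_of_ae ?_)
    filter_upwards [h3] with x hx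
    by_cases hxΩ : x ∈ Ω
    · have h4 := h1 x
      rw [hx hxΩ] at h4
      simpa using h4.symm
    · exact image_eq_zero_of_notMem_tsupport fun h => hxΩ (hsub h)
  have huV := testL2_mem_V (ΓD := ΓD) hφ hsφ hΩ.isOpen hsubφ
  have h5 := hCa _ huV _ huV
  rw [form_testL2 _ _ hΩ hsubφ, weakGrad_testL2 _ _ hΩ.isOpen hsubφ, inner_self_eq_norm_sq_to_K,
    inner_self_eq_norm_sq_to_K, mul_assoc, ← sq, normV_sq, weakGrad_testL2 _ _ hΩ.isOpen hsubφ]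
    at h5
  set U := ‖testL2 Ω hφ hsφ‖
  set G := ‖testGrad Ω hφ hsφ‖
  have hU : 0 < U := norm_pos_iff.2 hne
  have h6 : G ^ 2 - κ ^ 2 * U ^ 2 ≤ Ca * (κ ^ 2 * U ^ 2 + G ^ 2) := by
    refine le_trans ?_ h5
    refine le_trans (le_of_eq ?_) (Complex.re_le_norm _)
    rw [← Complex.ofReal_re (G ^ 2 - κ ^ 2 * U ^ 2)]
    push_cast
    rfl
  have h7 : (2 * κ * U) ^ 2 ≤ G ^ 2 := pow_le_pow_left₀ (by positivity) hle 2
  by_contra! hlt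
  have h8 : 0 < κ ^ 2 * U ^ 2 + G ^ 2 := by positivity
  nlinarith [mul_pos (pow_pos hκ 2) (pow_pos hU 2)]

end Helmholtz

end

noncomputable section

namespace Helmholtz

variable {d : ℕ} {Ω ΓD ΓR : Set (Pt d)} {κ : ℝ}

/-! ### Complex conjugation -/

/-- Complex conjugation of a square integrable function. -/
def conjLp {μ : Measure (Pt d)} : Lp ℂ 2 μ →L[ℝ] Lp ℂ 2 μ :=
  (Complex.conjCLE : ℂ →L[ℝ] ℂ).compLpL 2 μ

/-- Complex conjugation on `ℂ^d`. -/
def conjEuclidean : EuclideanSpace ℂ (Fin d) →L[ℝ] EuclideanSpace ℂ (Fin d) :=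
  LinearMap.toContinuousLinearMap
    { toFun := fun x => WithLp.toLp 2 fun i => starRingEnd ℂ (x i)
      map_add' := fun x y => by ext i; simp
      map_smul' := fun c x => by ext i; simp }

lemma conjEuclidean_apply (x : EuclideanSpace ℂ (Fin d)) (i : Fin d) :
    conjEuclidean x i = starRingEnd ℂ (x i) := rfl

lemma norm_conjEuclidean (x : EuclideanSpace ℂ (Fin d)) : ‖conjEuclidean x‖ = ‖x‖ := by
  simp [EuclideanSpace.norm_eq, conjEuclidean_apply]

/-- Complex conjugation of a square integrable vector field. -/
def conjVec : L2Vec Ω →L[ℝ] L2Vec Ω := conjEuclidean.compLpL 2 _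

lemma coeFn_conjLp {μ : Measure (Pt d)} (u : Lp ℂ 2 μ) :
    conjLp u =ᵐ[μ] fun x => starRingEnd ℂ (u x) :=
  ContinuousLinearMap.coeFn_compLp _ _

lemma coeFn_conjVec (G : L2Vec Ω) :
    conjVec G =ᵐ[volume.restrict Ω] fun x => conjEuclidean (G x) :=
  ContinuousLinearMap.coeFn_compLp _ _

lemma norm_conjLp {μ : Measure (Pt d)} (u : Lp ℂ 2 μ) : ‖conjLp u‖ = ‖u‖ := by
  rw [Lp.norm_def, Lp.norm_def]
  congr 1
  refine eLpNorm_congr_norm_ae ?_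
  filter_upwards [coeFn_conjLp u] with x hx
  rw [hx, RCLike.norm_conj]

lemma norm_conjVec (G : L2Vec Ω) : ‖conjVec G‖ = ‖G‖ := by
  rw [Lp.norm_def, Lp.norm_def]
  congr 1
  refine eLpNorm_congr_norm_ae ?_
  filter_upwards [coeFn_conjVec G] with x hx
  rw [hx, norm_conjEuclidean]

lemma conj_mem_sobolevGraph {u : L2 Ω} {G : L2Vec Ω} {g : L2Bdry Ω}
    (hp : (u, G, g) ∈ sobolevGraph Ω) : (conjLp u, conjVec G, conjLp g) ∈ sobolevGraph Ω := by
  have hc : Continuous fun p : L2 Ω × L2Vec Ω × L2Bdry Ω =>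
      (conjLp p.1, conjVec p.2.1, conjLp p.2.2) := by fun_prop
  refine map_mem_closure (s := (smoothTriples Ω : Set (L2 Ω × L2Vec Ω × L2Bdry Ω)))
    (t := (smoothTriples Ω : Set (L2 Ω × L2Vec Ω × L2Bdry Ω)))
    (f := fun p : L2 Ω × L2Vec Ω × L2Bdry Ω => (conjLp p.1, conjVec p.2.1, conjLp p.2.2))
    hc hp fun p hp => ?_
  obtain ⟨φ, hφ, h1, h2, h3⟩ := hp
  refine ⟨fun x => starRingEnd ℂ (φ x), Complex.conjCLE.contDiff.comp hφ, ?_, ?_, ?_⟩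
  · filter_upwards [coeFn_conjLp p.1, h1] with x hx hx'
    rw [hx, hx']
  · filter_upwards [coeFn_conjVec p.2.1, h2] with x hx hx'
    rw [hx, hx']
    ext i
    rw [conjEuclidean_apply, classicalGrad_apply, classicalGrad_apply]
    have h4 := (Complex.conjCLE : ℂ →L[ℝ] ℂ).hasFDerivAt.comp x
      (hφ.differentiable (by simp) x).hasFDerivAt
    rw [show (fun x => starRingEnd ℂ (φ x)) = (Complex.conjCLE : ℂ →L[ℝ] ℂ) ∘ φ from rfl, h4.fderiv]
    rfl
  · filter_upwards [coeFn_conjLp p.2.2, h3] with x hx hx'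
    rw [hx, hx']

lemma mem_sobolevGraph_of_mem_V (hΩ : IsLipschitzDomain Ω) {v : L2 Ω} (hv : v ∈ V Ω ΓD) :
    (v, weakGrad v, trace v) ∈ sobolevGraph Ω ∧
      ∀ᵐ x ∂(surfaceMeasure Ω), x ∈ ΓD → trace v x = 0 := by
  obtain ⟨G, g, hp, h0⟩ := (mem_V_iff hΩ.isOpen).1 hv
  rw [weakGrad_eq_of_mem hΩ.isOpen hp, trace_eq_of_mem hΩ hp]
  exact ⟨hp, h0⟩

lemma conj_mem_V (hΩ : IsLipschitzDomain Ω) {v : L2 Ω} (hv : v ∈ V Ω ΓD) :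
    conjLp v ∈ V Ω ΓD := by
  obtain ⟨hp, h0⟩ := mem_sobolevGraph_of_mem_V hΩ hv
  refine (mem_V_iff hΩ.isOpen).2 ⟨_, _, conj_mem_sobolevGraph hp, ?_⟩
  filter_upwards [coeFn_conjLp (trace v), h0] with x hx hx0 hxD
  rw [hx, hx0 hxD, map_zero]

lemma weakGrad_conj (hΩ : IsLipschitzDomain Ω) {v : L2 Ω} (hv : v ∈ V Ω ΓD) :
    weakGrad (conjLp v) = conjVec (weakGrad v) :=
  weakGrad_eq_of_mem hΩ.isOpen (conj_mem_sobolevGraph (mem_sobolevGraph_of_mem_V hΩ hv).1)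

lemma trace_conj (hΩ : IsLipschitzDomain Ω) {v : L2 Ω} (hv : v ∈ V Ω ΓD) :
    trace (conjLp v) = conjLp (trace v) :=
  trace_eq_of_mem hΩ (conj_mem_sobolevGraph (mem_sobolevGraph_of_mem_V hΩ hv).1)

lemma normV_conj (hΩ : IsLipschitzDomain Ω) {v : L2 Ω} (hv : v ∈ V Ω ΓD) :
    normV κ (conjLp v) = normV κ v := by
  rw [normV, weakGrad_conj hΩ hv, norm_conjVec, norm_conjLp, normV]

/-- Without conjugation the form is bilinear and symmetric. Thus the conjugate of a primal solution
with data conj f solves the adjoint problem with data f. -/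
lemma form_conj (hΩ : IsLipschitzDomain Ω) {u v : L2 Ω} (hu : u ∈ V Ω ΓD) (hv : v ∈ V Ω ΓD) :
    form ΓR κ u (conjLp v) = form ΓR κ v (conjLp u) := by
  rw [form, form, weakGrad_conj hΩ hu, weakGrad_conj hΩ hv, trace_conj hΩ hu, trace_conj hΩ hv]
  congr 1
  · congr 1
    · rw [L2.inner_def, L2.inner_def]
      refine integral_congr_ae ?_
      filter_upwards [coeFn_conjVec (weakGrad u), coeFn_conjVec (weakGrad v)] with x hx hx'
      rw [hx, hx', PiLp.inner_apply, PiLp.inner_apply]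
      refine Finset.sum_congr rfl fun i _ => ?_
      rw [conjEuclidean_apply, conjEuclidean_apply]
      simp [mul_comm]
    · congr 1
      rw [L2.inner_def, L2.inner_def]
      refine integral_congr_ae ?_
      filter_upwards [coeFn_conjLp u, coeFn_conjLp v] with x hx hx'
      rw [hx, hx']
      simp [mul_comm]
  · congr 1
    refine integral_congr_ae (ae_restrict_of_ae ?_)
    filter_upwards [coeFn_conjLp (trace u), coeFn_conjLp (trace v)] with x hx hx'
    rw [hx, hx']
    simp [mul_comm]

/-! ### The space `V` as a Hilbert space -/

/-- L² convergence gives almost everywhere convergence along a subsequence. -/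
lemma isClosed_ae_eq_zero_on {μ : Measure (Pt d)} (S : Set (Pt d)) :
    IsClosed {g : Lp ℂ 2 μ | ∀ᵐ x ∂μ, x ∈ S → g x = 0} := by
  refine IsSeqClosed.isClosed fun g g₀ hg hlim => ?_
  obtain ⟨ns, -, hns⟩ := (tendstoInMeasure_of_tendsto_Lp hlim).exists_seq_tendsto_ae
  filter_upwards [hns, ae_all_iff.2 hg] with x hx hx0 hxS
  refine tendsto_nhds_unique hx (tendsto_const_nhds.congr fun n => ?_)
  rw [hx0 _ hxS]

/-- The triples of a function in `V`, its gradient and its trace. -/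
def dirichletGraph (Ω ΓD : Set (Pt d)) : Submodule ℂ (L2 Ω × L2Vec Ω × L2Bdry Ω) where
  carrier := {p | p ∈ sobolevGraph Ω ∧ ∀ᵐ x ∂(surfaceMeasure Ω), x ∈ ΓD → p.2.2 x = 0}
  zero_mem' := by
    refine ⟨zero_mem _, ?_⟩
    filter_upwards [Lp.coeFn_zero ℂ 2 (surfaceMeasure Ω)] with x hx _
    exact hx
  add_mem' := by
    rintro p q ⟨hp, hp0⟩ ⟨hq, hq0⟩
    refine ⟨add_mem hp hq, ?_⟩
    filter_upwards [Lp.coeFn_add p.2.2 q.2.2, hp0, hq0] with x hx h1 h2 hxD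
    change (p.2.2 + q.2.2 : L2Bdry Ω) x = 0
    rw [hx, Pi.add_apply, h1 hxD, h2 hxD, add_zero]
  smul_mem' := by
    rintro c p ⟨hp, hp0⟩
    refine ⟨Submodule.smul_mem _ c hp, ?_⟩
    filter_upwards [Lp.coeFn_smul c p.2.2, hp0] with x hx h1 hxD
    change (c • p.2.2 : L2Bdry Ω) x = 0
    rw [hx, Pi.smul_apply, h1 hxD, smul_zero]

lemma isClosed_dirichletGraph : IsClosed (dirichletGraph Ω ΓD : Set (L2 Ω × L2Vec Ω × L2Bdry Ω)) :=
  (Submodule.isClosed_topologicalClosure _).inter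
    ((isClosed_ae_eq_zero_on ΓD).preimage (continuous_snd.comp continuous_snd))

lemma mem_V_of_mem_dirichletGraph (hΩ : IsLipschitzDomain Ω) {p : L2 Ω × L2Vec Ω × L2Bdry Ω}
    (hp : p ∈ dirichletGraph Ω ΓD) : p.1 ∈ V Ω ΓD ∧ weakGrad p.1 = p.2.1 ∧ trace p.1 = p.2.2 :=
  ⟨(mem_V_iff hΩ.isOpen).2 ⟨_, _, hp.1, hp.2⟩, weakGrad_eq_of_mem hΩ.isOpen hp.1,
    trace_eq_of_mem hΩ hp.1⟩

/-- The embedding of `V` into a Hilbert space that induces the norm `‖·‖_V`. -/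
def weightedGraphMap (Ω ΓD : Set (Pt d)) (κ : ℝ) :
    dirichletGraph Ω ΓD →L[ℂ] WithLp 2 (L2 Ω × L2Vec Ω) :=
  ((WithLp.prodContinuousLinearEquiv 2 ℂ (L2 Ω) (L2Vec Ω)).symm :
      L2 Ω × L2Vec Ω →L[ℂ] WithLp 2 (L2 Ω × L2Vec Ω)).comp
    ((((κ : ℂ) • ContinuousLinearMap.fst ℂ (L2 Ω) (L2Vec Ω × L2Bdry Ω)).prod
      ((ContinuousLinearMap.fst ℂ (L2Vec Ω) (L2Bdry Ω)).comp
        (ContinuousLinearMap.snd ℂ (L2 Ω) (L2Vec Ω × L2Bdry Ω)))).comp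
          (dirichletGraph Ω ΓD).subtypeL)

lemma weightedGraphMap_apply (p : dirichletGraph Ω ΓD) :
    weightedGraphMap Ω ΓD κ p = WithLp.toLp 2 ((κ : ℂ) • p.1.1, p.1.2.1) := rfl

/-- The space `V` with the Hilbert space structure of the norm `‖·‖_V`. -/
abbrev energySpace (Ω ΓD : Set (Pt d)) (κ : ℝ) : Submodule ℂ (WithLp 2 (L2 Ω × L2Vec Ω)) :=
  LinearMap.range (weightedGraphMap Ω ΓD κ : dirichletGraph Ω ΓD →ₗ[ℂ] WithLp 2 (L2 Ω × L2Vec Ω))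

lemma completeSpace_energySpace (hΩ : IsLipschitzDomain Ω) (hκ : 0 < κ) :
    CompleteSpace (energySpace Ω ΓD κ) := by
  obtain ⟨C, hC0, hC⟩ := exists_trace_bound hΩ
  have hcs : CompleteSpace (dirichletGraph Ω ΓD) := isClosed_dirichletGraph.completeSpace_coe
  -- The three summands bound the function, its gradient and its trace by the energy norm. The trace
  -- is not part of that norm, so its bound comes from the trace inequality.
  have hanti : AntilipschitzWith (κ⁻¹ + 1 + √(C * ((κ⁻¹) ^ 2 + 1))).toNNReal
      (weightedGraphMap Ω ΓD κ) := by
    refine AddMonoidHomClass.antilipschitz_of_bound _ fun p => ?_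
    rw [Real.coe_toNNReal _ (by positivity)]
    set N := ‖weightedGraphMap Ω ΓD κ p‖ with hN
    have hN0 : 0 ≤ N := norm_nonneg _
    have hsq : N ^ 2 = κ ^ 2 * ‖p.1.1‖ ^ 2 + ‖p.1.2.1‖ ^ 2 := by
      rw [hN, weightedGraphMap_apply, WithLp.prod_norm_sq_eq_of_L2]
      change ‖(κ : ℂ) • p.1.1‖ ^ 2 + ‖p.1.2.1‖ ^ 2 = _
      rw [norm_smul, Complex.norm_real, Real.norm_of_nonneg hκ.le]
      ring
    have h1 : ‖p.1.1‖ ≤ κ⁻¹ * N := by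
      rw [← div_eq_inv_mul, le_div_iff₀ hκ]
      refine le_of_sq_le_sq ?_ hN0
      nlinarith [sq_nonneg ‖p.1.2.1‖]
    have h2 : ‖p.1.2.1‖ ≤ N := by
      refine le_of_sq_le_sq ?_ hN0
      nlinarith [sq_nonneg (κ * ‖p.1.1‖)]
    have h3 : ‖p.1.2.2‖ ≤ √(C * ((κ⁻¹) ^ 2 + 1)) * N := by
      refine le_of_sq_le_sq ?_ (by positivity)
      rw [mul_pow, Real.sq_sqrt (by positivity)]
      refine (hC _ p.2.1).trans ?_
      rw [mul_assoc, add_mul, one_mul, ← mul_pow]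
      gcongr
    have hs0 : 0 ≤ √(C * ((κ⁻¹) ^ 2 + 1)) * N := by positivity
    have hk0 : 0 ≤ κ⁻¹ * N := by positivity
    change max ‖p.1.1‖ (max ‖p.1.2.1‖ ‖p.1.2.2‖) ≤ _
    refine max_le ?_ (max_le ?_ ?_) <;> nlinarith
  exact (hanti.isClosed_range (weightedGraphMap Ω ΓD κ).uniformContinuous).completeSpace_coe

/-- The function in `V` that is represented by an element of `energySpace`. -/
def toFunctionL (Ω ΓD : Set (Pt d)) (κ : ℝ) : energySpace Ω ΓD κ →L[ℂ] L2 Ω :=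
  ((κ : ℂ)⁻¹ • (WithLp.fstL 2 ℂ (L2 Ω) (L2Vec Ω))).comp (energySpace Ω ΓD κ).subtypeL

lemma exists_mem_dirichletGraph (hκ : κ ≠ 0) (x : energySpace Ω ΓD κ) :
    ∃ p ∈ dirichletGraph Ω ΓD, toFunctionL Ω ΓD κ x = p.1 ∧
      (x : WithLp 2 (L2 Ω × L2Vec Ω)) = WithLp.toLp 2 ((κ : ℂ) • p.1, p.2.1) := by
  obtain ⟨_, p, rfl⟩ := x
  refine ⟨p.1, p.2, ?_, rfl⟩
  change (κ : ℂ)⁻¹ • ((κ : ℂ) • p.1.1) = p.1.1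
  rw [smul_smul, inv_mul_cancel₀ (by exact_mod_cast hκ), one_smul]

lemma toFunctionL_mem_V (hΩ : IsLipschitzDomain Ω) (hκ : 0 < κ) (x : energySpace Ω ΓD κ) :
    toFunctionL Ω ΓD κ x ∈ V Ω ΓD := by
  obtain ⟨p, hp, h1, -⟩ := exists_mem_dirichletGraph hκ.ne' x
  rw [h1]
  exact (mem_V_of_mem_dirichletGraph hΩ hp).1

lemma norm_eq_normV (hΩ : IsLipschitzDomain Ω) (hκ : 0 < κ) (x : energySpace Ω ΓD κ) :
    ‖x‖ = normV κ (toFunctionL Ω ΓD κ x) := by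
  obtain ⟨p, hp, h1, h2⟩ := exists_mem_dirichletGraph hκ.ne' x
  change ‖(x : WithLp 2 (L2 Ω × L2Vec Ω))‖ = _
  rw [h1, normV, (mem_V_of_mem_dirichletGraph hΩ hp).2.1, h2, WithLp.prod_norm_eq_of_L2]
  congr 2
  change ‖(κ : ℂ) • p.1‖ ^ 2 = _
  rw [norm_smul, Complex.norm_real, Real.norm_of_nonneg hκ.le, mul_pow]

lemma exists_toFunctionL_eq (hΩ : IsLipschitzDomain Ω) (hκ : 0 < κ) {v : L2 Ω}
    (hv : v ∈ V Ω ΓD) : ∃ x, toFunctionL Ω ΓD κ x = v := by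
  refine ⟨⟨_, ⟨(v, weakGrad v, trace v), mem_sobolevGraph_of_mem_V hΩ hv⟩, rfl⟩, ?_⟩
  change (κ : ℂ)⁻¹ • ((κ : ℂ) • v) = v
  rw [smul_smul, inv_mul_cancel₀ (by exact_mod_cast hκ.ne'), one_smul]

lemma weakGrad_toFunctionL (hΩ : IsLipschitzDomain Ω) (hκ : 0 < κ) (x : energySpace Ω ΓD κ) :
    weakGrad (toFunctionL Ω ΓD κ x) = (x : WithLp 2 (L2 Ω × L2Vec Ω)).snd := by
  obtain ⟨p, hp, h1, h2⟩ := exists_mem_dirichletGraph hκ.ne' x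
  rw [h1, h2, (mem_V_of_mem_dirichletGraph hΩ hp).2.1]
  rfl

lemma injective_toFunctionL (hΩ : IsLipschitzDomain Ω) (hκ : 0 < κ) :
    Function.Injective (toFunctionL Ω ΓD κ) := by
  rw [injective_iff_map_eq_zero]
  intro x hx
  have h0 := weakGrad_toFunctionL hΩ hκ (0 : energySpace Ω ΓD κ)
  rw [map_zero] at h0
  rw [← norm_eq_zero, norm_eq_normV hΩ hκ, hx, normV, h0]
  simp

/-- `trace` is defined by choice, so its linearity comes from the graph being a submodule together
with uniqueness of traces. -/
lemma trace_add_toFunctionL (hΩ : IsLipschitzDomain Ω) (hκ : 0 < κ) (x y : energySpace Ω ΓD κ) :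
    trace (toFunctionL Ω ΓD κ (x + y)) =
      trace (toFunctionL Ω ΓD κ x) + trace (toFunctionL Ω ΓD κ y) := by
  rw [map_add]
  exact trace_eq_of_mem hΩ (add_mem
    (mem_sobolevGraph_of_mem_V hΩ (toFunctionL_mem_V hΩ hκ x)).1
    (mem_sobolevGraph_of_mem_V hΩ (toFunctionL_mem_V hΩ hκ y)).1)

lemma trace_smul_toFunctionL (hΩ : IsLipschitzDomain Ω) (hκ : 0 < κ) (c : ℂ)
    (x : energySpace Ω ΓD κ) :
    trace (toFunctionL Ω ΓD κ (c • x)) = c • trace (toFunctionL Ω ΓD κ x) := by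
  rw [map_smul]
  exact trace_eq_of_mem hΩ (Submodule.smul_mem _ c
    (mem_sobolevGraph_of_mem_V hΩ (toFunctionL_mem_V hΩ hκ x)).1)

/-- The sesquilinear form of the Robin boundary. -/
def robinForm (ΓR : Set (Pt d)) (g h : L2Bdry Ω) : ℂ :=
  ∫ x in ΓR, g x * (starRingEnd ℂ) (h x) ∂(surfaceMeasure Ω)

lemma integrable_mul_conj (g h : L2Bdry Ω) :
    Integrable (fun x => g x * (starRingEnd ℂ) (h x)) ((surfaceMeasure Ω).restrict ΓR) := by
  refine Integrable.restrict ?_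
  refine (L2.integrable_inner (𝕜 := ℂ) h g).congr (Eventually.of_forall fun x => ?_)
  simp

lemma robinForm_add_left (g g' h : L2Bdry Ω) :
    robinForm ΓR (g + g') h = robinForm ΓR g h + robinForm ΓR g' h := by
  rw [robinForm, robinForm, robinForm, ← integral_add (integrable_mul_conj g h)
    (integrable_mul_conj g' h)]
  refine integral_congr_ae (ae_restrict_of_ae ?_)
  filter_upwards [Lp.coeFn_add g g'] with x hx
  rw [hx, Pi.add_apply, add_mul]

lemma robinForm_smul_left (c : ℂ) (g h : L2Bdry Ω) :
    robinForm ΓR (c • g) h = c * robinForm ΓR g h := by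
  rw [robinForm, robinForm, ← integral_const_mul]
  refine integral_congr_ae (ae_restrict_of_ae ?_)
  filter_upwards [Lp.coeFn_smul c g] with x hx
  rw [hx, Pi.smul_apply, smul_eq_mul, mul_assoc]

lemma robinForm_conj (g h : L2Bdry Ω) :
    robinForm ΓR g h = (starRingEnd ℂ) (robinForm ΓR h g) := by
  rw [robinForm, robinForm, ← integral_conj]
  refine integral_congr_ae (Eventually.of_forall fun x => ?_)
  simp [mul_comm]

/-- Hermitian symmetry makes the diagonal real, so the term -iκ(u,u) drops out of the real part of
the Helmholtz form. -/
lemma robinForm_self_im (g : L2Bdry Ω) : (robinForm ΓR g g).im = 0 :=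
  Complex.conj_eq_iff_im.1 (robinForm_conj g g).symm

/-- The Helmholtz form on the energy space. -/
def energyForm (hΩ : IsLipschitzDomain Ω) (ΓR : Set (Pt d)) (hκ : 0 < κ) :
    energySpace Ω ΓD κ →ₗ[ℂ] energySpace Ω ΓD κ →ₗ⋆[ℂ] ℂ :=
  LinearMap.mk₂'ₛₗ (RingHom.id ℂ) (starRingEnd ℂ)
    (fun x y => inner ℂ (y : WithLp 2 (L2 Ω × L2Vec Ω)).snd (x : WithLp 2 (L2 Ω × L2Vec Ω)).snd
      - (κ : ℂ) ^ 2 * inner ℂ (toFunctionL Ω ΓD κ y) (toFunctionL Ω ΓD κ x)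
      - Complex.I * κ * robinForm ΓR (trace (toFunctionL Ω ΓD κ x)) (trace (toFunctionL Ω ΓD κ y)))
    (fun x x' y => by
      rw [trace_add_toFunctionL hΩ hκ, robinForm_add_left, map_add, inner_add_right,
        Submodule.coe_add, WithLp.add_snd, inner_add_right]
      ring)
    (fun c x y => by
      rw [trace_smul_toFunctionL hΩ hκ, robinForm_smul_left, map_smul, inner_smul_right,
        Submodule.coe_smul, WithLp.smul_snd, inner_smul_right, RingHom.id_apply, smul_eq_mul]
      ring)
    (fun x y y' => by
      rw [trace_add_toFunctionL hΩ hκ, robinForm_conj, robinForm_add_left, map_add, map_add,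
        ← robinForm_conj, ← robinForm_conj, inner_add_left, Submodule.coe_add, WithLp.add_snd,
        inner_add_left]
      ring)
    (fun c x y => by
      rw [trace_smul_toFunctionL hΩ hκ, robinForm_conj, robinForm_smul_left, map_mul, map_smul,
        ← robinForm_conj, inner_smul_left, Submodule.coe_smul, WithLp.smul_snd, inner_smul_left,
        smul_eq_mul]
      ring)

lemma energyForm_apply (hΩ : IsLipschitzDomain Ω) (hκ : 0 < κ) (x y : energySpace Ω ΓD κ) :
    energyForm hΩ ΓR hκ x y = form ΓR κ (toFunctionL Ω ΓD κ x) (toFunctionL Ω ΓD κ y) := by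
  rw [form, weakGrad_toFunctionL hΩ hκ, weakGrad_toFunctionL hΩ hκ]
  rfl

lemma energyForm_self_re (hΩ : IsLipschitzDomain Ω) (hκ : 0 < κ) (x : energySpace Ω ΓD κ) :
    (energyForm hΩ ΓR hκ x x).re =
      ‖weakGrad (toFunctionL Ω ΓD κ x)‖ ^ 2 - κ ^ 2 * ‖toFunctionL Ω ΓD κ x‖ ^ 2 := by
  rw [energyForm_apply, form, inner_self_eq_norm_sq_to_K, inner_self_eq_norm_sq_to_K]
  have h1 := robinForm_self_im (ΓR := ΓR) (trace (toFunctionL Ω ΓD κ x))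
  rw [robinForm] at h1
  have h2 (r s : ℝ) (z : ℂ) (hz : z.im = 0) :
      (((r : ℂ) ^ 2 - (κ : ℂ) ^ 2 * (s : ℂ) ^ 2) - Complex.I * κ * z).re =
        r ^ 2 - κ ^ 2 * s ^ 2 := by
    have : ((r : ℂ) ^ 2 - (κ : ℂ) ^ 2 * (s : ℂ) ^ 2) = ((r ^ 2 - κ ^ 2 * s ^ 2 : ℝ) : ℂ) := by
      push_cast; ring
    rw [this, Complex.sub_re, Complex.ofReal_re, Complex.mul_re, hz]
    simp
  exact h2 _ _ _ h1

end Helmholtz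

end

noncomputable section

namespace Helmholtz

variable {d : ℕ} {Ω ΓD ΓR : Set (Pt d)} {κ : ℝ} {K : Geometry.SimplicialComplex ℝ (Pt d)}

/-! ### The spaces of the method in the energy space -/

/-- The remainder space as a subspace of the energy space. -/
def remainderSpace (hM : IsMesh Ω ΓD K) (κ : ℝ) : Submodule ℂ (energySpace Ω ΓD κ) :=
  LinearMap.ker ((interpL hM).comp (toFunctionL Ω ΓD κ) : energySpace Ω ΓD κ →ₗ[ℂ] L2 Ω)

lemma isClosed_remainderSpace (hM : IsMesh Ω ΓD K) :
    IsClosed (remainderSpace hM κ : Set (energySpace Ω ΓD κ)) :=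
  ContinuousLinearMap.isClosed_ker ((interpL hM).comp (toFunctionL Ω ΓD κ))

lemma mem_remainderSpace (hM : IsMesh Ω ΓD K) {x : energySpace Ω ΓD κ} :
    x ∈ remainderSpace hM κ ↔ interpL hM (toFunctionL Ω ΓD κ x) = 0 := Iff.rfl

lemma mem_remainderSpace_iff (hΩ : IsLipschitzDomain Ω) (hM : IsMesh Ω ΓD K) (hκ : 0 < κ)
    {x : energySpace Ω ΓD κ} :
    x ∈ remainderSpace hM κ ↔ toFunctionL Ω ΓD κ x ∈ W Ω ΓD K := by
  rw [mem_remainderSpace, ← interp_eq hΩ hM]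
  exact ⟨fun h => ⟨toFunctionL_mem_V hΩ hκ x, h⟩, fun h => h.2⟩

/-- The finite element space as a subspace of the energy space. -/
def feSpace (Ω ΓD : Set (Pt d)) (K : Geometry.SimplicialComplex ℝ (Pt d)) (κ : ℝ) :
    Submodule ℂ (energySpace Ω ΓD κ) :=
  (hatSpan Ω ΓD K).comap (toFunctionL Ω ΓD κ : energySpace Ω ΓD κ →ₗ[ℂ] L2 Ω)

lemma finiteDimensional_feSpace (hΩ : IsLipschitzDomain Ω) (hM : IsMesh Ω ΓD K) (hκ : 0 < κ) :
    FiniteDimensional ℂ (feSpace Ω ΓD K κ) := by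
  have := finiteDimensional_hatSpan hM
  let f : feSpace Ω ΓD K κ →ₗ[ℂ] hatSpan Ω ΓD K :=
    (toFunctionL Ω ΓD κ : energySpace Ω ΓD κ →ₗ[ℂ] L2 Ω).restrict fun x hx => hx
  refine Module.Finite.of_injective f fun x y hxy => ?_
  exact Subtype.ext (injective_toFunctionL hΩ hκ (congrArg Subtype.val hxy))

lemma add_mem_V (hΩ : IsLipschitzDomain Ω) {u v : L2 Ω} (hu : u ∈ V Ω ΓD) (hv : v ∈ V Ω ΓD) :
    u + v ∈ V Ω ΓD := by
  obtain ⟨x, rfl⟩ := exists_toFunctionL_eq hΩ one_pos hu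
  obtain ⟨y, rfl⟩ := exists_toFunctionL_eq hΩ one_pos hv
  rw [← map_add]
  exact toFunctionL_mem_V hΩ one_pos _

lemma smul_mem_V (hΩ : IsLipschitzDomain Ω) (c : ℂ) {u : L2 Ω} (hu : u ∈ V Ω ΓD) :
    c • u ∈ V Ω ΓD := by
  obtain ⟨x, rfl⟩ := exists_toFunctionL_eq hΩ one_pos hu
  rw [← map_smul]
  exact toFunctionL_mem_V hΩ one_pos _

/-- This inclusion is all that is needed: the test functions are built from hat functions, while
trial functions are used only as members of `V` orthogonal to `W`. -/
lemma mem_VH_of_mem_hatSpan (hΩ : IsLipschitzDomain Ω) (hM : IsMesh Ω ΓD K) {v : L2 Ω}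
    (hv : v ∈ hatSpan Ω ΓD K) : v ∈ VH Ω ΓD K := by
  refine Submodule.span_induction (p := fun v _ => v ∈ VH Ω ΓD K) ?_ ?_ ?_ ?_ hv
  · rintro _ ⟨z, hz, rfl⟩
    exact hatL2_mem_VH hΩ hM hz
  · refine ⟨?_, fun T _ => ⟨0, ?_⟩⟩
    · rw [← map_zero (toFunctionL Ω ΓD 1)]
      exact toFunctionL_mem_V hΩ one_pos _
    · filter_upwards [Lp.coeFn_zero ℂ 2 (volume.restrict Ω)] with x hx _
      exact hx
  · rintro u v - - ⟨hu, hu'⟩ ⟨hv, hv'⟩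
    refine ⟨add_mem_V hΩ hu hv, fun T hT => ?_⟩
    obtain ⟨p, hp⟩ := hu' T hT
    obtain ⟨q, hq⟩ := hv' T hT
    refine ⟨p + q, ?_⟩
    filter_upwards [hp, hq, Lp.coeFn_add u v] with x h1 h2 h3 hx
    rw [h3, Pi.add_apply, h1 hx, h2 hx]
    rfl
  · rintro c u - ⟨hu, hu'⟩
    refine ⟨smul_mem_V hΩ c hu, fun T hT => ?_⟩
    obtain ⟨p, hp⟩ := hu' T hT
    refine ⟨c • p, ?_⟩
    filter_upwards [hp, Lp.coeFn_smul c u] with x h1 h3 hx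
    rw [h3, Pi.smul_apply, h1 hx]
    rfl

/-- The interpolation operator is injective on the finite-dimensional span of the hat functions,
hence onto it; some s in the span has the same interpolant as x. The operator need not be a
projection. -/
lemma exists_mem_feSpace_sub_mem (hΩ : IsLipschitzDomain Ω) (hM : IsMesh Ω ΓD K) (hκ : 0 < κ)
    (x : energySpace Ω ΓD κ) : ∃ s ∈ feSpace Ω ΓD K κ, x - s ∈ remainderSpace hM κ := by
  have := finiteDimensional_hatSpan hM
  let f : hatSpan Ω ΓD K →ₗ[ℂ] hatSpan Ω ΓD K :=
    (interpL hM : L2 Ω →ₗ[ℂ] L2 Ω).restrict fun v _ => interpL_mem_hatSpan hM v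
  have hf : Function.Injective f := by
    rw [injective_iff_map_eq_zero]
    exact fun v hv => Subtype.ext
      (eq_zero_of_interpL_eq_zero hΩ hM v.2 (congrArg Subtype.val hv))
  obtain ⟨p, hp⟩ := LinearMap.injective_iff_surjective.1 hf
    ⟨interpL hM (toFunctionL Ω ΓD κ x), interpL_mem_hatSpan hM _⟩
  have hp' : interpL hM (p : L2 Ω) = interpL hM (toFunctionL Ω ΓD κ x) := congrArg Subtype.val hp
  obtain ⟨s, hs⟩ := exists_toFunctionL_eq hΩ hκ (mem_VH_of_mem_hatSpan hΩ hM p.2).1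
  refine ⟨s, ?_, ?_⟩
  · change toFunctionL Ω ΓD κ s ∈ hatSpan Ω ΓD K
    rw [hs]
    exact p.2
  · rw [mem_remainderSpace, map_sub, map_sub, hs, hp', sub_self]

lemma eq_zero_of_mem_feSpace (hΩ : IsLipschitzDomain Ω) (hM : IsMesh Ω ΓD K) (hκ : 0 < κ)
    {x : energySpace Ω ΓD κ} (hx : x ∈ feSpace Ω ΓD K κ) (hx' : x ∈ remainderSpace hM κ) :
    x = 0 := by
  refine injective_toFunctionL hΩ hκ ?_
  rw [map_zero]
  exact eq_zero_of_interpL_eq_zero hΩ hM hx hx'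


lemma norm_energyForm_le (hΩ : IsLipschitzDomain Ω) (hκ : 0 < κ) {Ca : ℝ}
    (hCa : IsContinuityConst Ω ΓD ΓR κ Ca) (x y : energySpace Ω ΓD κ) :
    ‖energyForm hΩ ΓR hκ x y‖ ≤ Ca * ‖x‖ * ‖y‖ := by
  rw [energyForm_apply, norm_eq_normV hΩ hκ, norm_eq_normV hΩ hκ]
  exact hCa _ (toFunctionL_mem_V hΩ hκ x) _ (toFunctionL_mem_V hΩ hκ y)

/-- With A = κ²‖w‖² and B = ‖∇w‖², the bound A + B ≤ 3(B - A) is exactly 2A ≤ B. -/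
lemma norm_sq_le_energyForm (hd : 1 ≤ d) (hΩ : IsLipschitzDomain Ω) (hM : IsMesh Ω ΓD K)
    (hκ : 0 < κ) {CI : ℝ} (hCI : IsInterpConst Ω ΓD K CI)
    (hres : meshSize K * κ ≤ 1 / (√(2 * (overlap K : ℝ)) * CI)) {w : energySpace Ω ΓD κ}
    (hw : w ∈ remainderSpace hM κ) : ‖w‖ ^ 2 ≤ 3 * (energyForm hΩ ΓR hκ w w).re := by
  have h := norm_sq_le_of_mem_W hd hΩ hM hκ hCI hres ((mem_remainderSpace_iff hΩ hM hκ).1 hw)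
  rw [energyForm_self_re, norm_eq_normV hΩ hκ, normV_sq]
  linarith

/-- Unique solvability of the corrector problems. -/
lemma existsUnique_isCorrector (hd : 1 ≤ d) (hΩ : IsLipschitzDomain Ω) (hM : IsMesh Ω ΓD K)
    (hκ : 0 < κ) {Ca CI : ℝ} (hCa : IsContinuityConst Ω ΓD ΓR κ Ca)
    (hCI : IsInterpConst Ω ΓD K CI)
    (hres : meshSize K * κ ≤ 1 / (√(2 * (overlap K : ℝ)) * CI)) {v : L2 Ω} (hv : v ∈ V Ω ΓD) :
    (∃! c, IsCorrector ΓD ΓR K κ v c) ∧ ∃! c, IsAdjointCorrector ΓD ΓR K κ v c := by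
  have := completeSpace_energySpace (ΓD := ΓD) hΩ hκ
  obtain ⟨x, rfl⟩ := exists_toFunctionL_eq hΩ hκ hv
  have hb := norm_energyForm_le hΩ hκ hCa
  have hco (w) (hw : w ∈ remainderSpace hM κ) :=
    norm_sq_le_energyForm (ΓR := ΓR) hd hΩ hM hκ hCI hres hw
  have hmem {w : L2 Ω} (hw : w ∈ W Ω ΓD K) :
      ∃ y ∈ remainderSpace hM κ, toFunctionL Ω ΓD κ y = w := by
    obtain ⟨y, rfl⟩ := exists_toFunctionL_eq hΩ hκ hw.1
    exact ⟨y, (mem_remainderSpace_iff hΩ hM hκ).2 hw, rfl⟩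
  have hmem' {y : energySpace Ω ΓD κ} (hy : y ∈ remainderSpace hM κ) :=
    (mem_remainderSpace_iff hΩ hM hκ).1 hy
  constructor
  · obtain ⟨c, ⟨hc, hcw⟩, huniq⟩ := existsUnique_corrector (isClosed_remainderSpace hM) hb hco x
    simp only [energyForm_apply] at hcw huniq
    refine ⟨toFunctionL Ω ΓD κ c, ⟨hmem' hc, fun w hw => ?_⟩, fun c' ⟨h1, h2⟩ => ?_⟩
    · obtain ⟨y, hy, rfl⟩ := hmem hw
      exact hcw y hy
    · obtain ⟨y, hy, rfl⟩ := hmem h1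
      rw [huniq y ⟨hy, fun w hw => h2 _ (hmem' hw)⟩]
  · obtain ⟨c, ⟨hc, hcw⟩, huniq⟩ :=
      existsUnique_adjointCorrector (isClosed_remainderSpace hM) hb hco x
    simp only [energyForm_apply] at hcw huniq
    refine ⟨toFunctionL Ω ΓD κ c, ⟨hmem' hc, fun w hw => ?_⟩, fun c' ⟨h1, h2⟩ => ?_⟩
    · obtain ⟨y, hy, rfl⟩ := hmem hw
      exact hcw y hy
    · obtain ⟨y, hy, rfl⟩ := hmem h1
      rw [huniq y ⟨hy, fun w hw => h2 _ (hmem' hw)⟩]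

/-- A solution of the adjoint Helmholtz problem with right-hand side `κ² u`. -/
lemma exists_adjoint_solution (hd : 1 ≤ d) (hΩ : IsLipschitzDomain Ω) (hM : IsMesh Ω ΓD K)
    (hκ : 0 < κ) {Ca Cst CI : ℝ} (hCa : IsContinuityConst Ω ΓD ΓR κ Ca)
    (hCst : IsStabilityConst Ω ΓD ΓR κ Cst) (hCI : IsInterpConst Ω ΓD K CI)
    (hres : meshSize K * κ ≤ 1 / (√(2 * (overlap K : ℝ)) * CI)) (u : energySpace Ω ΓD κ) :
    ∃ z : energySpace Ω ΓD κ, (energyForm hΩ ΓR hκ u z).re = (κ * ‖toFunctionL Ω ΓD κ u‖) ^ 2 ∧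
      ‖z‖ ≤ Cst * κ * (κ * ‖toFunctionL Ω ΓD κ u‖) := by
  have := completeSpace_energySpace (ΓD := ΓD) hΩ hκ
  have := finiteDimensional_feSpace hΩ hM hκ
  have huV := toFunctionL_mem_V hΩ hκ u
  -- Uniqueness is the stability estimate with zero data.
  have hinj (x : energySpace Ω ΓD κ) (hx : ∀ y, energyForm hΩ ΓR hκ x y = 0) : x = 0 := by
    have h := hCst 0 _ (toFunctionL_mem_V hΩ hκ x) fun v hv => by
      obtain ⟨y, rfl⟩ := exists_toFunctionL_eq hΩ hκ hv
      rw [← energyForm_apply hΩ hκ, hx, inner_zero_right]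
    rw [norm_zero, mul_zero, ← norm_eq_normV hΩ hκ] at h
    exact norm_le_zero_iff.1 h
  set f : L2 Ω := (κ : ℂ) ^ 2 • conjLp (toFunctionL Ω ΓD κ u) with hf
  obtain ⟨ζ, hζ⟩ := exists_solution (isClosed_remainderSpace hM) (norm_energyForm_le hΩ hκ hCa)
    (fun w hw => norm_sq_le_energyForm (ΓR := ΓR) hd hΩ hM hκ hCI hres hw)
    (exists_mem_feSpace_sub_mem hΩ hM hκ) (fun x hx => eq_zero_of_mem_feSpace hΩ hM hκ hx) hinj
    ((innerSL ℂ f).comp (toFunctionL Ω ΓD κ))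
  have hform (v) (hv : v ∈ V Ω ΓD) : form ΓR κ (toFunctionL Ω ΓD κ ζ) v = inner ℂ v f := by
    obtain ⟨y, rfl⟩ := exists_toFunctionL_eq hΩ hκ hv
    have h := congrArg (starRingEnd ℂ) (hζ y)
    rw [conjForm_apply, Complex.conj_conj, energyForm_apply] at h
    rw [h]
    exact inner_conj_symm (𝕜 := ℂ) _ f
  have hζV := toFunctionL_mem_V hΩ hκ ζ
  -- The adjoint solution is the conjugate of the primal solution ζ with the conjugated data f;
  -- conjugation preserves the energy norm.
  obtain ⟨z, hz⟩ := exists_toFunctionL_eq hΩ hκ (conj_mem_V hΩ hζV)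
  refine ⟨z, ?_, ?_⟩
  · rw [energyForm_apply, hz, form_conj hΩ huV hζV, hform _ (conj_mem_V hΩ huV), hf,
      inner_smul_right, inner_self_eq_norm_sq_to_K, norm_conjLp, mul_pow]
    have h (r : ℝ) : ((κ : ℂ) ^ 2 * (r : ℂ) ^ 2).re = κ ^ 2 * r ^ 2 := by
      rw [← Complex.ofReal_pow, ← Complex.ofReal_pow, ← Complex.ofReal_mul, Complex.ofReal_re]
    exact h _
  · rw [norm_eq_normV hΩ hκ, hz, normV_conj hΩ hζV]
    refine (hCst f _ hζV hform).trans_eq ?_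
    rw [hf, norm_smul, norm_conjLp, norm_pow, Complex.norm_real, Real.norm_of_nonneg hκ.le]
    ring

/-- The inf-sup stability of the ideal method. -/
lemma le_infSup (hd : 1 ≤ d) (hΩ : IsLipschitzDomain Ω) (hM : IsMesh Ω ΓD K)
    (hκ : 0 < κ) {Ca Cst CI : ℝ} (hCa : IsContinuityConst Ω ΓD ΓR κ Ca)
    (hCst : IsStabilityConst Ω ΓD ΓR κ Cst) (hCI : IsInterpConst Ω ΓD K CI)
    (hres : meshSize K * κ ≤ 1 / (√(2 * (overlap K : ℝ)) * CI)) (hs : 1 ≤ Cst * κ) :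
    ((1 / (2 * (3 * Ca) * Cst * κ) : ℝ) : EReal) ≤
      infSup ΓR κ (trialSpace Ω ΓD ΓR K κ) (testSpace Ω ΓD ΓR K κ) := by
  have := completeSpace_energySpace (ΓD := ΓD) hΩ hκ
  refine le_iInf₂ fun u hu => ?_
  obtain ⟨⟨v, hv, c, hc, rfl⟩, hu0⟩ := hu
  obtain ⟨y, rfl⟩ := exists_toFunctionL_eq hΩ hκ hv.1
  obtain ⟨e, rfl⟩ := exists_toFunctionL_eq hΩ hκ hc.1.1
  rw [← map_sub] at hu0 ⊢
  have hx0 : y - e ≠ 0 := by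
    intro h
    rw [h, map_zero] at hu0
    exact hu0 rfl
  have huW (w) (hw : w ∈ remainderSpace hM κ) : energyForm hΩ ΓR hκ (y - e) w = 0 := by
    rw [map_sub, LinearMap.sub_apply, energyForm_apply, energyForm_apply,
      hc.2 _ ((mem_remainderSpace_iff hΩ hM hκ).1 hw), sub_self]
  -- From here only orthogonality to `W` matters, not how the trial function was built.
  generalize y - e = x at hu0 hx0 huW ⊢
  obtain ⟨z, hz, hz'⟩ := exists_adjoint_solution hd hΩ hM hκ hCa hCst hCI hres x
  have hxx : (energyForm hΩ ΓR hκ x x).re =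
      ‖x‖ ^ 2 - 2 * (κ * ‖toFunctionL Ω ΓD κ x‖) ^ 2 := by
    rw [energyForm_self_re, norm_eq_normV hΩ hκ, normV_sq]
    ring
  obtain ⟨p, hp, q, hq, hqp, hpq, hle⟩ := exists_test_function (norm_energyForm_le hΩ hκ hCa)
    (fun w hw => norm_sq_le_energyForm (ΓR := ΓR) hd hΩ hM hκ hCI hres hw)
    (one_le_three_mul_continuityConst hd hΩ hκ hCa) (isClosed_remainderSpace hM)
    (exists_mem_feSpace_sub_mem hΩ hM hκ) hx0 huW hxx hz hz' (by positivity) hs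
  have hmem : toFunctionL Ω ΓD κ (p - q) ∈ testSpace Ω ΓD ΓR K κ \ {0} := by
    refine ⟨⟨_, mem_VH_of_mem_hatSpan hΩ hM hp, _, ⟨(mem_remainderSpace_iff hΩ hM hκ).1 hq,
      fun w hw => ?_⟩, map_sub _ _ _⟩, fun h => hpq (injective_toFunctionL hΩ hκ ?_)⟩
    · obtain ⟨w, rfl⟩ := exists_toFunctionL_eq hΩ hκ hw.1
      have h := hqp w ((mem_remainderSpace_iff hΩ hM hκ).2 hw)
      rwa [energyForm_apply, energyForm_apply] at h
    · rw [map_zero]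
      exact h
  refine le_iSup₂_of_le _ hmem (EReal.coe_le_coe_iff.2 ?_)
  rw [← energyForm_apply hΩ hκ, ← norm_eq_normV hΩ hκ, ← norm_eq_normV hΩ hκ, mul_assoc _ Cst κ]
  exact hle

end Helmholtz

end

/-! ### The stability theorem -/

theorem mainTheorem6 (d : ℕ) (hd1 : 1 ≤ d) (hd3 : d ≤ 3) (Ω : Set (Helmholtz.Pt d))
    (hΩ : Helmholtz.IsLipschitzDomain Ω) :
    ∃ κ₀ : ℝ, 0 < κ₀ ∧
      ∀ (ΓD ΓN ΓR : Set (Helmholtz.Pt d)), Helmholtz.IsBoundaryPartition Ω ΓD ΓN ΓR →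
      ∀ (K : Geometry.SimplicialComplex ℝ (Helmholtz.Pt d)), Helmholtz.IsMesh Ω ΓD K →
      ∀ (κ Ca Cst CI : ℝ), 0 < κ →
        Helmholtz.IsContinuityConst Ω ΓD ΓR κ Ca →
        Helmholtz.IsStabilityConst Ω ΓD ΓR κ Cst →
        Helmholtz.IsInterpConst Ω ΓD K CI →
        Helmholtz.meshSize K * κ ≤ 1 / (√(2 * (Helmholtz.overlap K : ℝ)) * CI) →
        (∀ v ∈ Helmholtz.V Ω ΓD,
          (∃! c, Helmholtz.IsCorrector ΓD ΓR K κ v c) ∧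
          (∃! c, Helmholtz.IsAdjointCorrector ΓD ΓR K κ v c)) ∧
        (κ₀ ≤ κ ∨ 1 ≤ Cst * κ →
          ((1 / (2 * (3 * Ca) * Cst * κ) : ℝ) : EReal) ≤
            Helmholtz.infSup ΓR κ (Helmholtz.trialSpace Ω ΓD ΓR K κ)
              (Helmholtz.testSpace Ω ΓD ΓR K κ)) := by
  obtain ⟨κ₀, hκ₀, h⟩ := Helmholtz.exists_forall_one_le_stabilityConst_mul hd1 hΩ
  refine ⟨κ₀, hκ₀, fun ΓD ΓN ΓR _ K hM κ Ca Cst CI hκ hCa hCst hCI hres => ⟨fun v hv =>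
    Helmholtz.existsUnique_isCorrector hd1 hΩ hM hκ hCa hCI hres hv, fun hs => ?_⟩⟩
  -- Either alternative gives 1 ≤ Cst * κ; for κ ≥ κ₀ this is the lower bound on the stability
  -- constant.
  exact Helmholtz.le_infSup hd1 hΩ hM hκ hCa hCst hCI hres (hs.elim (h ΓD ΓR κ Cst · hCst) id)
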